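/- **Corollary (optimizing bounded-degree $k$-local Hamiltonians).** For $P\in\{I,X,Y,Z\}^{\otimes n}$ let $|P|$ be the number of tensor factors of $P$ different from $I$. An $n$-qubit $k$-local Hamiltonian $H=\sum_{P:|P|\le k}\alpha_P P$ ($\alpha_P\in\mathbb{R}$) has degree at most $d$ if $H=\sum_j h_j$ is a sum of finitely many $k$-qubit observables (Hermitian operators each acting on at most $k$ qubits) such that each qubit is acted on by at most $d$ of the $h_j$. For every fixed $k$ there are a constant $C>0$ and a randomized algorithm, both depending only on $k$, such that the following holds for all $n,d\ge 1$ and every $n$-qubit $k$-local Hamiltonian $H=\sum_{P:|P|\le k}\alpha_P P$ of degree at most $d$ with $|\alpha_P|\le 1$ for all $P$. Given $n$ and the list, in any order, of the Pauli terms of $H$ with nonzero coefficient (each as its list of pairs (qubit, Pauli matrix) and its coefficient), the algorithm always halts within $O(nd)$ steps, where the implied constant depends only on $k$, and outputs a random product state $|\psi\rangle=|\psi_1\rangle\otimes\cdots\otimes|\psi_n\rangle$ of $n$ single-qubit pure states, which is either a random maximizing state satisfying $$\mathbb{E}_{|\psi\rangle}\big[\langle\psi|H|\psi\rangle\big]\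 \ge\ \mathbb{E}_{|\phi\rangle:\mathrm{Haar}}\big[\langle\phi|H|\phi\rangle\big]+\frac{C}{\sqrt d}\sum_{P\ne I}|\alpha_P|,$$ or a random minimizing state satisfying $$\mathbb{E}_{|\psi\rangle}\big[\langle\psi|H|\psi\rangle\big]\ \le\ \mathbb{E}_{|\phi\rangle:\mathrm{Haar}}\big[\langle\phi|H|\phi\rangle\big]-\frac{C}{\sqrt d}\sum_{P\ne I}|\alpha_P| .$$ Here $|\phi\rangle$ is a Haar-random state of the $n$ qubits, and which of the two alternatives holds may depend on the input. Moreover this margin is at least the one of the form guaranteed by Anshu, Gosset, Morenz Korol and Soleimanifar: $$\frac{C}{\sqrt d}\sum_{P\ne I}|\alpha_P|\ \ge\ \frac{C}{d}\Big(\sum_{P\ne I}|\alpha_P|^2\Big)\cdot\frac{\sum_{P\ne I}|\alpha_P|^2}{\#\{P\ne I:\alpha_P\ne 0\}}$$ (the right-hand side being read as $0$ if $\alpha_P=0$ for all $P\neq I$). The model of computation is a randomized real random-access machine with unit costs: cells holding natural numbers (assignment of constants, addition, truncated subtraction, comparison, indirect addressing) and cells holding real numbers (assignment of integer constants, $+,-,\times,/,\sqrt{\cdot}$,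 comparison), random access to the input and to the output, and an instruction that draws a fresh independent uniform random real in $[0,1]$; each executed instruction or test is one step. The output consists of the two complex amplitudes of each $|\psi_i\rangle$. -/

import Mathlib

open MeasureTheory

namespace LocalHam

/-! ### Pauli operators, Hamiltonians and energies -/

/-- The four single-qubit Pauli labels. -/
inductive Pauli
  | I
  | X
  | Y
  | Z
deriving DecidableEq

instance : Fintype Pauli where
  elems := {Pauli.I, Pauli.X, Pauli.Y, Pauli.Z}
  complete := fun p => by cases p <;> decide

/-- The single-qubit Pauli matrices. -/
def Pauli.mat : Pauli → Matrix (Fin 2) (Fin 2) ℂ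
  | .I => !![1, 0; 0, 1]
  | .X => !![0, 1; 1, 0]
  | .Y => !![0, -Complex.I; Complex.I, 0]
  | .Z => !![1, 0; 0, -1]

/-- Labels of the computational basis of `n` qubits. -/
abbrev Bits (n : ℕ) : Type := Fin n → Fin 2

/-- Operators on `n` qubits, written in the computational basis. -/
abbrev Op (n : ℕ) : Type := Matrix (Bits n) (Bits n) ℂ

/-- `n`-qubit Pauli strings. -/
abbrev PauliString (n : ℕ) : Type := Fin n → Pauli

/-- The all-identity Pauli string. -/
def identityString (n : ℕ) : PauliString n := fun _ => Pauli.I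

/-- The operator `P₁ ⊗ ⋯ ⊗ Pₙ`. -/
def pauliOp {n : ℕ} (P : PauliString n) : Op n :=
  Matrix.of fun x y => ∏ i, (P i).mat (x i) (y i)

/-- The weight `|P|`: the number of qubits on which `P` acts nontrivially. -/
def weight {n : ℕ} (P : PauliString n) : ℕ :=
  (Finset.univ.filter fun i => P i ≠ Pauli.I).card

/-- The Hermitian operator `∑_P α_P P` with real Pauli coefficients `α`. -/
noncomputable def hamiltonian {n : ℕ} (α : PauliString n → ℝ) : Op n :=
  ∑ P, (α P : ℂ) • pauliOp P

/-- Only Pauli strings of weight at most `k` have a nonzero coefficient. -/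
def IsLocal {n : ℕ} (k : ℕ) (α : PauliString n → ℝ) : Prop :=
  ∀ P, α P ≠ 0 → weight P ≤ k

/-- `h` acts only on the qubits in `S`, that is, `h = A ⊗ 1` with `A` an operator on the qubits
in `S` and `1` the identity on the others. -/
def ActsOnlyOn {n : ℕ} (S : Finset (Fin n)) (h : Op n) : Prop :=
  ∃ A : Matrix (S → Fin 2) (S → Fin 2) ℂ, ∀ x y : Bits n,
    h x y = if ∀ i, i ∉ S → x i = y i then A (fun i => x i) (fun i => y i) else 0

/-- `H` is a sum of `k`-qubit observables such that each qubit is acted on by at most `d` of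
them. -/
def HasDegreeAtMost {n : ℕ} (k d : ℕ) (H : Op n) : Prop :=
  ∃ (m : ℕ) (S : Fin m → Finset (Fin n)) (h : Fin m → Op n),
    (∀ j, (h j).IsHermitian) ∧ (∀ j, (S j).card ≤ k) ∧ (∀ j, ActsOnlyOn (S j) (h j)) ∧
    H = ∑ j, h j ∧ ∀ i : Fin n, (Finset.univ.filter fun j => i ∈ S j).card ≤ d

/-- The energy `⟨ψ|H|ψ⟩` (a real number for Hermitian `H`). -/
noncomputable def energy {n : ℕ} (H : Op n) (ψ : Bits n → ℂ) : ℝ :=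
  (star ψ ⬝ᵥ H.mulVec ψ).re

/-- The product vector `ψ₁ ⊗ ⋯ ⊗ ψₙ`. -/
def productState {n : ℕ} (ψ : Fin n → Fin 2 → ℂ) : Bits n → ℂ :=
  fun x => ∏ i, ψ i (x i)

/-- The law of a Haar-random pure state of `n` qubits: the normalized surface measure on the unit
sphere of `ℂ^(2^n)`. -/
noncomputable def haarState (n : ℕ) :
    Measure (Metric.sphere (0 : EuclideanSpace ℂ (Bits n)) 1) :=
  ((volume : Measure (EuclideanSpace ℂ (Bits n))).toSphere Set.univ)⁻¹ •
    (volume : Measure (EuclideanSpace ℂ (Bits n))).toSphere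

/-- The average energy of `H` over Haar-random states. -/
noncomputable def haarEnergy {n : ℕ} (H : Op n) : ℝ :=
  ∫ φ, energy H (fun x => (φ : EuclideanSpace ℂ (Bits n)) x) ∂(haarState n)

/-! ### A randomized real random-access machine with unit costs

The machine has a read-only input (a list of natural numbers and a list of reals), a work memory
of natural-number cells `N[0], N[1], …` and real cells `R[0], R[1], …`, all initially `0`, a
write-only output array of reals, and a source of independent uniform random reals in `[0,1]`.
There is no rounding of reals to integers and no multiplication of integers. -/

/-- A source of random reals in `[0,1]`. -/
abbrev Tape : Type := ℕ → unitInterval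

/-- The law of the random source: independent uniform draws. -/
noncomputable def tapeLaw : Measure Tape :=
  Measure.infinitePi fun _ : ℕ => (volume : Measure unitInterval)

/-- The input of the machine. -/
structure Input where
  nats : List ℕ
  reals : List ℝ

/-- A configuration: work memory, output array, and the number of random reals used so far. -/
structure Config where
  N : ℕ → ℕ
  R : ℕ → ℝ
  out : ℕ → ℝ
  drawn : ℕ

/-- The initial configuration. -/
def Config.init : Config := ⟨fun _ => 0, fun _ => 0, fun _ => 0, 0⟩

/-- The elementary instructions; `Instr.exec` gives their effect. -/
inductive Instr
  | natConst (a c : ℕ)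
  | natAdd (a b c : ℕ)
  | natSub (a b c : ℕ)
  | natLoad (a b : ℕ)
  | natStore (a b : ℕ)
  | natInput (a b : ℕ)
  | realConst (a : ℕ) (c : ℤ)
  | realAdd (a b c : ℕ)
  | realSub (a b c : ℕ)
  | realMul (a b c : ℕ)
  | realDiv (a b c : ℕ)
  | realSqrt (a b : ℕ)
  | realLoad (a b : ℕ)
  | realStore (a b : ℕ)
  | realInput (a b : ℕ)
  | realRandom (a : ℕ)
  | write (a b : ℕ)

/-- The effect of an instruction. -/
noncomputable def Instr.exec (inp : Input) (ω : Tape) (s : Config) : Instr → Config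
  | .natConst a c => { s with N := Function.update s.N a c }
  | .natAdd a b c => { s with N := Function.update s.N a (s.N b + s.N c) }
  | .natSub a b c => { s with N := Function.update s.N a (s.N b - s.N c) }
  | .natLoad a b => { s with N := Function.update s.N a (s.N (s.N b)) }
  | .natStore a b => { s with N := Function.update s.N (s.N a) (s.N b) }
  | .natInput a b => { s with N := Function.update s.N a (inp.nats.getD (s.N b) 0) }
  | .realConst a c => { s with R := Function.update s.R a (c : ℝ) }
  | .realAdd a b c => { s with R := Function.update s.R a (s.R b + s.R c) }
  | .realSub a b c => { s with R := Function.update s.R a (s.R b - s.R c) }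
  | .realMul a b c => { s with R := Function.update s.R a (s.R b * s.R c) }
  | .realDiv a b c => { s with R := Function.update s.R a (s.R b / s.R c) }
  | .realSqrt a b => { s with R := Function.update s.R a (Real.sqrt (s.R b)) }
  | .realLoad a b => { s with R := Function.update s.R a (s.R (s.N b)) }
  | .realStore a b => { s with R := Function.update s.R (s.N a) (s.R b) }
  | .realInput a b => { s with R := Function.update s.R a (inp.reals.getD (s.N b) 0) }
  | .realRandom a =>
      { s with R := Function.update s.R a (ω s.drawn : ℝ), drawn := s.drawn + 1 }
  | .write a b => { s with out := Function.update s.out (s.N a) (s.R b) }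

/-- The tests on which a program can branch: comparison of two natural-number cells, or of two
real cells. -/
inductive Test
  | natLt (a b : ℕ)
  | realLt (a b : ℕ)

/-- The outcome of a test. -/
def Test.holds (s : Config) : Test → Prop
  | .natLt a b => s.N a < s.N b
  | .realLt a b => s.R a < s.R b

/-- Programs. -/
inductive Program
  | instr (i : Instr)
  | seq (p q : Program)
  | ifThenElse (b : Test) (p q : Program)
  | whileDo (b : Test) (p : Program)

/-- `Runs inp ω p s s' t`: on input `inp` with random source `ω`, program `p` started in `s` halts
in `s'` after exactly `t` steps. Each executed instruction and each evaluated test is one step. -/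
inductive Runs (inp : Input) (ω : Tape) : Program → Config → Config → ℕ → Prop
  | instr (i : Instr) (s : Config) : Runs inp ω (.instr i) s (i.exec inp ω s) 1
  | seq {p q : Program} {s s' s'' : Config} {t t' : ℕ} :
      Runs inp ω p s s' t → Runs inp ω q s' s'' t' → Runs inp ω (.seq p q) s s'' (t + t')
  | ifTrue {b : Test} {p q : Program} {s s' : Config} {t : ℕ} :
      b.holds s → Runs inp ω p s s' t → Runs inp ω (.ifThenElse b p q) s s' (t + 1)
  | ifFalse {b : Test} {p q : Program} {s s' : Config} {t : ℕ} :
      ¬ b.holds s → Runs inp ω q s s' t → Runs inp ω (.ifThenElse b p q) s s' (t + 1)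
  | whileTrue {b : Test} {p : Program} {s s' s'' : Config} {t t' : ℕ} :
      b.holds s → Runs inp ω p s s' t → Runs inp ω (.whileDo b p) s' s'' t' →
      Runs inp ω (.whileDo b p) s s'' (t + t' + 1)
  | whileFalse {b : Test} {p : Program} {s : Config} :
      ¬ b.holds s → Runs inp ω (.whileDo b p) s s 1

/-- The final configuration and the number of steps are determined by the input and the random
source. -/
theorem Runs.deterministic {inp : Input} {ω : Tape} {p : Program} {s s₁ s₂ : Config} {t₁ t₂ : ℕ}
    (h₁ : Runs inp ω p s s₁ t₁) (h₂ : Runs inp ω p s s₂ t₂) : s₁ = s₂ ∧ t₁ = t₂ := by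
  induction h₁ generalizing s₂ t₂ with
  | instr i s => cases h₂; exact ⟨rfl, rfl⟩
  | seq _ _ ih ih' =>
    cases h₂ with
    | seq k k' =>
      obtain ⟨rfl, rfl⟩ := ih k
      obtain ⟨rfl, rfl⟩ := ih' k'
      exact ⟨rfl, rfl⟩
  | ifTrue hb _ ih =>
    cases h₂ with
    | ifTrue _ k => obtain ⟨rfl, rfl⟩ := ih k; exact ⟨rfl, rfl⟩
    | ifFalse hb' _ => exact absurd hb hb'
  | ifFalse hb _ ih =>
    cases h₂ with
    | ifTrue hb' _ => exact absurd hb' hb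
    | ifFalse _ k => obtain ⟨rfl, rfl⟩ := ih k; exact ⟨rfl, rfl⟩
  | whileTrue hb _ _ ih ih' =>
    cases h₂ with
    | whileTrue _ k k' =>
      obtain ⟨rfl, rfl⟩ := ih k
      obtain ⟨rfl, rfl⟩ := ih' k'
      exact ⟨rfl, rfl⟩
    | whileFalse hb' => exact absurd hb hb'
  | whileFalse hb =>
    cases h₂ with
    | whileTrue hb' _ _ => exact absurd hb' hb
    | whileFalse _ => exact ⟨rfl, rfl⟩

/-! ### Encoding of a Hamiltonian as an input, and of a product state as an output -/

/-- The code of a Pauli label. -/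
def Pauli.code : Pauli → ℕ
  | .I => 0
  | .X => 1
  | .Y => 2
  | .Z => 3

/-- A Pauli string in sparse form: its weight, followed by the pairs (qubit, code of the Pauli
label) for the qubits on which it acts nontrivially, in increasing order of the qubits. -/
def encodePauli {n : ℕ} (P : PauliString n) : List ℕ :=
  weight P :: ((List.finRange n).filter fun i => P i ≠ Pauli.I).flatMap
    fun i : Fin n => [i.val, (P i).code]

/-- `L` lists the Pauli strings with nonzero coefficient, each once, in an arbitrary order. -/
def ListsTerms {n : ℕ} (α : PauliString n → ℝ) (L : List (PauliString n)) : Prop :=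
  L.Nodup ∧ ∀ P, P ∈ L ↔ α P ≠ 0

/-- The input describing `∑_P α_P P`: the number of qubits, the number of terms, and the listed
terms in sparse form; and the list of their coefficients. -/
def encodeHamiltonian {n : ℕ} (α : PauliString n → ℝ) (L : List (PauliString n)) : Input where
  nats := n :: L.length :: L.flatMap encodePauli
  reals := L.map α

/-- The `n` single-qubit vectors written on the output array: the real and imaginary parts of the
two amplitudes of qubit `i` are in the cells `4 i, …, 4 i + 3`. -/
noncomputable def outputQubits (n : ℕ) (s : Config) : Fin n → Fin 2 → ℂ :=
  fun i b => (⟨s.out (4 * i + 2 * b), s.out (4 * i + 2 * b + 1)⟩ : ℂ)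

end LocalHam

open LocalHam

namespace LocalHam

set_option linter.constructorNameAsVariable false

/-! ### A memory with named registers and arrays -/

/-! Number the Pauli matrix with code `c` on qubit `i` as the variable `4 i + c`. In a product state
with Bloch vectors `m i` the energy is `α_I + f(m)`, where `f` is multilinear with one monomial of
degree at most `k` for each nonidentity term. The constant `α_I` is the Haar average, because every
other Pauli string changes sign under conjugation by some unitary (`haarEnergy_hamiltonian`). The
Bloch vectors need not have length 1: if all components are at most `1/3` in absolute value, each
qubit can be rounded independently to a random eigenstate of `X`, `Y` or `Z` with this mean, and by
multilinearity the average energy is still `α_I + f(m)` (`integral_energy_rounded`). So it suffices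
to find, without randomness, a point `m` in this cube with `|f(m)| ≥ C/√d · ∑ |α_P|`. The sign of
`f(m)` decides between maximizing and minimizing.

For signs `Y` let `S v` be the sum of `a_t / 6^|t| · ∏_{x ∈ t} Y x` over the terms `t` containing
`v`. Along the line `z ↦ Y x (1 ± z) / 6`, with `±` the sign of `S x`, the value of `f` is a
polynomial in `z` of degree at most `k` with derivative `∑ |S v|` at `0`. By interpolation one of
its values at `1, 1/2, …, 1/(k+1)` is at least a constant times this derivative
(`exists_abs_derivative_le`, `exists_candidate_bound`), and for these `z` the point lies in the
cube.

It remains to choose `Y` with `∑ |S v|` of the order of `∑ √(Q v)`, where `Q v` is the sum of the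
squared coefficients of `S v`. For random signs this follows from a fourth-moment (hypercontractive)
bound. Here it is derandomized: the variables are fixed one at a time, in decreasing order, by
following `potential`, that is `(M - T² / (2Q)) / √Q`. Here `M` is the current sum of squared
coefficients and `T` is the same sum with weights `5^degree / 5^k`. The factor 5 makes the
second-order part of the change of `-T²` nonnegative (`sq_contract_le`), so the total potential does
not decrease if the sign agrees with the first-order part (`sum_potential_contract`). At the start
it is at least `√Q / 2`, and when all variables are fixed it bounds `|S v|` from below
(`half_sqrt_le_potential`, `potential_le_abs`).

A trace argument places the support of each term inside one of the supports of the degree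
decomposition. Hence a variable occurs in at most `4^k d` terms, and there are at most `4^k n d + 1`
terms. Cauchy-Schwarz then compares `∑ √(Q v)` with `∑ |α_P|` at the price of a factor `√d`
(`sum_abs_le_sum_sqrt`).

For the running time, the monomials of `S v` are kept in a trie rooted at `v`, with edges labelled
by increasing variables. When `u` is the largest free variable, the nodes labelled `u` are leaves,
and fixing `Y u` merges each of them into its parent. Each node is merged only once, so the whole
computation takes time linear in `n + m`, where `m` is the number of terms. Programs are verified on
a memory with named registers and arrays (`Represents`) by Hoare-style rules with time bounds
(`Halts`). -/

/-- Names of natural-number registers. -/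
inductive NReg
  | zero | one | two | n | m | size | pos | t | w | p | pp | j | pj | x | v | node | idx | ch
  | cnt | acc | u | i | o | tmp
deriving DecidableEq

/-- Names of natural-number arrays. -/
inductive NArr
  | child | row | root | par | var | head | next
deriving DecidableEq

/-- Names of real registers. -/
inductive RReg
  | zero | one | two | five | six | lam | a | b | c | d | y | tt | best | bt | h | third | twoThirds
  | cX | cY | cZ | mX | mY | mZ | r
deriving DecidableEq

/-- Names of real arrays. -/
inductive RArr
  | S | T | Q | W | Y
deriving DecidableEq

/-- A memory with named registers and arrays. -/
structure Memory where
  nr : NReg → ℕ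
  na : NArr → ℕ → ℕ
  rr : RReg → ℝ
  ra : RArr → ℕ → ℝ
  out : ℕ → ℝ
  drawn : ℕ

/-- The cell of a natural-number register; the cells `0` and `8` are used for addresses. -/
def NReg.cell (r : NReg) : ℕ := 8 * (r.ctorIdx + 2)

/-- The cell of a real register. -/
def RReg.cell (r : RReg) : ℕ := 8 * r.ctorIdx

theorem NReg.cell_injective : Function.Injective NReg.cell := by
  intro r s h
  have : r.ctorIdx = s.ctorIdx := by unfold NReg.cell at h; omega
  revert this
  cases r <;> cases s <;> simp [NReg.ctorIdx]

theorem RReg.cell_injective : Function.Injective RReg.cell := by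
  intro r s h
  have : r.ctorIdx = s.ctorIdx := by unfold RReg.cell at h; omega
  revert this
  cases r <;> cases s <;> simp [RReg.ctorIdx]

theorem NArr.ctorIdx_lt (A : NArr) : A.ctorIdx < 7 := by cases A <;> simp [NArr.ctorIdx]

theorem RArr.ctorIdx_lt (A : RArr) : A.ctorIdx < 7 := by cases A <;> simp [RArr.ctorIdx]

theorem NArr.ctorIdx_injective : Function.Injective NArr.ctorIdx := by
  intro A B; cases A <;> cases B <;> simp [NArr.ctorIdx]

theorem RArr.ctorIdx_injective : Function.Injective RArr.ctorIdx := by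
  intro A B; cases A <;> cases B <;> simp [RArr.ctorIdx]

/-- The cell of entry `i` of an array. -/
def NArr.cell (A : NArr) (i : ℕ) : ℕ := 8 * i + (A.ctorIdx + 1)

/-- The cell of entry `i` of an array. -/
def RArr.cell (A : RArr) (i : ℕ) : ℕ := 8 * i + (A.ctorIdx + 1)

/-- The configuration `c` stores the memory `s`. -/
structure Represents (s : Memory) (c : Config) : Prop where
  nr : ∀ r : NReg, c.N r.cell = s.nr r
  na : ∀ (A : NArr) i, c.N (A.cell i) = s.na A i
  rr : ∀ r : RReg, c.R r.cell = s.rr r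
  ra : ∀ (A : RArr) i, c.R (A.cell i) = s.ra A i
  out : c.out = s.out
  drawn : c.drawn = s.drawn

/-- Registers occupy the residue 0 modulo 8 and the at most seven arrays the residues 1 to 7, so
unbounded arrays coexist without overlap. -/
theorem NArr.cell_ne_reg (A : NArr) (i : ℕ) (r : NReg) : A.cell i ≠ r.cell := by
  have := A.ctorIdx_lt; unfold NArr.cell NReg.cell; omega

theorem RArr.cell_ne_reg (A : RArr) (i : ℕ) (r : RReg) : A.cell i ≠ r.cell := by
  have := A.ctorIdx_lt; unfold RArr.cell RReg.cell; omega

theorem NArr.cell_inj {A B : NArr} {i j : ℕ} : A.cell i = B.cell j ↔ A = B ∧ i = j := by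
  have hA := A.ctorIdx_lt; have hB := B.ctorIdx_lt
  constructor
  · intro h
    unfold NArr.cell at h
    exact ⟨NArr.ctorIdx_injective (by omega), by omega⟩
  · rintro ⟨rfl, rfl⟩; rfl

theorem RArr.cell_inj {A B : RArr} {i j : ℕ} : A.cell i = B.cell j ↔ A = B ∧ i = j := by
  have hA := A.ctorIdx_lt; have hB := B.ctorIdx_lt
  constructor
  · intro h
    unfold RArr.cell at h
    exact ⟨RArr.ctorIdx_injective (by omega), by omega⟩
  · rintro ⟨rfl, rfl⟩; rfl

theorem NReg.cell_ne (r : NReg) : r.cell ≠ 0 ∧ r.cell ≠ 8 := by unfold NReg.cell; omega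

theorem NArr.cell_ne (A : NArr) (i : ℕ) : A.cell i ≠ 0 ∧ A.cell i ≠ 8 := by
  have := A.ctorIdx_lt; unfold NArr.cell; omega

/-- Operations on a memory. -/
inductive MemOp
  | const (r : NReg) (c : ℕ)
  | add (r a b : NReg)
  | sub (r a b : NReg)
  | load (r : NReg) (A : NArr) (i : NReg)
  | store (A : NArr) (i r : NReg)
  | input (r i : NReg)
  | rconst (r : RReg) (c : ℤ)
  | radd (r a b : RReg)
  | rsub (r a b : RReg)
  | rmul (r a b : RReg)
  | rdiv (r a b : RReg)
  | rsqrt (r a : RReg)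
  | rload (r : RReg) (A : RArr) (i : NReg)
  | rstore (A : RArr) (i : NReg) (r : RReg)
  | rinput (r : RReg) (i : NReg)
  | rrandom (r : RReg)
  | rwrite (i : NReg) (r : RReg)

/-- The effect of an operation. -/
noncomputable def MemOp.exec (inp : Input) (ω : Tape) (s : Memory) : MemOp → Memory
  | .const r c => { s with nr := Function.update s.nr r c }
  | .add r a b => { s with nr := Function.update s.nr r (s.nr a + s.nr b) }
  | .sub r a b => { s with nr := Function.update s.nr r (s.nr a - s.nr b) }
  | .load r A i => { s with nr := Function.update s.nr r (s.na A (s.nr i)) }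
  | .store A i r =>
      { s with na := Function.update s.na A (Function.update (s.na A) (s.nr i) (s.nr r)) }
  | .input r i => { s with nr := Function.update s.nr r (inp.nats.getD (s.nr i) 0) }
  | .rconst r c => { s with rr := Function.update s.rr r (c : ℝ) }
  | .radd r a b => { s with rr := Function.update s.rr r (s.rr a + s.rr b) }
  | .rsub r a b => { s with rr := Function.update s.rr r (s.rr a - s.rr b) }
  | .rmul r a b => { s with rr := Function.update s.rr r (s.rr a * s.rr b) }
  | .rdiv r a b => { s with rr := Function.update s.rr r (s.rr a / s.rr b) }
  | .rsqrt r a => { s with rr := Function.update s.rr r (Real.sqrt (s.rr a)) }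
  | .rload r A i => { s with rr := Function.update s.rr r (s.ra A (s.nr i)) }
  | .rstore A i r =>
      { s with ra := Function.update s.ra A (Function.update (s.ra A) (s.nr i) (s.rr r)) }
  | .rinput r i => { s with rr := Function.update s.rr r (inp.reals.getD (s.nr i) 0) }
  | .rrandom r => { s with rr := Function.update s.rr r (ω s.drawn : ℝ), drawn := s.drawn + 1 }
  | .rwrite i r => { s with out := Function.update s.out (s.nr i) (s.rr r) }

/-- Computes `8 * i + e` in the cell `0`, where `i` is the content of the given cell. -/
def addressProgram (cell e : ℕ) : Program :=
  .seq (.instr (.natAdd 0 cell cell)) <| .seq (.instr (.natAdd 0 0 0)) <|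
    .seq (.instr (.natAdd 0 0 0)) <| .seq (.instr (.natConst 8 e)) <| .instr (.natAdd 0 0 8)

/-- The implementation of an operation. -/
def MemOp.program : MemOp → Program
  | .const r c => .instr (.natConst r.cell c)
  | .add r a b => .instr (.natAdd r.cell a.cell b.cell)
  | .sub r a b => .instr (.natSub r.cell a.cell b.cell)
  | .load r A i => .seq (addressProgram i.cell (A.ctorIdx + 1)) (.instr (.natLoad r.cell 0))
  | .store A i r => .seq (addressProgram i.cell (A.ctorIdx + 1)) (.instr (.natStore 0 r.cell))
  | .input r i => .instr (.natInput r.cell i.cell)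
  | .rconst r c => .instr (.realConst r.cell c)
  | .radd r a b => .instr (.realAdd r.cell a.cell b.cell)
  | .rsub r a b => .instr (.realSub r.cell a.cell b.cell)
  | .rmul r a b => .instr (.realMul r.cell a.cell b.cell)
  | .rdiv r a b => .instr (.realDiv r.cell a.cell b.cell)
  | .rsqrt r a => .instr (.realSqrt r.cell a.cell)
  | .rload r A i => .seq (addressProgram i.cell (A.ctorIdx + 1)) (.instr (.realLoad r.cell 0))
  | .rstore A i r => .seq (addressProgram i.cell (A.ctorIdx + 1)) (.instr (.realStore 0 r.cell))
  | .rinput r i => .instr (.realInput r.cell i.cell)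
  | .rrandom r => .instr (.realRandom r.cell)
  | .rwrite i r => .instr (.write i.cell r.cell)

/-- Program `p` takes memory `s` to memory `s'` in `t` steps. -/
def Reaches (inp : Input) (ω : Tape) (p : Program) (s s' : Memory) (t : ℕ) : Prop :=
  ∀ c, Represents s c → ∃ c', Represents s' c' ∧ Runs inp ω p c c' t

theorem Represents.updateNReg {s : Memory} {c : Config} (h : Represents s c) (r : NReg) (a : ℕ) :
    Represents { s with nr := Function.update s.nr r a }
      { c with N := Function.update c.N r.cell a } := by
  refine ⟨fun r' => ?_, fun A i => ?_, h.rr, h.ra, h.out, h.drawn⟩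
  · by_cases hr : r' = r
    · subst hr; simp
    · simp [hr, NReg.cell_injective.ne hr, h.nr]
  · simp [A.cell_ne_reg, h.na]

theorem Represents.updateRReg {s : Memory} {c : Config} (h : Represents s c) (r : RReg) (a : ℝ) :
    Represents { s with rr := Function.update s.rr r a }
      { c with R := Function.update c.R r.cell a } := by
  refine ⟨h.nr, h.na, fun r' => ?_, fun A i => ?_, h.out, h.drawn⟩
  · by_cases hr : r' = r
    · subst hr; simp
    · simp [hr, RReg.cell_injective.ne hr, h.rr]
  · simp [A.cell_ne_reg, h.ra]

theorem Represents.updateNArr {s : Memory} {c : Config} (h : Represents s c) (A : NArr)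
    (i a : ℕ) :
    Represents { s with na := Function.update s.na A (Function.update (s.na A) i a) }
      { c with N := Function.update c.N (A.cell i) a } := by
  refine ⟨fun r => ?_, fun B j => ?_, h.rr, h.ra, h.out, h.drawn⟩
  · simp [(A.cell_ne_reg i r).symm, h.nr]
  · by_cases hA : B = A
    · subst hA
      by_cases hi : j = i
      · subst hi; simp
      · simp [hi, NArr.cell_inj, h.na]
    · simp [hA, NArr.cell_inj, h.na]

theorem Represents.updateRArr {s : Memory} {c : Config} (h : Represents s c) (A : RArr)
    (i : ℕ) (a : ℝ) :
    Represents { s with ra := Function.update s.ra A (Function.update (s.ra A) i a) }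
      { c with R := Function.update c.R (A.cell i) a } := by
  refine ⟨h.nr, h.na, fun r => ?_, fun B j => ?_, h.out, h.drawn⟩
  · simp [(A.cell_ne_reg i r).symm, h.rr]
  · by_cases hA : B = A
    · subst hA
      by_cases hi : j = i
      · subst hi; simp
      · simp [hi, RArr.cell_inj, h.ra]
    · simp [hA, RArr.cell_inj, h.ra]

/-- Address computations are invisible to the memory. The cells 0 and 8 are thus not determined by
it, which is why `Reaches` speaks of all configurations representing `s`. -/
theorem Represents.updateScratch {s : Memory} {c : Config} (h : Represents s c) {e : ℕ}
    (he : e = 0 ∨ e = 8) (a : ℕ) : Represents s { c with N := Function.update c.N e a } := by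
  refine ⟨fun r => ?_, fun A i => ?_, h.rr, h.ra, h.out, h.drawn⟩
  · rcases he with rfl | rfl <;> simp [r.cell_ne, h.nr]
  · rcases he with rfl | rfl <;> simp [A.cell_ne, h.na]

/-- The machine cannot multiply integers, so the factor 8 comes from three doublings. -/
theorem runs_addressProgram {inp : Input} {ω : Tape} {s : Memory} {c : Config}
    (h : Represents s c) (i : NReg) (e : ℕ) : ∃ c', Represents s c' ∧ c'.N 0 = 8 * s.nr i + e ∧
      Runs inp ω (addressProgram i.cell e) c c' 5 := by
  have h1 := h.updateScratch (Or.inl rfl) (c.N i.cell + c.N i.cell)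
  have h2 := h1.updateScratch (Or.inl rfl) ((c.N i.cell + c.N i.cell) + (c.N i.cell + c.N i.cell))
  have h3 := h2.updateScratch (Or.inl rfl) (((c.N i.cell + c.N i.cell) + (c.N i.cell + c.N i.cell))
    + ((c.N i.cell + c.N i.cell) + (c.N i.cell + c.N i.cell)))
  have h4 := h3.updateScratch (Or.inr rfl) e
  have h5 := h4.updateScratch (Or.inl rfl) (8 * s.nr i + e)
  refine ⟨_, h5, by simp, ?_⟩
  have : Runs inp ω (addressProgram i.cell e) c _ (1 + (1 + (1 + (1 + 1)))) :=
    .seq (.instr _ _) (.seq (.instr _ _) (.seq (.instr _ _) (.seq (.instr _ _) (.instr _ _))))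
  convert this using 1
  simp [Instr.exec, h.nr]
  congr 1
  ring

/-- The number of steps of an operation. -/
def MemOp.time : MemOp → ℕ
  | .load .. | .store .. | .rload .. | .rstore .. => 6
  | _ => 1

theorem MemOp.reaches (inp : Input) (ω : Tape) (s : Memory) (o : MemOp) :
    Reaches inp ω o.program s (o.exec inp ω s) o.time := by
  intro c h
  have one : ∀ (ins : Instr) (s' : Memory), Represents s' (ins.exec inp ω c) →
      ∃ c', Represents s' c' ∧ Runs inp ω (.instr ins) c c' 1 :=
    fun ins s' h' => ⟨_, h', .instr ins c⟩
  have addr : ∀ (i : NReg) (e : ℕ) (ins : Instr) (s' : Memory),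
      (∀ c', Represents s c' → c'.N 0 = 8 * s.nr i + e → Represents s' (ins.exec inp ω c')) →
      ∃ c', Represents s' c' ∧
        Runs inp ω (.seq (addressProgram i.cell e) (.instr ins)) c c' 6 := by
    intro i e ins s' h'
    obtain ⟨c', hc', h0, hr⟩ := runs_addressProgram (inp := inp) (ω := ω) h i e
    exact ⟨_, h' c' hc' h0, .seq hr (.instr ins c')⟩
  cases o with
  | const r x => exact one _ _ (h.updateNReg _ _)
  | add r a b =>
    apply one; simp only [Instr.exec, MemOp.exec, h.nr]; exact h.updateNReg _ _
  | sub r a b =>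
    apply one; simp only [Instr.exec, MemOp.exec, h.nr]; exact h.updateNReg _ _
  | input r i =>
    apply one; simp only [Instr.exec, MemOp.exec, h.nr]; exact h.updateNReg _ _
  | rconst r x => exact one _ _ (h.updateRReg _ _)
  | radd r a b =>
    apply one; simp only [Instr.exec, MemOp.exec, h.rr]; exact h.updateRReg _ _
  | rsub r a b =>
    apply one; simp only [Instr.exec, MemOp.exec, h.rr]; exact h.updateRReg _ _
  | rmul r a b =>
    apply one; simp only [Instr.exec, MemOp.exec, h.rr]; exact h.updateRReg _ _
  | rdiv r a b =>
    apply one; simp only [Instr.exec, MemOp.exec, h.rr]; exact h.updateRReg _ _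
  | rsqrt r a =>
    apply one; simp only [Instr.exec, MemOp.exec, h.rr]; exact h.updateRReg _ _
  | rinput r i =>
    apply one; simp only [Instr.exec, MemOp.exec, h.nr]; exact h.updateRReg _ _
  | rrandom r =>
    apply one; simp only [Instr.exec, MemOp.exec, h.drawn]
    have h' := h.updateRReg r (ω s.drawn)
    exact ⟨h'.nr, h'.na, h'.rr, h'.ra, h'.out, rfl⟩
  | rwrite i r =>
    apply one; simp only [Instr.exec, MemOp.exec, h.nr, h.rr, h.out]
    exact ⟨h.nr, h.na, h.rr, h.ra, rfl, h.drawn⟩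
  | load r A i =>
    apply addr; intro c' hc' h0
    simp only [Instr.exec, MemOp.exec, h0, ← hc'.na]; exact hc'.updateNReg _ _
  | store A i r =>
    apply addr; intro c' hc' h0
    simp only [Instr.exec, MemOp.exec, h0, hc'.nr]; exact hc'.updateNArr _ _ _
  | rload r A i =>
    apply addr; intro c' hc' h0
    simp only [Instr.exec, MemOp.exec, h0, ← hc'.ra]; exact hc'.updateRReg _ _
  | rstore A i r =>
    apply addr; intro c' hc' h0
    simp only [Instr.exec, MemOp.exec, h0, hc'.rr]; exact hc'.updateRArr _ _ _

/-! ### Rules for proving that a program halts in time with a given property -/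

/-- The effect of a list of operations. -/
noncomputable def execs (inp : Input) (ω : Tape) (l : List MemOp) (s : Memory) : Memory :=
  l.foldl (fun s o => o.exec inp ω s) s

/-- The program performing a list of operations. -/
def block : List MemOp → Program
  | [] => .instr (.natConst 0 0)
  | o :: l => .seq o.program (block l)

/-- Starting from `s`, the program `p` halts within `T` steps in a memory satisfying `Q`. -/
def Halts (inp : Input) (ω : Tape) (p : Program) (T : ℕ) (Q : Memory → Prop) (s : Memory) :
    Prop :=
  ∃ s' t, t ≤ T ∧ Q s' ∧ Reaches inp ω p s s' t

section

variable {inp : Input} {ω : Tape} {p q : Program} {T T' : ℕ} {Q Q' : Memory → Prop} {s : Memory}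

theorem Halts.mono (h : Halts inp ω p T Q s) (hT : T ≤ T') (hQ : ∀ s', Q s' → Q' s') :
    Halts inp ω p T' Q' s := by
  obtain ⟨s', t, ht, hs, hr⟩ := h
  exact ⟨s', t, ht.trans hT, hQ _ hs, hr⟩

theorem Halts.of_block {l : List MemOp} (hQ : Q (execs inp ω l s)) :
    Halts inp ω (block l) ((l.map MemOp.time).sum + 1) Q s := by
  induction l generalizing s with
  | nil =>
    -- The empty block is one assignment to a scratch cell, hence a no-op costing one step.
    exact ⟨s, 1, le_rfl, hQ, fun c hc => ⟨_, hc.updateScratch (Or.inl rfl) 0, .instr _ _⟩⟩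
  | cons o l ih =>
    obtain ⟨s', t, ht, hs, hr⟩ := ih (s := o.exec inp ω s) hQ
    refine ⟨s', o.time + t, ?_, hs, fun c hc => ?_⟩
    · simp only [List.map_cons, List.sum_cons]; omega
    · obtain ⟨c', hc', h1⟩ := o.reaches inp ω s c hc
      obtain ⟨c'', hc'', h2⟩ := hr c' hc'
      exact ⟨c'', hc'', .seq h1 h2⟩

theorem Halts.seq (h : Halts inp ω p T (fun s' => Halts inp ω q T' Q s') s) :
    Halts inp ω (.seq p q) (T + T') Q s := by
  obtain ⟨s', t, ht, ⟨s'', t', ht', hs, hr'⟩, hr⟩ := h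
  refine ⟨s'', t + t', by omega, hs, fun c hc => ?_⟩
  obtain ⟨c', hc', h1⟩ := hr c hc
  obtain ⟨c'', hc'', h2⟩ := hr' c' hc'
  exact ⟨c'', hc'', .seq h1 h2⟩

/-- Tests on registers. -/
inductive RegTest
  | lt (a b : NReg)
  | rlt (a b : RReg)

/-- The outcome of a test. -/
def RegTest.holds (s : Memory) : RegTest → Prop
  | .lt a b => s.nr a < s.nr b
  | .rlt a b => s.rr a < s.rr b

/-- The implementation of a test. -/
def RegTest.test : RegTest → Test
  | .lt a b => .natLt a.cell b.cell
  | .rlt a b => .realLt a.cell b.cell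

theorem RegTest.holds_iff {c : Config} (h : Represents s c) (b : RegTest) :
    b.test.holds c ↔ b.holds s := by
  cases b <;> simp [RegTest.test, RegTest.holds, Test.holds, h.nr, h.rr]

theorem Halts.ite {b : RegTest} (h1 : b.holds s → Halts inp ω p T Q s)
    (h2 : ¬ b.holds s → Halts inp ω q T Q s) :
    Halts inp ω (.ifThenElse b.test p q) (T + 1) Q s := by
  by_cases hb : b.holds s
  · obtain ⟨s', t, ht, hs, hr⟩ := h1 hb
    refine ⟨s', t + 1, by omega, hs, fun c hc => ?_⟩
    obtain ⟨c', hc', h⟩ := hr c hc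
    exact ⟨c', hc', .ifTrue ((b.holds_iff hc).2 hb) h⟩
  · obtain ⟨s', t, ht, hs, hr⟩ := h2 hb
    refine ⟨s', t + 1, by omega, hs, fun c hc => ?_⟩
    obtain ⟨c', hc', h⟩ := hr c hc
    exact ⟨c', hc', .ifFalse (fun h' => hb ((b.holds_iff hc).1 h')) h⟩

/-- The invariant is indexed by the number of completed iterations, which makes termination
automatic. The cost may vary with the iteration, so that loops over linked lists of different
lengths can be bounded by the total length. -/
theorem Halts.while {b : RegTest} (I : ℕ → Memory → Prop) (len : ℕ) (cost : ℕ → ℕ)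
    (h : ∀ i < len, ∀ s, I i s → b.holds s ∧ Halts inp ω p (cost i) (I (i + 1)) s)
    (hlen : ∀ s, I len s → ¬ b.holds s) (h0 : I 0 s) :
    Halts inp ω (.whileDo b.test p) (∑ i ∈ Finset.range len, (cost i + 1) + 1) (I len) s := by
  have key : ∀ r i, i + r = len → ∀ s, I i s → Halts inp ω (.whileDo b.test p)
      (∑ j ∈ Finset.range r, (cost (i + j) + 1) + 1) (I len) s := by
    intro r
    induction r with
    | zero =>
      intro i hi s hs
      obtain rfl : i = len := hi
      exact ⟨s, 1, by simp, hs, fun c hc => ⟨c, hc, .whileFalse fun h' =>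
        hlen s hs ((b.holds_iff hc).1 h')⟩⟩
    | succ r ih =>
      intro i hi s hs
      obtain ⟨hb, s', t, ht, hs', hr⟩ := h i (by omega) s hs
      obtain ⟨s'', t', ht', hs'', hr'⟩ := ih (i + 1) (by omega) s' hs'
      refine ⟨s'', t + t' + 1, ?_, hs'', fun c hc => ?_⟩
      · rw [Finset.sum_range_succ']
        simp only [add_zero]
        have : ∑ j ∈ Finset.range r, (cost (i + 1 + j) + 1) =
            ∑ j ∈ Finset.range r, (cost (i + (j + 1)) + 1) :=
          Finset.sum_congr rfl fun j _ => by rw [add_assoc, add_comm 1 j]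
        omega
      · obtain ⟨c', hc', h1⟩ := hr c hc
        obtain ⟨c'', hc'', h2⟩ := hr' c' hc'
        exact ⟨c'', hc'', .whileTrue ((b.holds_iff hc).2 hb) h1 h2⟩
  have := key len 0 (by omega) s h0
  simpa using this

end

/-! ### Tensor products of single-qubit operators -/

/-- The operator `A₁ ⊗ ⋯ ⊗ Aₙ`. -/
def tensorOp {n : ℕ} (A : Fin n → Matrix (Fin 2) (Fin 2) ℂ) : Op n :=
  Matrix.of fun x y => ∏ i, A i (x i) (y i)

theorem pauliOp_eq_tensorOp {n : ℕ} (P : PauliString n) :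
    pauliOp P = tensorOp fun i => (P i).mat := rfl

theorem tensorOp_mul {n : ℕ} (A B : Fin n → Matrix (Fin 2) (Fin 2) ℂ) :
    tensorOp A * tensorOp B = tensorOp fun i => A i * B i := by
  ext x y
  simp only [tensorOp, Matrix.mul_apply, Matrix.of_apply, Finset.prod_univ_sum,
    Fintype.piFinset_univ, Finset.prod_mul_distrib]

theorem tensorOp_one {n : ℕ} : tensorOp (fun _ : Fin n => 1) = 1 := by
  ext x y
  simp only [tensorOp, Matrix.of_apply, Matrix.one_apply, Finset.prod_ite_zero,
    Finset.prod_const_one, Finset.mem_univ, true_imp_iff, funext_iff]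

theorem conjTranspose_tensorOp {n : ℕ} (A : Fin n → Matrix (Fin 2) (Fin 2) ℂ) :
    (tensorOp A).conjTranspose = tensorOp fun i => (A i).conjTranspose := by
  ext x y
  simp [tensorOp, Matrix.conjTranspose_apply]

theorem trace_tensorOp {n : ℕ} (A : Fin n → Matrix (Fin 2) (Fin 2) ℂ) :
    (tensorOp A).trace = ∏ i, (A i).trace := by
  simp only [Matrix.trace, Matrix.diag, tensorOp, Matrix.of_apply, Finset.prod_univ_sum,
    Fintype.piFinset_univ]

theorem tensorOp_eq_neg {n : ℕ} {A B : Fin n → Matrix (Fin 2) (Fin 2) ℂ} (i : Fin n)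
    (h : A i = - B i) (h' : ∀ j, j ≠ i → A j = B j) : tensorOp A = - tensorOp B := by
  ext x y
  simp only [tensorOp, Matrix.of_apply, Matrix.neg_apply]
  rw [← Finset.mul_prod_erase _ _ (Finset.mem_univ i), ← Finset.mul_prod_erase _ _
    (Finset.mem_univ i), h, Matrix.neg_apply, neg_mul]
  congr 2
  exact Finset.prod_congr rfl fun j hj => by rw [h' j (Finset.ne_of_mem_erase hj)]

theorem Pauli.mat_mul_self (p : Pauli) : p.mat * p.mat = 1 := by
  cases p <;> ext i j <;> fin_cases i <;> fin_cases j <;>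
    simp [Pauli.mat, Matrix.mul_apply, Fin.sum_univ_two]

theorem Pauli.conjTranspose_mat (p : Pauli) : p.mat.conjTranspose = p.mat := by
  cases p <;> ext i j <;> fin_cases i <;> fin_cases j <;>
    simp [Pauli.mat]

theorem Pauli.mat_I : Pauli.I.mat = 1 := by
  ext i j; fin_cases i <;> fin_cases j <;> simp [Pauli.mat]

theorem Pauli.exists_anticomm {p : Pauli} (hp : p ≠ .I) :
    ∃ q : Pauli, p.mat * q.mat = -(q.mat * p.mat) := by
  cases p
  · exact absurd rfl hp
  · refine ⟨.Y, ?_⟩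
    ext i j; fin_cases i <;> fin_cases j <;> simp [Pauli.mat, Matrix.mul_apply, Fin.sum_univ_two]
  · refine ⟨.Z, ?_⟩
    ext i j; fin_cases i <;> fin_cases j <;> simp [Pauli.mat, Matrix.mul_apply, Fin.sum_univ_two]
  · refine ⟨.X, ?_⟩
    ext i j; fin_cases i <;> fin_cases j <;> simp [Pauli.mat, Matrix.mul_apply, Fin.sum_univ_two]

theorem Pauli.trace_mul (p q : Pauli) : (p.mat * q.mat).trace = if p = q then 2 else 0 := by
  cases p <;> cases q <;>
    simp [Pauli.mat, Matrix.trace, Fin.sum_univ_two, one_add_one_eq_two]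

theorem trace_pauliOp_mul {n : ℕ} (P Q : PauliString n) :
    (pauliOp P * pauliOp Q).trace = if P = Q then 2 ^ n else 0 := by
  rw [pauliOp_eq_tensorOp, pauliOp_eq_tensorOp, tensorOp_mul, trace_tensorOp]
  simp only [Pauli.trace_mul, Finset.prod_ite_zero, Finset.mem_univ, true_imp_iff, funext_iff,
    Finset.prod_const, Finset.card_univ, Fintype.card_fin]

/-- The Pauli `q` on qubit `i`. -/
def singlePauli {n : ℕ} (i : Fin n) (q : Pauli) : PauliString n :=
  Function.update (identityString n) i q

theorem pauliOp_mul_self {n : ℕ} (P : PauliString n) : pauliOp P * pauliOp P = 1 := by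
  simp only [pauliOp_eq_tensorOp, tensorOp_mul, Pauli.mat_mul_self, tensorOp_one]

theorem conjTranspose_pauliOp {n : ℕ} (P : PauliString n) :
    (pauliOp P).conjTranspose = pauliOp P := by
  simp only [pauliOp_eq_tensorOp, conjTranspose_tensorOp, Pauli.conjTranspose_mat]

/-- This sign flip is used twice: to locate the supports of the terms and to show that the Haar
averages vanish. -/
theorem exists_singlePauli_anticomm {n : ℕ} {P : PauliString n} {i : Fin n} (hi : P i ≠ .I) :
    ∃ q, pauliOp P * pauliOp (singlePauli i q) = -(pauliOp (singlePauli i q) * pauliOp P) := by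
  obtain ⟨q, hq⟩ := Pauli.exists_anticomm hi
  refine ⟨q, ?_⟩
  simp only [pauliOp_eq_tensorOp, tensorOp_mul]
  apply tensorOp_eq_neg i
  · simpa [singlePauli] using hq
  · intro j hj
    simp [singlePauli, identityString, hj, Pauli.mat_I]

/-! ### Supports of the terms of a bounded-degree Hamiltonian -/

theorem singlePauli_apply {n : ℕ} (i : Fin n) (q : Pauli) (x y : Bits n) :
    pauliOp (singlePauli i q) x y = if ∀ j, j ≠ i → x j = y j then q.mat (x i) (y i) else 0 := by
  simp only [pauliOp, Matrix.of_apply]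
  rw [← Finset.mul_prod_erase _ _ (Finset.mem_univ i)]
  have : ∀ j ∈ Finset.univ.erase i, (singlePauli i q j).mat (x j) (y j) =
      if x j = y j then 1 else 0 := by
    intro j hj
    rw [singlePauli, Function.update_of_ne (Finset.ne_of_mem_erase hj), identityString,
      Pauli.mat_I, Matrix.one_apply]
  rw [Finset.prod_congr rfl this, Finset.prod_ite_zero]
  simp [singlePauli]

theorem singlePauli_comm {n : ℕ} {S : Finset (Fin n)} {h : Op n} (hS : ActsOnlyOn S h)
    {i : Fin n} (hi : i ∉ S) (q : Pauli) :
    pauliOp (singlePauli i q) * h = h * pauliOp (singlePauli i q) := by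
  obtain ⟨A, hA⟩ := hS
  ext x y
  rw [Matrix.mul_apply, Matrix.mul_apply]
  rw [Finset.sum_eq_single (Function.update x i (y i)),
    Finset.sum_eq_single (Function.update y i (x i))]
  · rw [singlePauli_apply, singlePauli_apply, hA, hA, mul_comm]
    have h1 : ∀ j, j ≠ i → x j = Function.update x i (y i) j := by
      intro j hj; rw [Function.update_of_ne hj]
    have h2 : ∀ j, j ≠ i → Function.update y i (x i) j = y j := by
      intro j hj; rw [Function.update_of_ne hj]
    rw [if_pos h1, if_pos h2, Function.update_self, Function.update_self]
    congr 1
    have h3 : (∀ j, j ∉ S → Function.update x i (y i) j = y j) ↔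
        ∀ j, j ∉ S → x j = Function.update y i (x i) j := by
      refine forall_congr' fun j => forall_congr' fun _ => ?_
      by_cases hj : j = i
      · subst hj; simp
      · simp [hj]
    have h4 : (fun j : S => Function.update x i (y i) j) = fun j : S => x j := by
      ext j; rw [Function.update_of_ne]; rintro rfl; exact hi j.2
    have h5 : (fun j : S => Function.update y i (x i) j) = fun j : S => y j := by
      ext j; rw [Function.update_of_ne]; rintro rfl; exact hi j.2
    rw [h4, h5]
    simp only [h3]
  · intro z _ hz
    rw [singlePauli_apply, hA]
    split_ifs with h1 h2 <;> simp
    exfalso; apply hz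
    ext j
    by_cases hj : j = i
    · subst hj; rw [Function.update_self, h1 j hi]
    · rw [Function.update_of_ne hj, h2 j hj]
  · simp
  · intro z _ hz
    rw [singlePauli_apply, hA]
    split_ifs with h1 h2 <;> simp
    exfalso; apply hz
    ext j
    by_cases hj : j = i
    · subst hj; rw [Function.update_self, h2 j hi]
    · rw [Function.update_of_ne hj, h1 j hj]
  · simp

/-- Conjugation by a Pauli matrix on qubit `i` fixes `h`, which does not act there, and can be
chosen to change the sign of `P`. The trace is invariant under it, hence equal to its own negative.
-/
theorem trace_pauliOp_mul_eq_zero {n : ℕ} {P : PauliString n} {S : Finset (Fin n)} {h : Op n}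
    (hS : ActsOnlyOn S h) {i : Fin n} (hi : i ∉ S) (hP : P i ≠ .I) :
    (pauliOp P * h).trace = 0 := by
  obtain ⟨q, hq⟩ := exists_singlePauli_anticomm hP
  set U := pauliOp (singlePauli i q)
  have h1 : (pauliOp P * h).trace = -(pauliOp P * h).trace := by
    calc (pauliOp P * h).trace = (pauliOp P * h * (U * U)).trace := by
          rw [pauliOp_mul_self, mul_one]
      _ = (U * (pauliOp P * h * U)).trace := by rw [← mul_assoc, Matrix.trace_mul_comm]
      _ = (U * pauliOp P * (U * h)).trace := by
          rw [mul_assoc (pauliOp P), ← singlePauli_comm hS hi q]; simp only [mul_assoc, U]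
      _ = (-(pauliOp P * U) * (U * h)).trace := by rw [hq, neg_neg]
      _ = -(pauliOp P * (U * U) * h).trace := by
          rw [neg_mul, Matrix.trace_neg]; simp only [mul_assoc]
      _ = -(pauliOp P * h).trace := by rw [pauliOp_mul_self, mul_one]
  exact self_eq_neg.1 h1

theorem trace_pauliOp_mul_hamiltonian {n : ℕ} (α : PauliString n → ℝ) (P : PauliString n) :
    (pauliOp P * hamiltonian α).trace = 2 ^ n * (α P : ℂ) := by
  simp only [hamiltonian, Finset.mul_sum, Matrix.trace_sum, Matrix.mul_smul, Matrix.trace_smul,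
    trace_pauliOp_mul, smul_eq_mul, mul_ite, mul_zero, Finset.sum_ite_eq, Finset.mem_univ, if_true]
  ring

/-- The summands `h j` need not be Pauli terms and may cancel, so a coefficient is read off as a
trace: if no `S j` contained the support of `P`, every summand would contribute 0. -/
theorem exists_support_subset {n m : ℕ} {α : PauliString n → ℝ} {S : Fin m → Finset (Fin n)}
    {h : Fin m → Op n} (hS : ∀ j, ActsOnlyOn (S j) (h j)) (hH : hamiltonian α = ∑ j, h j)
    {P : PauliString n} (hP : α P ≠ 0) : ∃ j, ∀ i, P i ≠ .I → i ∈ S j := by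
  by_contra hcon
  push Not at hcon
  have h0 : (pauliOp P * hamiltonian α).trace = 0 := by
    rw [hH, Finset.mul_sum, Matrix.trace_sum]
    apply Finset.sum_eq_zero
    intro j _
    obtain ⟨i, hi, hiS⟩ := hcon j
    exact trace_pauliOp_mul_eq_zero (hS j) hiS hi
  rw [trace_pauliOp_mul_hamiltonian] at h0
  simp at h0
  exact hP h0

theorem card_support_subset_le {n k : ℕ} {S : Finset (Fin n)} (hS : S.card ≤ k) :
    (Finset.univ.filter fun P : PauliString n => ∀ i, P i ≠ .I → i ∈ S).card ≤ 4 ^ k := by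
  calc _ ≤ Fintype.card (S → Pauli) := by
        rw [← Finset.card_univ]
        apply Finset.card_le_card_of_injOn (fun P (i : S) => P i) (fun _ _ => Finset.mem_coe.2
          (Finset.mem_univ _))
        intro P hP Q hQ hPQ
        simp only [Finset.coe_filter, Finset.mem_univ, true_and, Set.mem_ofPred_eq] at hP hQ
        ext i
        by_cases hi : i ∈ S
        · exact congrFun hPQ ⟨i, hi⟩
        · rw [not_imp_comm.1 (hP i) hi, not_imp_comm.1 (hQ i) hi]
    _ = 4 ^ S.card := by
        rw [Fintype.card_fun, Fintype.card_coe]; rfl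
    _ ≤ 4 ^ k := Nat.pow_le_pow_right (by norm_num) hS

/-- A term acting on `i` is supported in one of the at most `d` sets `S j` containing `i`, and each
of these sets supports at most `4 ^ k` strings. -/
theorem card_terms_at_le {n k d : ℕ} {α : PauliString n → ℝ}
    (h : HasDegreeAtMost k d (hamiltonian α)) (i : Fin n) :
    (Finset.univ.filter fun P => α P ≠ 0 ∧ P i ≠ .I).card ≤ d * 4 ^ k := by
  obtain ⟨m, S, h, -, hk, hS, hH, hd⟩ := h
  calc (Finset.univ.filter fun P => α P ≠ 0 ∧ P i ≠ .I).card
      ≤ ((Finset.univ.filter fun j => i ∈ S j).biUnion fun j =>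
          Finset.univ.filter fun P : PauliString n => ∀ i, P i ≠ .I → i ∈ S j).card := by
        apply Finset.card_le_card
        intro P hP
        simp only [Finset.mem_filter, Finset.mem_univ, true_and, Finset.mem_biUnion] at hP ⊢
        obtain ⟨j, hj⟩ := exists_support_subset hS hH hP.1
        exact ⟨j, hj i hP.2, hj⟩
    _ ≤ (Finset.univ.filter fun j => i ∈ S j).card * 4 ^ k :=
        Finset.card_biUnion_le_card_mul _ _ _ fun j _ => card_support_subset_le (hk j)
    _ ≤ d * 4 ^ k := Nat.mul_le_mul_right _ (hd i)

theorem card_terms_le {n k d : ℕ} {α : PauliString n → ℝ}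
    (h : HasDegreeAtMost k d (hamiltonian α)) :
    (Finset.univ.filter fun P => α P ≠ 0).card ≤ n * (d * 4 ^ k) + 1 := by
  calc (Finset.univ.filter fun P => α P ≠ 0).card
      -- Every string except the identity acts on some qubit; the identity accounts for the `+ 1`.
      ≤ (insert (identityString n) (Finset.univ.biUnion fun i =>
          Finset.univ.filter fun P => α P ≠ 0 ∧ P i ≠ .I)).card := by
        apply Finset.card_le_card
        intro P hP
        rw [Finset.mem_insert, or_iff_not_imp_left]
        intro hne
        obtain ⟨i, hi⟩ := Function.ne_iff.1 hne
        simp only [Finset.mem_filter, Finset.mem_univ, true_and, Finset.mem_biUnion] at hP ⊢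
        exact ⟨i, hP, hi⟩
    _ ≤ _ := Finset.card_insert_le _ _
    _ ≤ n * (d * 4 ^ k) + 1 := by
        gcongr
        exact (Finset.card_biUnion_le_card_mul _ _ _ fun i _ => card_terms_at_le h i).trans
          (by simp)

/-! ### The Haar average of a Hamiltonian -/

theorem energy_hamiltonian {n : ℕ} (α : PauliString n → ℝ) (φ : Bits n → ℂ) :
    energy (hamiltonian α) φ = ∑ P, α P * energy (pauliOp P) φ := by
  simp only [energy, hamiltonian, Matrix.sum_mulVec, dotProduct_sum, Complex.re_sum,
    Matrix.smul_mulVec, dotProduct_smul, smul_eq_mul, Complex.re_ofReal_mul]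

-- The measure of a set on the sphere is, up to the dimension, the volume of the cone `(0,1) • s`
-- over it, and a linear isometry carries cones to cones and preserves volume.
open scoped Pointwise in
theorem measurePreserving_toSphere {E : Type*} [NormedAddCommGroup E] [InnerProductSpace ℝ E]
    [MeasurableSpace E] [BorelSpace E] [FiniteDimensional ℝ E] (e : E ≃ₗᵢ[ℝ] E)
    (f : Metric.sphere (0 : E) 1 → Metric.sphere (0 : E) 1) (hf : ∀ x, (f x : E) = e x) :
    MeasurePreserving f (volume : Measure E).toSphere (volume : Measure E).toSphere := by
  have hfc : Continuous f := by
    rw [continuous_induced_rng]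
    exact (e.continuous.comp continuous_subtype_val).congr fun x => (hf x).symm
  refine ⟨hfc.measurable, ?_⟩
  ext s hs
  rw [Measure.map_apply hfc.measurable hs, Measure.toSphere_apply' _ hs,
    Measure.toSphere_apply' _ (hfc.measurable hs)]
  congr 1
  have : Set.Ioo (0 : ℝ) 1 • ((↑) '' (f ⁻¹' s) : Set E) =
      e ⁻¹' (Set.Ioo (0 : ℝ) 1 • ((↑) '' s)) := by
    ext x
    simp only [Set.mem_smul, Set.mem_image, Set.mem_preimage]
    constructor
    · rintro ⟨r, hr, _, ⟨z, hz, rfl⟩, rfl⟩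
      exact ⟨r, hr, f z, ⟨f z, hz, rfl⟩, by rw [hf, map_smul]⟩
    · rintro ⟨r, hr, _, ⟨z, hz, rfl⟩, hx⟩
      have hz1 : e.symm z ∈ Metric.sphere (0 : E) 1 := by simp
      refine ⟨r, hr, e.symm z, ⟨⟨e.symm z, hz1⟩, ?_, rfl⟩, ?_⟩
      · have : f ⟨e.symm z, hz1⟩ = z := Subtype.ext (by rw [hf]; simp)
        rw [this]; exact hz
      · rw [← map_smul, hx]; simp
  rw [this]
  exact (e.measurePreserving).measure_preimage_equiv (f := e.toHomeomorph.toMeasurableEquiv) _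

instance {n : ℕ} : IsProbabilityMeasure (haarState n) := by
  constructor
  rw [haarState, Measure.smul_apply, smul_eq_mul]
  apply ENNReal.inv_mul_cancel
  · rw [Ne, Measure.measure_univ_eq_zero]
    exact Measure.toSphere_ne_zero _
  · exact measure_ne_top _ _

theorem continuous_energy {n : ℕ} (H : Op n) : Continuous (energy H) := by
  unfold energy
  fun_prop

theorem integrable_energy {n : ℕ} (H : Op n) :
    Integrable (fun φ : Metric.sphere (0 : EuclideanSpace ℂ (Bits n)) 1 =>
      energy H (fun x => (φ : EuclideanSpace ℂ (Bits n)) x)) (haarState n) := by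
  have hc : Continuous (fun φ : Metric.sphere (0 : EuclideanSpace ℂ (Bits n)) 1 =>
      energy H (fun x => (φ : EuclideanSpace ℂ (Bits n)) x)) :=
    (continuous_energy H).comp (by fun_prop)
  have : CompactSpace (Metric.sphere (0 : EuclideanSpace ℂ (Bits n)) 1) :=
    isCompact_iff_compactSpace.1 (isCompact_sphere _ _)
  exact hc.integrable_of_hasCompactSupport (HasCompactSupport.of_compactSpace _)

theorem energy_conj {n : ℕ} (H U : Op n) (φ : Bits n → ℂ) :
    energy H (U.mulVec φ) = energy (U.conjTranspose * H * U) φ := by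
  unfold energy
  rw [Matrix.star_mulVec, ← Matrix.dotProduct_mulVec, Matrix.mulVec_mulVec, Matrix.mulVec_mulVec]

/-- With `U` a single-qubit Pauli anticommuting with `P`, the states `φ` and `U φ` have the same
law, but `U P U = -P`, so the average equals its negative. -/
theorem haarEnergy_pauliOp {n : ℕ} {P : PauliString n} (hP : P ≠ identityString n) :
    haarEnergy (pauliOp P) = 0 := by
  obtain ⟨i, hi⟩ := Function.ne_iff.1 hP
  obtain ⟨q, hq⟩ := exists_singlePauli_anticomm (P := P) (i := i) hi
  set U := pauliOp (singlePauli i q) with hU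
  have hUU : U * U = 1 := pauliOp_mul_self _
  have hUs : U.conjTranspose = U := conjTranspose_pauliOp _
  have hu : Matrix.toEuclideanCLM (𝕜 := ℂ) U ∈ unitary _ := by
    rw [Unitary.mem_iff, ← map_star, ← map_mul, ← map_mul, Matrix.star_eq_conjTranspose, hUs, hUU,
      map_one]
    exact ⟨rfl, rfl⟩
  let eC : EuclideanSpace ℂ (Bits n) ≃ₗᵢ[ℂ] EuclideanSpace ℂ (Bits n) :=
    Unitary.linearIsometryEquiv ⟨_, hu⟩
  have heC : ∀ x, (fun b => eC x b) = U.mulVec (fun b => x b) := fun x => rfl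
  -- The surface measure is that of the underlying real space, so the unitary is regarded as a real
  -- isometry.
  let e : EuclideanSpace ℂ (Bits n) ≃ₗᵢ[ℝ] EuclideanSpace ℂ (Bits n) :=
    ⟨eC.toLinearEquiv.restrictScalars ℝ, eC.norm_map⟩
  let f : Metric.sphere (0 : EuclideanSpace ℂ (Bits n)) 1 →
      Metric.sphere (0 : EuclideanSpace ℂ (Bits n)) 1 := fun x => ⟨e x, by
        have := x.2
        simp only [mem_sphere_iff_norm, sub_zero] at this ⊢
        rw [e.norm_map, this]⟩
  have hmp := (measurePreserving_toSphere e f fun _ => rfl).smul_measure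
    ((volume : Measure (EuclideanSpace ℂ (Bits n))).toSphere Set.univ)⁻¹
  have hcont : AEStronglyMeasurable (fun φ : Metric.sphere (0 : EuclideanSpace ℂ (Bits n)) 1 =>
      energy (pauliOp P) (fun x => (φ : EuclideanSpace ℂ (Bits n)) x))
      (Measure.map f (haarState n)) := by
    rw [show Measure.map f (haarState n) = haarState n from hmp.map_eq]
    exact (integrable_energy _).1
  have h1 : haarEnergy (pauliOp P) = - haarEnergy (pauliOp P) := by
    conv_lhs => rw [haarEnergy, ← show Measure.map f (haarState n) = haarState n from hmp.map_eq,
      integral_map hmp.measurable.aemeasurable hcont]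
    rw [haarEnergy, ← integral_neg]
    congr 1
    ext φ
    have h2 : (fun x => ((f φ : EuclideanSpace ℂ (Bits n)) x)) =
      U.mulVec (fun b => (φ : EuclideanSpace ℂ (Bits n)) b) := heC _
    rw [h2, energy_conj, hUs, mul_assoc, hq, mul_neg, ← mul_assoc, hUU, one_mul]
    simp [energy, Matrix.neg_mulVec]
  linarith

theorem haarEnergy_identity {n : ℕ} : haarEnergy (pauliOp (identityString n)) = 1 := by
  have h1 : pauliOp (identityString n) = 1 := by
    simp only [pauliOp_eq_tensorOp, identityString, Pauli.mat_I, tensorOp_one]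
  rw [haarEnergy, h1]
  have h2 : ∀ φ : Metric.sphere (0 : EuclideanSpace ℂ (Bits n)) 1,
      energy (1 : Op n) (fun x => (φ : EuclideanSpace ℂ (Bits n)) x) = 1 := by
    intro φ
    have h3 : ‖(φ : EuclideanSpace ℂ (Bits n))‖ = 1 := by simp
    rw [energy, Matrix.one_mulVec, dotProduct, Complex.re_sum]
    refine Eq.trans ?_ (show ‖(φ : EuclideanSpace ℂ (Bits n))‖ ^ 2 = 1 by rw [h3, one_pow])
    rw [EuclideanSpace.norm_sq_eq]
    apply Finset.sum_congr rfl
    intro x _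
    rw [Pi.star_apply, ← Complex.normSq_eq_norm_sq]
    simp [Complex.normSq_apply]
  simp [h2]

theorem haarEnergy_hamiltonian {n : ℕ} (α : PauliString n → ℝ) :
    haarEnergy (hamiltonian α) = α (identityString n) := by
  unfold haarEnergy
  simp only [energy_hamiltonian]
  rw [integral_finsetSum _ fun P _ => (integrable_energy _).const_mul _]
  simp only [integral_const_mul]
  rw [Finset.sum_eq_single (identityString n)]
  · have := haarEnergy_identity (n := n)
    rw [haarEnergy] at this
    rw [this, mul_one]
  · intro P _ hP
    have := haarEnergy_pauliOp hP
    rw [haarEnergy] at this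
    rw [this, mul_zero]
  · simp

/-! ### Contracting the leaves of a forest -/

/-- Removing the leaves `L` from the set `A` while changing the summand only at their parents. -/
theorem sum_sdiff_contract {ι : Type*} [DecidableEq ι] {A L : Finset ι} {par : ι → ι}
    {F F' : ι → ℝ} (hL : L ⊆ A) (hpar : ∀ ν ∈ L, par ν ∈ A \ L) (hinj : Set.InjOn par L)
    (hF : ∀ μ ∈ A \ L, (∀ ν ∈ L, par ν ≠ μ) → F' μ = F μ) :
    ∑ μ ∈ A \ L, F' μ = ∑ μ ∈ A, F μ + ∑ ν ∈ L, (F' (par ν) - F (par ν) - F ν) := by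
  have h1 : ∑ μ ∈ A \ L, (F' μ - F μ) = ∑ μ ∈ L.image par, (F' μ - F μ) := by
    symm
    apply Finset.sum_subset
    · intro μ hμ
      obtain ⟨ν, hν, rfl⟩ := Finset.mem_image.1 hμ
      exact hpar ν hν
    · intro μ hμ hn
      rw [hF μ hμ fun ν hν h => hn (Finset.mem_image.2 ⟨ν, hν, h⟩), sub_self]
  rw [Finset.sum_image hinj, Finset.sum_sub_distrib] at h1
  have h2 := Finset.sum_sdiff (f := F) hL
  rw [Finset.sum_sub_distrib]
  linarith

/-- The one-variable hypercontractive step. The merged nodes carry `5 b` of the weighted sum `T`,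
because they weigh 5 times as much as their parents, but only `b` after the merge. This loss pays
for all terms of second order in `c`, and only the first-order term `4 y T c` remains. -/
theorem sq_contract_le {T T' b c y : ℝ} (hy : y ^ 2 = 1) (hb : 0 ≤ b) (ha : 0 ≤ T - 5 * b)
    (hc : c ^ 2 ≤ (T - 5 * b) * b) (hT : T' = T - 4 * b + 2 * y * c) :
    T' ^ 2 ≤ T ^ 2 + 4 * y * T * c := by
  set a := T - 5 * b with ha'
  have hTa : T = a + 5 * b := by rw [ha']; ring
  have hyc : (y * c) ^ 2 ≤ a * b := by rw [mul_pow, hy, one_mul]; exact hc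
  set e := y * c with he
  -- By AM-GM, `(a/2 + 2b)² ≥ 4ab ≥ 4e²`.
  have h3 : -(2 * e) ≤ a / 2 + 2 * b := by nlinarith [sq_nonneg (a / 2 - 2 * b)]
  have h4 : T' ^ 2 = (a + b) ^ 2 + 4 * e ^ 2 + 4 * e * (a + b) := by
    rw [hT, hTa, he]; ring
  have h5 : 4 * y * T * c = 4 * e * (a + 5 * b) := by rw [he, hTa]; ring
  rw [h4, h5, hTa]
  nlinarith [mul_nonneg hb (sub_nonneg.2 h3), mul_nonneg ha hb, sq_nonneg b]

/-- The potential of a polynomial whose squared coefficients have total `Q` at the start, total `M`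
now, and weighted total `T` now. -/
noncomputable def potential (Q M T : ℝ) : ℝ := (M - T ^ 2 / (2 * Q)) / Real.sqrt Q

/-- The potential changes by at least its part linear in `y`, so a sign making that part nonnegative
does no harm. For `Q = 0` both potentials are 0, since division by 0 gives 0; no case distinction is
needed in the program. -/
theorem potential_contract {Q M M' T T' b c c₁ y : ℝ} (hQ : 0 ≤ Q) (hy : y ^ 2 = 1) (hb : 0 ≤ b)
    (ha : 0 ≤ T - 5 * b) (hc : c ^ 2 ≤ (T - 5 * b) * b) (hT : T' = T - 4 * b + 2 * y * c)
    (hM : M' = M + 2 * y * c₁) :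
    potential Q M T + 2 * y * ((c₁ - c * T / Q) / Real.sqrt Q) ≤ potential Q M' T' := by
  have h := sq_contract_le hy hb ha hc hT
  unfold potential
  rw [← mul_div_assoc, ← add_div]
  apply div_le_div_of_nonneg_right _ (Real.sqrt_nonneg _)
  rw [hM]
  have h2 : T' ^ 2 / (2 * Q) ≤ (T ^ 2 + 4 * y * T * c) / (2 * Q) :=
    div_le_div_of_nonneg_right h (by positivity)
  have h3 : (T ^ 2 + 4 * y * T * c) / (2 * Q) = T ^ 2 / (2 * Q) + 2 * y * (c * T / Q) := by
    rcases eq_or_ne Q 0 with rfl | hq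
    · simp
    · field_simp; ring
  linarith

/-- The starting value: no variable is fixed, so `M = Q`, and the weights are at most 1, so `T ≤ Q`.
-/
theorem half_sqrt_le_potential {Q T : ℝ} (h0 : 0 ≤ T) (h : T ≤ Q) :
    Real.sqrt Q / 2 ≤ potential Q Q T := by
  unfold potential
  rcases eq_or_lt_of_le (h0.trans h) with rfl | hQ
  · simp
  · have hs := Real.sqrt_pos.2 hQ
    rw [le_div_iff₀ hs]
    have h1 : T ^ 2 / (2 * Q) ≤ Q / 2 := by
      rw [div_le_iff₀ (by positivity)]; nlinarith
    have h2 := Real.mul_self_sqrt hQ.le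
    nlinarith

/-- The final value: only the root is left, of weight `c = 1 / 5 ^ k`. With `z = c |S| / √Q` the
left side is `|S| (z - z³/2)`, and `z - z³/2 ≤ 1` for `z ≥ 0`. -/
theorem potential_le_abs {Q S c : ℝ} (hQ : 0 ≤ Q) (hc : 0 < c) :
    c * potential Q (S ^ 2) (c * S ^ 2) ≤ |S| := by
  unfold potential
  rcases eq_or_lt_of_le hQ with rfl | hQ
  · simp
  have hs := Real.sqrt_pos.2 hQ
  set r := Real.sqrt Q with hr
  have hrQ : Q = r ^ 2 := by rw [hr, Real.sq_sqrt hQ.le]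
  rw [hrQ, ← sq_abs S]
  set x := |S| with hx
  have hx0 : 0 ≤ x := abs_nonneg S
  rw [← mul_div_assoc, div_le_iff₀ hs]
  have h1 : c * (x ^ 2 - (c * x ^ 2) ^ 2 / (2 * r ^ 2)) =
      x * r * ((c * x / r) - (c * x / r) ^ 3 / 2) := by
    field_simp
  rw [h1]
  have hz : 0 ≤ c * x / r := by positivity
  set z := c * x / r
  have h2 : z - z ^ 3 / 2 ≤ 1 := by
    nlinarith [mul_nonneg hz (sq_nonneg (z - 1)), sq_nonneg (z - 1), sq_nonneg (z-3/4)]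
  calc x * r * (z - z ^ 3 / 2) ≤ x * r * 1 := by gcongr
    _ = x * r := by ring

/-- The effect of one contraction on the total potential. The set `A` of live nodes is split into
trees by `root`; the nodes in `L` are merged into their parents with the sign `y`. -/
theorem sum_potential_contract {ι V : Type*} [DecidableEq ι] [DecidableEq V] {A L : Finset ι}
    {par : ι → ι} {root : ι → V} {S S' W : ι → ℝ} {Q : V → ℝ} {B : Finset V} {y : ℝ}
    (hL : L ⊆ A) (hpar : ∀ ν ∈ L, par ν ∈ A \ L) (hinj : Set.InjOn par L)
    (hroot : ∀ ν ∈ L, root (par ν) = root ν) (hW : ∀ ν ∈ L, W ν = 5 * W (par ν))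
    (hW0 : ∀ ν ∈ A, 0 ≤ W ν) (hS1 : ∀ ν ∈ L, S' (par ν) = S (par ν) + y * S ν)
    (hS2 : ∀ μ, (∀ ν ∈ L, par ν ≠ μ) → S' μ = S μ) (hB : ∀ ν ∈ L, root ν ∈ B)
    (hQ : ∀ v, 0 ≤ Q v) (hy : y ^ 2 = 1)
    (hD : 0 ≤ y * ∑ ν ∈ L, S (par ν) * S ν *
      (1 - W (par ν) * (∑ μ ∈ A with root μ = root ν, W μ * S μ ^ 2) / Q (root ν)) /
        Real.sqrt (Q (root ν))) :
    ∑ v ∈ B, potential (Q v) (∑ μ ∈ A with root μ = v, S μ ^ 2)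
        (∑ μ ∈ A with root μ = v, W μ * S μ ^ 2) ≤
      ∑ v ∈ B, potential (Q v) (∑ μ ∈ A \ L with root μ = v, S' μ ^ 2)
        (∑ μ ∈ A \ L with root μ = v, W μ * S' μ ^ 2) := by
  have hfilt : ∀ v, {μ ∈ A \ L | root μ = v} = {μ ∈ A | root μ = v} \ {μ ∈ L | root μ = v} := by
    intro v; ext μ; simp only [Finset.mem_filter, Finset.mem_sdiff]; tauto
  have hcon : ∀ (v : V) (F F' : ι → ℝ), (∀ μ, (∀ ν ∈ L, par ν ≠ μ) → F' μ = F μ) →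
      ∑ μ ∈ A \ L with root μ = v, F' μ = ∑ μ ∈ A with root μ = v, F μ +
        ∑ ν ∈ L with root ν = v, (F' (par ν) - F (par ν) - F ν) := by
    intro v F F' hF
    rw [hfilt]
    apply sum_sdiff_contract
    · exact Finset.filter_subset_filter _ hL
    · intro ν hν
      rw [Finset.mem_filter] at hν
      have := hpar ν hν.1
      rw [← hfilt, Finset.mem_filter, hroot ν hν.1]
      exact ⟨this, hν.2⟩
    · exact hinj.mono (by intro ν hν; simp at hν ⊢; exact hν.1)
    · intro μ hμ h
      apply hF
      intro ν hν hνμ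
      apply h ν _ hνμ
      rw [Finset.mem_filter]
      refine ⟨hν, ?_⟩
      rw [Finset.mem_sdiff, Finset.mem_filter] at hμ
      rw [← hroot ν hν, hνμ, hμ.1.2]
  have key : ∀ v, potential (Q v) (∑ μ ∈ A with root μ = v, S μ ^ 2)
        (∑ μ ∈ A with root μ = v, W μ * S μ ^ 2) + 2 * (y * ∑ ν ∈ L with root ν = v,
        S (par ν) * S ν *
      (1 - W (par ν) * (∑ μ ∈ A with root μ = root ν, W μ * S μ ^ 2) / Q (root ν)) /
        Real.sqrt (Q (root ν))) ≤
      potential (Q v) (∑ μ ∈ A \ L with root μ = v, S' μ ^ 2)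
        (∑ μ ∈ A \ L with root μ = v, W μ * S' μ ^ 2) := by
    intro v
    set T := ∑ μ ∈ A with root μ = v, W μ * S μ ^ 2 with hTdef
    set b := ∑ ν ∈ L with root ν = v, W (par ν) * S ν ^ 2 with hbdef
    set c := ∑ ν ∈ L with root ν = v, W (par ν) * (S (par ν) * S ν) with hcdef
    set c₁ := ∑ ν ∈ L with root ν = v, S (par ν) * S ν with hc1def
    set a := ∑ ν ∈ L with root ν = v, W (par ν) * S (par ν) ^ 2 with hadef
    have hWp : ∀ ν ∈ L, 0 ≤ W (par ν) := fun ν hν => hW0 _ (Finset.mem_sdiff.1 (hpar ν hν)).1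
    have hb0 : 0 ≤ b := Finset.sum_nonneg fun ν hν =>
      mul_nonneg (hWp ν (Finset.mem_filter.1 hν).1) (sq_nonneg _)
    have ha0 : 0 ≤ a := Finset.sum_nonneg fun ν hν =>
      mul_nonneg (hWp ν (Finset.mem_filter.1 hν).1) (sq_nonneg _)
    -- Cauchy-Schwarz with the weights of the parents.
    have hcs : c ^ 2 ≤ a * b := by
      apply Finset.sum_sq_le_sum_mul_sum_of_sq_le_mul
      · exact fun ν hν => mul_nonneg (hWp ν (Finset.mem_filter.1 hν).1) (sq_nonneg _)
      · exact fun ν hν => mul_nonneg (hWp ν (Finset.mem_filter.1 hν).1) (sq_nonneg _)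
      · intro ν hν; exact le_of_eq (by ring)
    -- Removing `L` takes exactly `5 b` from `T`; the parents are distinct and survive, so what
    -- remains is at least their share `a`.
    have haT : a ≤ T - 5 * b := by
      have h1 := hcon v (fun μ => W μ * S μ ^ 2) (fun μ => W μ * S μ ^ 2) (fun _ _ => rfl)
      have h2 : ∑ ν ∈ L with root ν = v, (W (par ν) * S (par ν) ^ 2 - W (par ν) * S (par ν) ^ 2
          - W ν * S ν ^ 2) = - (5 * b) := by
        rw [hbdef, Finset.mul_sum, ← Finset.sum_neg_distrib]
        apply Finset.sum_congr rfl
        intro ν hν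
        rw [hW ν (Finset.mem_filter.1 hν).1]; ring
      rw [h2, ← hTdef] at h1
      rw [sub_eq_add_neg, ← h1, hadef]
      rw [← Finset.sum_image (f := fun μ => W μ * S μ ^ 2) (g := par)
        (hinj.mono (by intro ν hν; simp at hν ⊢; exact hν.1))]
      apply Finset.sum_le_sum_of_subset_of_nonneg
      · intro μ hμ
        obtain ⟨ν, hν, rfl⟩ := Finset.mem_image.1 hμ
        rw [Finset.mem_filter] at hν ⊢
        exact ⟨hpar ν hν.1, by rw [hroot ν hν.1, hν.2]⟩
      · intro μ hμ _
        exact mul_nonneg (hW0 _ (Finset.mem_sdiff.1 (Finset.mem_filter.1 hμ).1).1) (sq_nonneg _)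
    have hT' : ∑ μ ∈ A \ L with root μ = v, W μ * S' μ ^ 2 = T - 4 * b + 2 * y * c := by
      rw [hcon v (fun μ => W μ * S μ ^ 2) (fun μ => W μ * S' μ ^ 2)
        (fun μ hμ => by rw [hS2 μ hμ]), ← hTdef, hbdef, hcdef, Finset.mul_sum, Finset.mul_sum,
        sub_add, ← Finset.sum_sub_distrib, sub_eq_add_neg, ← Finset.sum_neg_distrib]
      congr 1
      apply Finset.sum_congr rfl
      intro ν hν
      rw [hW ν (Finset.mem_filter.1 hν).1, hS1 ν (Finset.mem_filter.1 hν).1]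
      linear_combination W (par ν) * S ν ^ 2 * hy
    have hM' : ∑ μ ∈ A \ L with root μ = v, S' μ ^ 2 =
        ∑ μ ∈ A with root μ = v, S μ ^ 2 + 2 * y * c₁ := by
      rw [hcon v (fun μ => S μ ^ 2) (fun μ => S' μ ^ 2)
        (fun μ hμ => by rw [hS2 μ hμ]), hc1def, Finset.mul_sum]
      congr 1
      apply Finset.sum_congr rfl
      intro ν hν
      rw [hS1 ν (Finset.mem_filter.1 hν).1]
      -- Since `y ^ 2 = 1`, the square of the merged coefficient exceeds the two old squares by the
      -- cross term alone.
      linear_combination S ν ^ 2 * hy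
    have := potential_contract (hQ v) hy hb0 (ha0.trans haT)
      (hcs.trans (mul_le_mul_of_nonneg_right haT hb0)) hT' hM'
    refine le_trans (le_of_eq ?_) this
    congr 1
    rw [mul_assoc]
    congr 2
    rw [hc1def, hcdef, Finset.sum_mul, Finset.sum_div, ← Finset.sum_sub_distrib, Finset.sum_div]
    apply Finset.sum_congr rfl
    intro ν hν
    rw [(Finset.mem_filter.1 hν).2, ← hTdef]
    ring
  refine le_trans ?_ (Finset.sum_le_sum fun v _ => key v)
  rw [Finset.sum_add_distrib, ← Finset.mul_sum, ← Finset.mul_sum]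
  have : ∑ v ∈ B, ∑ ν ∈ L with root ν = v, S (par ν) * S ν *
      (1 - W (par ν) * (∑ μ ∈ A with root μ = root ν, W μ * S μ ^ 2) / Q (root ν)) /
        Real.sqrt (Q (root ν)) = ∑ ν ∈ L, S (par ν) * S ν *
      (1 - W (par ν) * (∑ μ ∈ A with root μ = root ν, W μ * S μ ^ 2) / Q (root ν)) /
        Real.sqrt (Q (root ν)) := Finset.sum_fiberwise_of_maps_to hB _
  rw [this]
  linarith

/-! ### Recovering the derivative at zero from finitely many values -/

-- A polynomial of degree at most `k` is determined by its values at `k + 1` points, so its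
-- derivative at 0 is a fixed linear combination of these values and the largest of them controls
-- it. The nodes `1/(j+1)` lie in `(0, 1]`, as needed to keep the candidates inside the cube.
open Polynomial in
theorem exists_abs_derivative_le (k : ℕ) : ∃ c : ℝ, 0 < c ∧ ∀ p : ℝ[X], p.natDegree ≤ k →
    ∃ j ≤ k, c * |p.derivative.eval 0| ≤ |p.eval (1 / ((j : ℝ) + 1))| := by
  let s := Finset.range (k + 1)
  let t : ℕ → ℝ := fun j => 1 / ((j : ℝ) + 1)
  have ht : Set.InjOn t s := by
    intro i _ j _ h
    simp only [t, one_div, inv_inj, add_left_inj, Nat.cast_inj] at h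
    exact h
  let l : ℕ → ℝ := fun j => (Lagrange.basis s t j).derivative.eval 0
  have hl : 0 ≤ ∑ j ∈ s, |l j| := Finset.sum_nonneg fun _ _ => abs_nonneg _
  -- The `l j` are the interpolation weights of the derivative at 0; adding 1 only guarantees a
  -- positive denominator.
  refine ⟨1 / (1 + ∑ j ∈ s, |l j|), by positivity, fun p hp => ?_⟩
  have hdeg : p.degree < s.card := by
    rw [Finset.card_range]
    exact lt_of_le_of_lt degree_le_natDegree (by exact_mod_cast Nat.lt_succ_of_le hp)
  have hpe : p.derivative.eval 0 = ∑ j ∈ s, p.eval (t j) * l j := by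
    conv_lhs => rw [Lagrange.eq_interpolate ht hdeg]
    rw [Lagrange.interpolate_apply, derivative_sum, eval_finsetSum]
    apply Finset.sum_congr rfl
    intro j _
    rw [derivative_C_mul, eval_C_mul]
  obtain ⟨j, hj, hmax⟩ := Finset.exists_max_image s (fun j => |p.eval (t j)|) ⟨0, by simp [s]⟩
  refine ⟨j, by simpa [s, Nat.lt_succ_iff] using hj, ?_⟩
  change _ ≤ |p.eval (t j)|
  clear_value l t s
  rw [one_div, inv_mul_le_iff₀ (by positivity), hpe]
  calc |∑ j ∈ s, p.eval (t j) * l j| ≤ ∑ i ∈ s, |p.eval (t i) * l i| :=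
        Finset.abs_sum_le_sum_abs _ _
    _ ≤ ∑ i ∈ s, |p.eval (t j)| * |l i| := by
        apply Finset.sum_le_sum
        intro i hi
        rw [abs_mul]
        exact mul_le_mul_of_nonneg_right (hmax i hi) (abs_nonneg _)
    _ = (∑ i ∈ s, |l i|) * |p.eval (t j)| := by rw [← Finset.mul_sum, mul_comm]
    _ ≤ (1 + ∑ i ∈ s, |l i|) * |p.eval (t j)| := by
        apply mul_le_mul_of_nonneg_right _ (abs_nonneg _); linarith

/-! ### Random rounding of a Bloch vector to an eigenstate of a Pauli matrix -/

/-- The indicator of `r < a`. -/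
noncomputable def step (a r : ℝ) : ℝ := if r < a then 1 else 0

theorem measurable_step (a : ℝ) : Measurable fun r : unitInterval => step a r := by
  unfold step
  exact Measurable.ite (measurableSet_lt measurable_subtype_coe measurable_const)
    measurable_const measurable_const

theorem integrable_step (a : ℝ) : Integrable fun r : unitInterval => step a r := by
  apply Integrable.of_bound (measurable_step a).aestronglyMeasurable 1
  filter_upwards with r
  unfold step
  split_ifs <;> simp

theorem integral_step {a : ℝ} (h0 : 0 ≤ a) (h1 : a ≤ 1) : ∫ r : unitInterval, step a r = a := by
  have h : (fun r : unitInterval => step a r) =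
      Set.indicator (Set.Iio ⟨a, h0, h1⟩) fun _ => (1 : ℝ) := by
    ext r
    simp [step, Set.indicator_apply, ← Subtype.coe_lt_coe]
  rw [h, integral_indicator_const _ measurableSet_Iio]
  simp [Measure.real, unitInterval.volume_Iio, h0]

/-- The expectation of the Pauli matrix `p` in the rounded state, see `roundedQubit`. -/
noncomputable def blochValue (m : Pauli → ℝ) (r : ℝ) : Pauli → ℝ
  | .I => 1
  | .X => 2 * step (1 / 6 + m .X / 2) r - step (1 / 3) r
  | .Y => 2 * step (1 / 2 + m .Y / 2) r - step (1 / 3) r - step (2 / 3) r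
  | .Z => 2 * step (5 / 6 + m .Z / 2) r - step (2 / 3) r - 1

theorem measurable_blochValue (m : Pauli → ℝ) (p : Pauli) :
    Measurable fun r : unitInterval => blochValue m r p := by
  have h := measurable_step
  cases p
  · exact measurable_const
  · exact ((h _).const_mul 2).sub (h _)
  · exact (((h _).const_mul 2).sub (h _)).sub (h _)
  · exact (((h _).const_mul 2).sub (h _)).sub measurable_const

/-- Each axis owns one third of `[0,1]`, which is split so that the eigenvalue `+1` has probability
`1/6 + m/2` and `-1` has `1/6 - m/2`; on the other two thirds the expectation along this axis is 0.
The mean is `m`. -/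
theorem integral_blochValue {m : Pauli → ℝ} (hm : ∀ p, p ≠ .I → |m p| ≤ 1 / 3) (p : Pauli) :
    ∫ r : unitInterval, blochValue m r p = if p = .I then 1 else m p := by
  have h := integrable_step
  cases p
  · simp [blochValue]
  · have := abs_le.1 (hm .X (by simp))
    simp only [blochValue]
    rw [integral_sub ((h _).const_mul 2) (h _), integral_const_mul, integral_step, integral_step,
      if_neg (by simp)] <;> linarith
  · have := abs_le.1 (hm .Y (by simp))
    simp only [blochValue]
    refine (integral_sub (((h _).const_mul 2).sub (h _)) (h _)).trans ?_
    simp only [Pi.sub_apply]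
    rw [integral_sub ((h _).const_mul 2) (h _), integral_const_mul, integral_step, integral_step, integral_step,
      if_neg (by simp)] <;> linarith
  · have := abs_le.1 (hm .Z (by simp))
    simp only [blochValue]
    refine (integral_sub (((h _).const_mul 2).sub (h _)) (integrable_const _)).trans ?_
    simp only [Pi.sub_apply]
    rw [integral_sub ((h _).const_mul 2) (h _), integral_const_mul, integral_step, integral_step,
      if_neg (by simp)]
    · simp; linarith
    all_goals linarith

/-- The first amplitude and the real and imaginary parts of the second amplitude of the state to
which the Bloch vector `m` is rounded when the random number `r` is drawn. -/
noncomputable def roundedAmplitudes (m : Pauli → ℝ) (r : ℝ) : ℝ × ℝ × ℝ :=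
  if r < 1 / 6 + m .X / 2 then (1 / Real.sqrt 2, 1 / Real.sqrt 2, 0)
  else if r < 1 / 3 then (1 / Real.sqrt 2, -(1 / Real.sqrt 2), 0)
  else if r < 1 / 2 + m .Y / 2 then (1 / Real.sqrt 2, 0, 1 / Real.sqrt 2)
  else if r < 2 / 3 then (1 / Real.sqrt 2, 0, -(1 / Real.sqrt 2))
  else if r < 5 / 6 + m .Z / 2 then (1, 0, 0)
  else (0, 1, 0)

/-- The state to which the Bloch vector `m` is rounded. -/
noncomputable def roundedQubit (m : Pauli → ℝ) (r : ℝ) : Fin 2 → ℂ :=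
  ![⟨(roundedAmplitudes m r).1, 0⟩, ⟨(roundedAmplitudes m r).2.1, (roundedAmplitudes m r).2.2⟩]

theorem one_div_sqrt_two_mul_self : (1 / Real.sqrt 2) * (1 / Real.sqrt 2) = 1 / 2 := by
  rw [div_mul_div_comm, one_mul, Real.mul_self_sqrt zero_le_two]

theorem sum_norm_sq_roundedQubit (m : Pauli → ℝ) (r : ℝ) :
    ∑ b, ‖roundedQubit m r b‖ ^ 2 = 1 := by
  have h := one_div_sqrt_two_mul_self
  simp only [Fin.sum_univ_two, roundedQubit, Matrix.cons_val_zero, Matrix.cons_val_one,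
    ← Complex.normSq_eq_norm_sq, Complex.normSq_mk, roundedAmplitudes]
  split_ifs <;> simp only [mul_zero, add_zero, neg_mul_neg, h, zero_add] <;> norm_num

/-- The expectation `⟨ψ|A|ψ⟩` for one qubit. -/
noncomputable def qubitExpectation (A : Matrix (Fin 2) (Fin 2) ℂ) (ψ : Fin 2 → ℂ) : ℂ :=
  star ψ ⬝ᵥ A.mulVec ψ

/-- The bound `1/3` is what keeps each threshold inside its third of `[0,1]`; otherwise the nested
tests defining the state would not match the differences of step functions. -/
theorem qubitExpectation_roundedQubit {m : Pauli → ℝ} (hm : ∀ p, p ≠ .I → |m p| ≤ 1 / 3)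
    (r : ℝ) (p : Pauli) :
    qubitExpectation p.mat (roundedQubit m r) = (blochValue m r p : ℂ) := by
  have h := one_div_sqrt_two_mul_self
  have hX := abs_le.1 (hm .X (by simp))
  have hY := abs_le.1 (hm .Y (by simp))
  have hZ := abs_le.1 (hm .Z (by simp))
  set s := 1 / Real.sqrt 2 with hs
  have key : ∀ a b c : ℝ, qubitExpectation p.mat ![⟨a, 0⟩, ⟨b, c⟩] = ((match p with
        | .I => a * a + b * b + c * c
        | .X => 2 * (a * b)
        | .Y => 2 * (a * c)
        | .Z => a * a - b * b - c * c : ℝ) : ℂ) := by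
    intro a b c
    cases p <;> apply Complex.ext <;>
      simp [qubitExpectation, Pauli.mat, dotProduct, Fin.sum_univ_two, Matrix.mulVec,
        Complex.mul_re, Complex.mul_im] <;> ring
  unfold roundedQubit
  rw [key]
  congr 1
  unfold roundedAmplitudes
  cases p <;> simp only [blochValue, step] <;> split_ifs <;> linarith

/-! ### The average energy of the rounded product state -/

theorem dotProduct_tensorOp_productState {n : ℕ} (A : Fin n → Matrix (Fin 2) (Fin 2) ℂ)
    (ψ : Fin n → Fin 2 → ℂ) :
    star (productState ψ) ⬝ᵥ (tensorOp A).mulVec (productState ψ) =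
      ∏ i, qubitExpectation (A i) (ψ i) := by
  have h : ∀ i, qubitExpectation (A i) (ψ i) =
      ∑ c : Fin 2 × Fin 2, star (ψ i c.1) * (A i c.1 c.2 * ψ i c.2) := by
    intro i
    rw [Fintype.sum_prod_type]
    simp only [qubitExpectation, dotProduct, Matrix.mulVec, Finset.mul_sum, Pi.star_apply]
  simp only [h, Finset.prod_univ_sum, Fintype.piFinset_univ]
  have h2 : star (productState ψ) ⬝ᵥ (tensorOp A).mulVec (productState ψ) =
      ∑ p : Bits n × Bits n, ∏ i, star (ψ i (p.1 i)) * (A i (p.1 i) (p.2 i) * ψ i (p.2 i)) := by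
    rw [Fintype.sum_prod_type]
    simp only [dotProduct, Matrix.mulVec, Finset.mul_sum, tensorOp, Matrix.of_apply, productState,
      Pi.star_apply, star_prod, Finset.prod_mul_distrib]
  rw [h2]
  exact (Equiv.sum_comp (Equiv.arrowProdEquivProdArrow (Fin n) (fun _ => Fin 2) (fun _ => Fin 2))
    (fun p : Bits n × Bits n => ∏ i, star (ψ i (p.1 i)) *
      (A i (p.1 i) (p.2 i) * ψ i (p.2 i)))).symm

theorem energy_pauliOp_roundedQubit {n : ℕ} {m : Fin n → Pauli → ℝ}
    (hm : ∀ i p, p ≠ .I → |m i p| ≤ 1 / 3) (P : PauliString n) (r : Fin n → ℝ) :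
    energy (pauliOp P) (productState fun i => roundedQubit (m i) (r i)) =
      ∏ i, blochValue (m i) (r i) (P i) := by
  rw [energy, pauliOp_eq_tensorOp, dotProduct_tensorOp_productState,
    Finset.prod_congr rfl fun i _ => qubitExpectation_roundedQubit (hm i) (r i) (P i),
    ← Complex.ofReal_prod, Complex.ofReal_re]

/-- Independence of the draws; qubit `i` will use draw number `i`. -/
theorem integral_prod_tape {n : ℕ} {f : Fin n → unitInterval → ℝ} (hf : ∀ i, Measurable (f i)) :
    ∫ ω : Tape, ∏ i : Fin n, f i (ω i) ∂tapeLaw = ∏ i, ∫ r, f i r := by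
  have hmp : ∀ j : ℕ, MeasurePreserving (fun ω : Tape => ω j) tapeLaw volume :=
    fun j => measurePreserving_eval_infinitePi (fun _ : ℕ => (volume : Measure unitInterval)) j
  have h1 : ProbabilityTheory.iIndepFun (fun (j : ℕ) (ω : Tape) => ω j) tapeLaw :=
    ProbabilityTheory.iIndepFun_infinitePi (P := fun _ : ℕ => (volume : Measure unitInterval))
      (X := fun _ x => x) (fun _ => measurable_id)
  have h2 := (h1.precomp (g := fun i : Fin n => (i : ℕ)) Fin.val_injective).comp f hf
  refine (h2.integral_fun_prod_eq_prod_integral fun i =>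
    ((hf i).comp (hmp i).measurable).aestronglyMeasurable).trans ?_
  apply Finset.prod_congr rfl
  intro i _
  rw [← (hmp i).map_eq, integral_map (hmp i).measurable.aemeasurable
    (hf i).aestronglyMeasurable]
  rfl

theorem abs_blochValue_le (m : Pauli → ℝ) (r : ℝ) (p : Pauli) : |blochValue m r p| ≤ 4 := by
  have h : ∀ a, 0 ≤ step a r ∧ step a r ≤ 1 := by
    intro a; unfold step; split_ifs <;> norm_num
  rw [abs_le]
  cases p <;> simp only [blochValue]
  · norm_num
  · constructor <;> linarith [h (1 / 6 + m .X / 2), h (1 / 3)]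
  · constructor <;> linarith [h (1 / 2 + m .Y / 2), h (1 / 3), h (2 / 3)]
  · constructor <;> linarith [h (5 / 6 + m .Z / 2), h (2 / 3)]

instance : IsProbabilityMeasure tapeLaw :=
  inferInstanceAs (IsProbabilityMeasure (Measure.infinitePi fun _ : ℕ => (volume : Measure unitInterval)))

theorem integrable_prod_blochValue {n : ℕ} (m : Fin n → Pauli → ℝ) (P : PauliString n) :
    Integrable (fun ω : Tape => ∏ i, blochValue (m i) (ω i) (P i)) tapeLaw := by
  apply Integrable.of_bound (C := 4 ^ n)
  · refine (Finset.measurable_prod _ fun i _ => ?_).aestronglyMeasurable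
    exact (measurable_blochValue (m i) (P i)).comp (measurable_pi_apply _)
  · filter_upwards with ω
    rw [Real.norm_eq_abs, Finset.abs_prod]
    calc ∏ i, |blochValue (m i) (ω i) (P i)| ≤ ∏ _i : Fin n, (4 : ℝ) :=
          Finset.prod_le_prod (fun _ _ => abs_nonneg _) fun _ _ => abs_blochValue_le _ _ _
      _ = 4 ^ n := by simp

/-- The energy is multilinear in the Bloch vectors and the qubits are rounded independently, so the
expectation replaces every rounded Bloch vector by its mean. -/
theorem integral_energy_rounded {n : ℕ} {m : Fin n → Pauli → ℝ}
    (hm : ∀ i p, p ≠ .I → |m i p| ≤ 1 / 3) (α : PauliString n → ℝ) :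
    Integrable (fun ω : Tape => energy (hamiltonian α)
        (productState fun i => roundedQubit (m i) (ω i))) tapeLaw ∧
      ∫ ω, energy (hamiltonian α) (productState fun i => roundedQubit (m i) (ω i)) ∂tapeLaw =
        ∑ P, α P * ∏ i, if P i = .I then 1 else m i (P i) := by
  simp only [energy_hamiltonian, energy_pauliOp_roundedQubit hm _ fun i => _]
  constructor
  · exact integrable_finsetSum _ fun P _ => (integrable_prod_blochValue m P).const_mul _
  · rw [integral_finsetSum _ fun P _ => (integrable_prod_blochValue m P).const_mul _]
    apply Finset.sum_congr rfl
    intro P _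
    rw [integral_const_mul, integral_prod_tape (f := fun i (r : unitInterval) => blochValue (m i) r (P i))
      fun i => measurable_blochValue (m i) (P i)]
    simp only [integral_blochValue (hm _)]

/-! ### The program -/

/-- Reads the pair (qubit `q`, code `c`) at the input position `ptr` and computes the number
`4 q + c` of the corresponding variable. -/
def readVar (dst ptr : NReg) : List MemOp :=
  [.input .tmp ptr, .add .tmp .tmp .tmp, .add .tmp .tmp .tmp, .add .idx ptr .one,
    .input .idx .idx, .add dst .tmp .idx]

/-- Constants and the size of the input. -/
def setupProgram (k : ℕ) : Program :=
  block [.const .zero 0, .const .one 1, .const .two 2, .input .n .zero, .input .m .one,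
    .add .size .n .n, .add .size .size .size, .rconst .zero 0, .rconst .one 1, .rconst .two 2,
    .rconst .five 5, .rconst .six 6, .rconst .lam (5 ^ k), .rdiv .lam .one .lam,
    .const .v 0, .const .acc 0]

/-- The roots of the trie. -/
def rootsProgram : Program :=
  .whileDo (RegTest.lt .v .size).test <|
    block [.rstore .W .v .lam, .store .row .v .acc, .store .root .v .v, .add .acc .acc .size,
      .add .v .v .one]

/-- Creates the child of `node` for the variable `x`. -/
def createProgram : Program :=
  block [.add .ch .cnt .zero, .store .child .idx .ch, .store .row .ch .acc,
    .add .acc .acc .size, .store .par .ch .node, .store .root .ch .v, .store .var .ch .x,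
    .load .tmp .head .x, .store .next .ch .tmp, .store .head .x .ch, .rload .b .W .node,
    .rmul .b .b .five, .rstore .W .ch .b, .add .cnt .cnt .one]

/-- Moves from `node` to its child for the next variable of the current term. -/
def descendProgram : Program :=
  .seq (block (readVar .x .pj ++ [.load .idx .row .node, .add .idx .idx .x, .load .ch .child .idx]))
    (.seq (.ifThenElse (RegTest.lt .zero .ch).test (block []) createProgram)
      (block [.add .node .ch .zero, .rdiv .a .a .six, .add .j .j .one, .add .pj .pj .two]))

/-- Inserts the current term into the tree of its `p`-th variable. -/
def insertProgram : Program :=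
  .seq (block (readVar .v .pp ++ [.add .node .v .zero, .rinput .a .t, .const .j 0,
      .add .pj .pos .one]))
    (.seq (.whileDo (RegTest.lt .j .w).test descendProgram)
      (block [.rload .b .S .node, .radd .c .b .a, .rstore .S .node .c, .rmul .b .b .b,
        .rmul .c .c .c, .rsub .c .c .b, .rload .b .Q .v, .radd .b .b .c, .rstore .Q .v .b,
        .rload .b .W .node, .rmul .c .b .c, .rload .b .T .v, .radd .b .b .c, .rstore .T .v .b,
        .add .p .p .one, .add .pp .pp .two]))

/-- Moves the input position to the next term. -/
def nextTerm : List MemOp :=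
  [.add .t .t .one, .add .pos .pos .w, .add .pos .pos .w, .add .pos .pos .one]

/-- Builds the trie. -/
def buildProgram : Program :=
  .seq (block [.add .cnt .size .zero, .const .t 0, .const .pos 2])
    (.whileDo (RegTest.lt .t .m).test
      (.seq (block [.input .w .pos, .const .p 0, .add .pp .pos .one])
        (.seq (.whileDo (RegTest.lt .p .w).test insertProgram) (block nextTerm))))

/-- Adds the contribution of the node `node` to the derivative of the potential. -/
def slopeProgram : Program :=
  block [.load .ch .par .node, .load .v .root .node, .rload .a .S .node, .rload .b .S .ch,
    .rmul .a .a .b, .rload .b .W .ch, .rload .c .T .v, .rmul .b .b .c, .rload .c .Q .v,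
    .rdiv .b .b .c, .rsub .b .one .b, .rmul .a .a .b, .rsqrt .c .c, .rdiv .a .a .c,
    .radd .d .d .a, .load .node .next .node]

/-- Merges the node `node` into its parent. -/
def mergeProgram : Program :=
  block [.load .ch .par .node, .load .v .root .node, .rload .a .S .node, .rload .b .S .ch,
    .rmul .c .y .a, .radd .c .b .c, .rstore .S .ch .c, .rmul .c .c .c, .rmul .b .b .b,
    .rsub .c .c .b, .rmul .a .a .a, .rmul .a .a .five, .rsub .c .c .a, .rload .b .W .ch,
    .rmul .c .b .c, .rload .b .T .v, .radd .b .b .c, .rstore .T .v .b,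
    .load .node .next .node]

/-- Chooses the signs of all variables, the last one first. -/
def signProgram : Program :=
  .seq (block [.add .u .size .zero])
    (.whileDo (RegTest.lt .zero .u).test
      (.seq (block [.sub .u .u .one, .rconst .d 0, .load .node .head .u])
        (.seq (.whileDo (RegTest.lt .zero .node).test slopeProgram)
          (.seq (.ifThenElse (RegTest.rlt .d .zero).test (block [.rconst .y (-1)])
              (block [.rconst .y 1]))
            (.seq (block [.rstore .Y .u .y, .load .node .head .u])
              (.whileDo (RegTest.lt .zero .node).test mergeProgram))))))

/-- Computes the value of the variable `x` at the parameter in the register `tt`. -/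
def valueProgram (tt : RReg) : Program :=
  .seq (block [.rload .b .Y .x, .rload .c .S .x])
    (.seq (.ifThenElse (RegTest.rlt .c .zero).test (block [.rsub .c .one tt])
        (block [.radd .c .one tt]))
      (block [.rmul .b .b .c, .rdiv .b .b .six]))

/-- Adds the value of the current term to the register `d`. -/
def evalTermProgram : Program :=
  .seq (block [.rinput .a .t, .const .j 0, .add .pj .pos .one])
    (.seq (.whileDo (RegTest.lt .j .w).test
        (.seq (block (readVar .x .pj)) (.seq (valueProgram .tt)
          (block [.rmul .a .a .b, .add .j .j .one, .add .pj .pj .two]))))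
      (block [.radd .d .d .a]))

/-- Evaluates the candidate with parameter `1 / (j + 1)` and keeps it if it is the best so far. -/
def candidateProgram (j : ℕ) : Program :=
  .seq (block [.rconst .tt ((j : ℤ) + 1), .rdiv .tt .one .tt, .const .t 0, .const .pos 2,
      .rconst .d 0])
    (.seq (.whileDo (RegTest.lt .t .m).test
        (.seq (block [.input .w .pos])
          (.seq (.ifThenElse (RegTest.lt .zero .w).test evalTermProgram (block []))
            (block nextTerm))))
      (.seq (.ifThenElse (RegTest.rlt .d .zero).test (block [.rsub .d .zero .d]) (block []))
        (.ifThenElse (RegTest.rlt .best .d).test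
          (block [.radd .best .d .zero, .radd .bt .tt .zero]) (block []))))

/-- Evaluates the candidates with the first `k` parameters. -/
def candidatesProgram : ℕ → Program
  | 0 => block [.rconst .best 0, .rconst .bt 0]
  | k + 1 => .seq (candidatesProgram k) (candidateProgram k)

/-- The constants used for rounding. -/
def roundingSetup : Program :=
  block [.rsqrt .h .two, .rdiv .h .one .h, .rdiv .third .two .six,
    .radd .twoThirds .third .third, .rdiv .cX .one .six, .rdiv .cY .one .two,
    .rdiv .cZ .five .six, .const .i 0, .const .o 0]

/-- Computes a threshold from the component of the Bloch vector with number `o + 1`, and increases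
`o`. -/
def thresholdProgram (m c : RReg) : Program :=
  .seq (block [.add .o .o .one, .add .x .o .zero])
    (.seq (valueProgram .bt) (block [.rdiv .b .b .two, .radd m c .b]))

/-- Sets the amplitudes of the qubit. -/
def chooseProgram : Program :=
  .ifThenElse (RegTest.rlt .r .mX).test
    (block [.radd .a .h .zero, .radd .b .h .zero, .rconst .c 0]) <|
  .ifThenElse (RegTest.rlt .r .third).test
    (block [.radd .a .h .zero, .rsub .b .zero .h, .rconst .c 0]) <|
  .ifThenElse (RegTest.rlt .r .mY).test
    (block [.radd .a .h .zero, .rconst .b 0, .radd .c .h .zero]) <|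
  .ifThenElse (RegTest.rlt .r .twoThirds).test
    (block [.radd .a .h .zero, .rconst .b 0, .rsub .c .zero .h]) <|
  .ifThenElse (RegTest.rlt .r .mZ).test
    (block [.rconst .a 1, .rconst .b 0, .rconst .c 0])
    (block [.rconst .a 0, .rconst .b 1, .rconst .c 0])

/-- Rounds all qubits. -/
def roundingProgram : Program :=
  .seq roundingSetup <| .whileDo (RegTest.lt .i .n).test <|
    .seq (thresholdProgram .mX .cX) <| .seq (thresholdProgram .mY .cY) <|
    .seq (thresholdProgram .mZ .cZ) <| .seq (block [.rrandom .r]) <| .seq chooseProgram <|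
    block [.sub .o .o .two, .sub .o .o .one, .rwrite .o .a, .add .o .o .one, .rwrite .o .zero,
      .add .o .o .one, .rwrite .o .b, .add .o .o .one, .rwrite .o .c, .add .o .o .one,
      .add .i .i .one]

/-- Chooses the best candidate. -/
def selectProgram (k : ℕ) : Program :=
  .seq (setupProgram k) <| .seq rootsProgram <| .seq buildProgram <| .seq signProgram <|
    candidatesProgram (k + 1)

/-- The whole program. -/
def optimizeProgram (k : ℕ) : Program :=
  .seq (selectProgram k) roundingProgram

@[simp] theorem execs_nil (inp : Input) (ω : Tape) (s : Memory) : execs inp ω [] s = s := rfl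

@[simp] theorem execs_cons (inp : Input) (ω : Tape) (o : MemOp) (l : List MemOp) (s : Memory) :
    execs inp ω (o :: l) s = execs inp ω l (o.exec inp ω s) := rfl

@[simp] theorem execs_append (inp : Input) (ω : Tape) (l l' : List MemOp) (s : Memory) :
    execs inp ω (l ++ l') s = execs inp ω l' (execs inp ω l s) := List.foldl_append

/-! ### The terms of the input -/

/-- The input lists `m` terms on `n` qubits; the list of variables of term `t` is `l t`, its
coefficient is `a t`, and its description starts at the position `pos t`. -/
structure ReadsTerms (k n m : ℕ) (l : ℕ → List ℕ) (a : ℕ → ℝ) (pos : ℕ → ℕ) (inp : Input) :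
    Prop where
  nats_zero : inp.nats.getD 0 0 = n
  nats_one : inp.nats.getD 1 0 = m
  pos_zero : pos 0 = 2
  pos_succ : ∀ t < m, pos (t + 1) = pos t + (l t).length + (l t).length + 1
  weight : ∀ t < m, inp.nats.getD (pos t) 0 = (l t).length
  var : ∀ t < m, ∀ j < (l t).length,
    4 * inp.nats.getD (pos t + 1 + 2 * j) 0 + inp.nats.getD (pos t + 1 + 2 * j + 1) 0 =
      (l t).getD j 0
  coeff : ∀ t < m, inp.reals.getD t 0 = a t
  lt : ∀ t < m, ∀ x ∈ l t, x < 4 * n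
  sorted : ∀ t < m, (l t).Pairwise (· < ·)
  length_le : ∀ t < m, (l t).length ≤ k
  inj : ∀ t < m, ∀ t' < m, l t = l t' → t = t'

/-- The registers holding constants. -/
structure HoldsConstants (n m : ℕ) (s : Memory) : Prop where
  nr_zero : s.nr .zero = 0
  nr_one : s.nr .one = 1
  nr_two : s.nr .two = 2
  nr_n : s.nr .n = n
  nr_m : s.nr .m = m
  nr_size : s.nr .size = 4 * n
  rr_zero : s.rr .zero = 0
  rr_one : s.rr .one = 1
  rr_two : s.rr .two = 2
  rr_five : s.rr .five = 5
  rr_six : s.rr .six = 6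

/-- `a` is the head of a linked list with the entries `l`. -/
def IsChain (next : ℕ → ℕ) : ℕ → List ℕ → Prop
  | a, [] => a = 0
  | a, b :: l => a = b ∧ b ≠ 0 ∧ IsChain next (next b) l

/-- The nodes with variable `x`, the last created first. -/
def nodesAt (M : ℕ) (var : ℕ → ℕ) (cnt x : ℕ) : List ℕ :=
  ((List.range cnt).filter fun ν => M ≤ ν ∧ var ν = x).reverse

theorem IsChain.congr {next next' : ℕ → ℕ} {l : List ℕ} {a : ℕ} (h : IsChain next a l)
    (hn : ∀ b ∈ l, next' b = next b) : IsChain next' a l := by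
  induction l generalizing a with
  | nil => exact h
  | cons b l ih =>
    refine ⟨h.1, h.2.1, ?_⟩
    rw [hn b (by simp)]
    exact ih h.2.2 fun c hc => hn c (by simp [hc])

theorem mem_nodesAt {M cnt x ν : ℕ} {var : ℕ → ℕ} :
    ν ∈ nodesAt M var cnt x ↔ ν < cnt ∧ M ≤ ν ∧ var ν = x := by
  simp [nodesAt]

theorem nodup_nodesAt {M cnt x : ℕ} {var : ℕ → ℕ} : (nodesAt M var cnt x).Nodup := by
  rw [nodesAt, List.nodup_reverse]
  exact List.nodup_range.filter _

/-- The arrays of the memory hold a trie with `cnt` nodes, of which the first `M` are roots; the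
path from the root to the node `ν` is labelled by `path ν`. -/
structure IsTrie (M k : ℕ) (s : Memory) (cnt : ℕ) (path : ℕ → List ℕ) : Prop where
  le_cnt : M ≤ cnt
  row : ∀ ν < cnt, s.na .row ν = ν * M
  root_root : ∀ v < M, s.na .root v = v
  root_lt : ∀ ν < cnt, s.na .root ν < M
  path_root : ∀ v < M, path v = []
  weight : ∀ ν < cnt, s.ra .W ν = 1 / 5 ^ k * 5 ^ (path ν).length
  par_lt : ∀ ν < cnt, M ≤ ν → s.na .par ν < ν
  var_lt : ∀ ν < cnt, M ≤ ν → s.na .var ν < M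
  root_par : ∀ ν < cnt, M ≤ ν → s.na .root (s.na .par ν) = s.na .root ν
  path_par : ∀ ν < cnt, M ≤ ν → path ν = path (s.na .par ν) ++ [s.na .var ν]
  child_par : ∀ ν < cnt, M ≤ ν → s.na .child (s.na .par ν * M + s.na .var ν) = ν
  child_ne : ∀ ν < cnt, ∀ x < M, s.na .child (ν * M + x) ≠ 0 →
    M ≤ s.na .child (ν * M + x) ∧ s.na .child (ν * M + x) < cnt ∧
      s.na .par (s.na .child (ν * M + x)) = ν ∧ s.na .var (s.na .child (ν * M + x)) = x
  child_zero : ∀ i, cnt * M ≤ i → s.na .child i = 0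
  sorted : ∀ ν < cnt, (path ν).Pairwise (· < ·)
  length_le : ∀ ν < cnt, (path ν).length ≤ k
  chain : ∀ x < M, IsChain (s.na .next) (s.na .head x) (nodesAt M (s.na .var) cnt x)
  S_zero : ∀ ν, cnt ≤ ν → s.ra .S ν = 0

theorem nodesAt_succ {M cnt x y : ℕ} {var : ℕ → ℕ} (hM : M ≤ cnt) :
    nodesAt M (Function.update var cnt x) (cnt + 1) y =
      if x = y then cnt :: nodesAt M var cnt y else nodesAt M var cnt y := by
  have h : ((List.range cnt).filter fun ν => M ≤ ν ∧ Function.update var cnt x ν = y) =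
      (List.range cnt).filter fun ν => M ≤ ν ∧ var ν = y := by
    apply List.filter_congr
    intro ν hν
    rw [Function.update_of_ne (List.mem_range.1 hν).ne]
  rw [nodesAt, List.range_succ, List.filter_append, List.reverse_append, h, ← nodesAt]
  by_cases hxy : x = y <;> simp [hxy, hM]

/-- Creation of a node. -/
theorem IsTrie.insert {M k : ℕ} {s s' : Memory} {cnt : ℕ}
    {path : ℕ → List ℕ} {ν x : ℕ} (hM : 0 < M) (h : IsTrie M k s cnt path)
    (hν : ν < cnt) (hxM : x < M) (hch : s.na .child (ν * M + x) = 0)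
    (hsort : (path ν ++ [x]).Pairwise (· < ·)) (hlen : (path ν ++ [x]).length ≤ k)
    (e_child : s'.na .child = Function.update (s.na .child) (ν * M + x) cnt)
    (e_row : s'.na .row = Function.update (s.na .row) cnt (cnt * M))
    (e_par : s'.na .par = Function.update (s.na .par) cnt ν)
    (e_root : s'.na .root = Function.update (s.na .root) cnt (s.na .root ν))
    (e_var : s'.na .var = Function.update (s.na .var) cnt x)
    (e_next : s'.na .next = Function.update (s.na .next) cnt (s.na .head x))
    (e_head : s'.na .head = Function.update (s.na .head) x cnt)
    (e_W : s'.ra .W = Function.update (s.ra .W) cnt (s.ra .W ν * 5))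
    (e_S : s'.ra .S = s.ra .S) :
    IsTrie M k s' (cnt + 1) (Function.update path cnt (path ν ++ [x])) := by
  have hMc := h.le_cnt
  have hcnt0 : cnt ≠ 0 := by omega
  have split : ∀ {μ}, μ < cnt + 1 → μ = cnt ∨ (μ < cnt ∧ μ ≠ cnt) := fun h => by omega
  have idx_lt : ∀ {μ y}, μ < cnt → y < M → μ * M + y < cnt * M := by
    intro μ y hμ hy
    calc μ * M + y < μ * M + M := by omega
      _ = (μ + 1) * M := by ring
      _ ≤ cnt * M := Nat.mul_le_mul_right _ hμ
  have idx_inj : ∀ {μ y ν x}, y < M → x < M → μ * M + y = ν * M + x → μ = ν ∧ y = x := by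
    intro μ y ν x hy hx he
    have h1 : (μ * M + y) / M = μ := by
      rw [mul_comm, Nat.mul_add_div hM, Nat.div_eq_of_lt hy, add_zero]
    have h2 : (ν * M + x) / M = ν := by
      rw [mul_comm, Nat.mul_add_div hM, Nat.div_eq_of_lt hx, add_zero]
    have h3 : μ = ν := by rw [← h1, ← h2, he]
    subst h3
    exact ⟨rfl, by omega⟩
  refine ⟨by omega, ?_, ?_, ?_, ?_, ?_, ?_, ?_, ?_, ?_, ?_, ?_, ?_, ?_, ?_, ?_, ?_⟩
  · intro μ hμ
    rw [e_row]
    rcases split hμ with rfl | ⟨h1, h2⟩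
    · simp
    · rw [Function.update_of_ne h2, h.row μ h1]
  · intro v hv
    rw [e_root, Function.update_of_ne (by omega), h.root_root v hv]
  · intro μ hμ
    rw [e_root]
    rcases split hμ with rfl | ⟨h1, h2⟩
    · simp [h.root_lt ν hν]
    · rw [Function.update_of_ne h2]; exact h.root_lt μ h1
  · intro v hv
    rw [Function.update_of_ne (by omega), h.path_root v hv]
  · intro μ hμ
    rw [e_W]
    rcases split hμ with rfl | ⟨h1, h2⟩
    · simp only [Function.update_self, h.weight ν hν, List.length_append, List.length_singleton]
      ring
    · rw [Function.update_of_ne h2, Function.update_of_ne h2, h.weight μ h1]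
  · intro μ hμ hMμ
    rw [e_par]
    rcases split hμ with rfl | ⟨h1, h2⟩
    · simpa
    · rw [Function.update_of_ne h2]; exact h.par_lt μ h1 hMμ
  · intro μ hμ hMμ
    rw [e_var]
    rcases split hμ with rfl | ⟨h1, h2⟩
    · simpa
    · rw [Function.update_of_ne h2]; exact h.var_lt μ h1 hMμ
  · intro μ hμ hMμ
    rw [e_root, e_par]
    rcases split hμ with rfl | ⟨h1, h2⟩
    · rw [Function.update_self, Function.update_self, Function.update_of_ne hν.ne]
    · have := h.par_lt μ h1 hMμ
      rw [Function.update_of_ne h2, Function.update_of_ne h2, Function.update_of_ne (by omega),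
        h.root_par μ h1 hMμ]
  · intro μ hμ hMμ
    rw [e_var, e_par]
    rcases split hμ with rfl | ⟨h1, h2⟩
    · simp [hν.ne]
    · have := h.par_lt μ h1 hMμ
      rw [Function.update_of_ne h2, Function.update_of_ne h2, Function.update_of_ne h2,
        Function.update_of_ne (by omega), h.path_par μ h1 hMμ]
  · intro μ hμ hMμ
    rw [e_var, e_par, e_child]
    rcases split hμ with rfl | ⟨h1, h2⟩
    · simp
    · rw [Function.update_of_ne h2, Function.update_of_ne h2]
      have hc := h.child_par μ h1 hMμ
      rw [Function.update_of_ne, hc]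
      -- If the two entries coincided, the entry pointing to `μ` would hold 0, but 0 is a root.
      intro he
      rw [he, hch] at hc
      omega
  · intro μ hμ y hy
    rw [e_child, e_par, e_var]
    by_cases he : μ * M + y = ν * M + x
    · obtain ⟨rfl, rfl⟩ := idx_inj hy hxM he
      simp [hMc]
    · rw [Function.update_of_ne he]
      -- The row of the new node lies beyond all rows in use, so its entries are still the initial
      -- 0, meaning "no child".
      rcases split hμ with rfl | ⟨h1, h2⟩
      · intro h0
        exact absurd (h.child_zero _ (by omega)) h0
      · intro h0
        obtain ⟨c1, c2, c3, c4⟩ := h.child_ne μ h1 y hy h0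
        rw [Function.update_of_ne c2.ne, Function.update_of_ne c2.ne]
        exact ⟨c1, by omega, c3, c4⟩
  · intro i hi
    have := idx_lt hν hxM
    rw [add_mul] at hi
    rw [e_child, Function.update_of_ne (by omega), h.child_zero i (by omega)]
  · intro μ hμ
    rcases split hμ with rfl | ⟨h1, h2⟩
    · simpa using hsort
    · rw [Function.update_of_ne h2]; exact h.sorted μ h1
  · intro μ hμ
    rcases split hμ with rfl | ⟨h1, h2⟩
    · simpa using hlen
    · rw [Function.update_of_ne h2]; exact h.length_le μ h1
  · intro y hy
    rw [e_var, e_next, e_head, nodesAt_succ hMc]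
    have hn : ∀ b ∈ nodesAt M (s.na .var) cnt y,
        Function.update (s.na .next) cnt (s.na .head x) b = s.na .next b := by
      intro b hb
      rw [Function.update_of_ne (mem_nodesAt.1 hb).1.ne]
    split_ifs with hxy
    · subst hxy
      refine ⟨by simp, hcnt0, ?_⟩
      rw [Function.update_self]
      exact (h.chain x hy).congr hn
    · rw [Function.update_of_ne (Ne.symm hxy)]
      exact (h.chain y hy).congr hn
  · intro μ hμ
    rw [e_S, h.S_zero μ (by omega)]

theorem halts_createProgram {inp : Input} {ω : Tape} {n m k : ℕ} {s : Memory} {cnt : ℕ}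
    {path : ℕ → List ℕ} {ν x : ℕ} (hn : 1 ≤ n) (h : IsTrie (4 * n) k s cnt path)
    (hc : HoldsConstants n m s) (hcnt : s.nr .cnt = cnt) (hacc : s.nr .acc = cnt * (4 * n))
    (hnode : s.nr .node = ν) (hx : s.nr .x = x) (hidx : s.nr .idx = ν * (4 * n) + x)
    (hv : s.nr .v = s.na .root ν)
    (hν : ν < cnt) (hxM : x < 4 * n) (hch : s.na .child (ν * (4 * n) + x) = 0)
    (hsort : (path ν ++ [x]).Pairwise (· < ·)) (hlen : (path ν ++ [x]).length ≤ k) :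
    Halts inp ω createProgram 100 (fun s' =>
      IsTrie (4 * n) k s' (cnt + 1) (Function.update path cnt (path ν ++ [x])) ∧
      HoldsConstants n m s' ∧ s'.nr .cnt = cnt + 1 ∧ s'.nr .acc = (cnt + 1) * (4 * n) ∧
      s'.nr .ch = cnt ∧ s'.na .root = Function.update (s.na .root) cnt (s.na .root ν) ∧
      s'.ra = Function.update s.ra .W (Function.update (s.ra .W) cnt (s.ra .W ν * 5)) ∧
      s'.rr .a = s.rr .a ∧
      ∀ r, r ∉ [NReg.ch, .acc, .tmp, .cnt] → s'.nr r = s.nr r) s := by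
  refine (Halts.of_block ?_).mono (by simp [MemOp.time]) fun _ h => h
  simp only [execs_cons, execs_nil, MemOp.exec]
  refine ⟨?_, ?_, ?_, ?_, ?_, ?_, ?_, ?_, ?_⟩
  · apply h.insert (by omega) hν hxM hch hsort hlen <;>
      simp [hcnt, hc.nr_zero, hacc, hnode, hx, hidx, hv, hc.rr_five]
  · constructor <;> simp [hc.nr_zero, hc.nr_one, hc.nr_two, hc.nr_n, hc.nr_m, hc.nr_size,
      hc.rr_zero, hc.rr_one, hc.rr_two, hc.rr_five, hc.rr_six]
  · simp [hcnt, hc.nr_one]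
  · simp [hacc, hc.nr_size]; ring
  · simp [hcnt, hc.nr_zero]
  · simp [hcnt, hc.nr_zero, hv]
  · simp [hcnt, hc.nr_zero, hc.rr_five, hnode]
  · simp
  · intro r hr
    simp at hr
    simp [hr]

theorem Halts.seq_of {inp : Input} {ω : Tape} {p q : Program} {T T' : ℕ} {P Q : Memory → Prop}
    {s : Memory} (h : Halts inp ω p T P s) (h' : ∀ s', P s' → Halts inp ω q T' Q s') :
    Halts inp ω (.seq p q) (T + T') Q s :=
  Halts.seq (h.mono le_rfl h')

theorem Halts.of_block_le {inp : Input} {ω : Tape} {l : List MemOp} {T : ℕ} {Q : Memory → Prop}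
    {s : Memory} (hQ : Q (execs inp ω l s)) (hT : (l.map MemOp.time).sum + 1 ≤ T) :
    Halts inp ω (block l) T Q s :=
  (Halts.of_block hQ).mono hT fun _ h => h

theorem execs_readVar {inp : Input} {ω : Tape} {s : Memory} {dst ptr : NReg} {x : ℕ}
    (h1 : s.nr .one = 1) (hptr : ptr ≠ .tmp)
    (hx : 4 * inp.nats.getD (s.nr ptr) 0 + inp.nats.getD (s.nr ptr + 1) 0 = x) :
    (execs inp ω (readVar dst ptr) s).na = s.na ∧ (execs inp ω (readVar dst ptr) s).ra = s.ra ∧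
    (execs inp ω (readVar dst ptr) s).rr = s.rr ∧ (execs inp ω (readVar dst ptr) s).out = s.out ∧
    (execs inp ω (readVar dst ptr) s).drawn = s.drawn ∧
    (execs inp ω (readVar dst ptr) s).nr dst = x ∧
    ∀ r, r ≠ .tmp → r ≠ .idx → r ≠ dst → (execs inp ω (readVar dst ptr) s).nr r = s.nr r := by
  simp only [readVar, execs_cons, execs_nil, MemOp.exec]
  refine ⟨trivial, trivial, trivial, trivial, trivial, ?_, ?_⟩
  · simp only [List.getD_eq_getElem?_getD] at hx
    simp [h1, hptr]
    omega
  · intro r h2 h3 h4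
    simp [h2, h3, h4]

theorem HoldsConstants.frame {n m : ℕ} {s s' : Memory} (h : HoldsConstants n m s)
    (hn : ∀ r ∈ [NReg.zero, .one, .two, .n, .m, .size], s'.nr r = s.nr r)
    (hr : ∀ r ∈ [RReg.zero, .one, .two, .five, .six], s'.rr r = s.rr r) :
    HoldsConstants n m s' := by
  constructor
  · rw [hn _ (by simp), h.nr_zero]
  · rw [hn _ (by simp), h.nr_one]
  · rw [hn _ (by simp), h.nr_two]
  · rw [hn _ (by simp), h.nr_n]
  · rw [hn _ (by simp), h.nr_m]
  · rw [hn _ (by simp), h.nr_size]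
  · rw [hr _ (by simp), h.rr_zero]
  · rw [hr _ (by simp), h.rr_one]
  · rw [hr _ (by simp), h.rr_two]
  · rw [hr _ (by simp), h.rr_five]
  · rw [hr _ (by simp), h.rr_six]

theorem IsTrie.congr {M k cnt : ℕ} {s s' : Memory} {path : ℕ → List ℕ}
    (h : IsTrie M k s cnt path) (hn : s'.na = s.na) (hW : s'.ra .W = s.ra .W)
    (hS : ∀ ν, cnt ≤ ν → s'.ra .S ν = 0) : IsTrie M k s' cnt path := by
  obtain ⟨h1, h2, h3, h4, h5, h6, h7, h8, h9, h10, h11, h12, h13, h14, h15, h16, h17⟩ := h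
  constructor <;> first | assumption | (rw [hn]; assumption) | (rw [hW]; assumption)

/-! ### Building the trie -/

/-- The sum of `F` over the insertions into the tree of `v` that precede insertion `p` of term
`t`. -/
def doneSum (l : ℕ → List ℕ) (F : ℕ → ℝ) (v t p : ℕ) : ℝ :=
  ∑ t' ∈ Finset.range t, ∑ j ∈ Finset.range (l t').length,
      (if (l t').getD j 0 = v then F t' else 0) +
    ∑ j ∈ Finset.range p, if (l t).getD j 0 = v then F t else 0

theorem doneSum_succ (l : ℕ → List ℕ) (F : ℕ → ℝ) (v t p : ℕ) :
    doneSum l F v t (p + 1) =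
      doneSum l F v t p + if (l t).getD p 0 = v then F t else 0 := by
  rw [doneSum, Finset.sum_range_succ, doneSum, add_assoc]

theorem doneSum_length (l : ℕ → List ℕ) (F : ℕ → ℝ) (v t : ℕ) :
    doneSum l F v t (l t).length = doneSum l F v (t + 1) 0 := by
  simp [doneSum, Finset.sum_range_succ]

theorem doneSum_zero (l : ℕ → List ℕ) (F : ℕ → ℝ) (v : ℕ) : doneSum l F v 0 0 = 0 := by
  simp [doneSum]

/-- The memory during the construction of the trie. -/
structure Building (k n m : ℕ) (l : ℕ → List ℕ) (a : ℕ → ℝ) (t p cnt : ℕ) (path : ℕ → List ℕ)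
    (s : Memory) : Prop where
  trie : IsTrie (4 * n) k s cnt path
  consts : HoldsConstants n m s
  nr_cnt : s.nr .cnt = cnt
  nr_acc : s.nr .acc = cnt * (4 * n)
  poly : ∀ (y : ℕ → ℝ) v, ∑ ν ∈ Finset.range cnt with s.na .root ν = v,
    s.ra .S ν * ((path ν).map y).prod =
      doneSum l (fun t => a t / 6 ^ (l t).length * ((l t).map y).prod) v t p
  sq : ∀ v, s.ra .Q v = doneSum l (fun t => (a t / 6 ^ (l t).length) ^ 2) v t p
  sq_eq : ∀ v, s.ra .Q v = ∑ ν ∈ Finset.range cnt with s.na .root ν = v, s.ra .S ν ^ 2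
  weighted : ∀ v, s.ra .T v =
    ∑ ν ∈ Finset.range cnt with s.na .root ν = v, s.ra .W ν * s.ra .S ν ^ 2
  done : ∀ ν < cnt, s.ra .S ν ≠ 0 → ∃ t' j, path ν = l t' ∧ j < (l t').length ∧
    s.na .root ν = (l t').getD j 0 ∧ t' < m ∧ (t' < t ∨ t' = t ∧ j < p)

theorem Building.congr {k n m t p cnt : ℕ} {l : ℕ → List ℕ} {a : ℕ → ℝ} {path : ℕ → List ℕ}
    {s s' : Memory} (h : Building k n m l a t p cnt path s)
    (hna : s'.na = s.na) (hra : s'.ra = s.ra)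
    (hn : ∀ r ∈ [NReg.zero, .one, .two, .n, .m, .size, .cnt, .acc], s'.nr r = s.nr r)
    (hr : ∀ r ∈ [RReg.zero, .one, .two, .five, .six], s'.rr r = s.rr r) :
    Building k n m l a t p cnt path s' := by
  obtain ⟨h1, h2, h3, h4, h5, h6, h7, h8, h9⟩ := h
  refine ⟨h1.congr hna (by rw [hra]) (by rw [hra]; exact h1.S_zero),
    h2.frame (fun r hr' => hn r (by simp at hr' ⊢; tauto)) hr, ?_, ?_, ?_, ?_, ?_, ?_, ?_⟩
  · rw [hn _ (by simp), h3]
  · rw [hn _ (by simp), h4]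
  · rw [hna, hra]; exact h5
  · rw [hra]; exact h6
  · rw [hna, hra]; exact h7
  · rw [hna, hra]; exact h8
  · rw [hna, hra]; exact h9

/-- The registers of the loops over the terms. -/
structure AtTerm (l : ℕ → List ℕ) (pos : ℕ → ℕ) (t p : ℕ) (s : Memory) : Prop where
  nr_t : s.nr .t = t
  nr_w : s.nr .w = (l t).length
  nr_p : s.nr .p = p
  nr_pos : s.nr .pos = pos t
  nr_pp : s.nr .pp = pos t + 1 + 2 * p

theorem AtTerm.congr {l : ℕ → List ℕ} {pos : ℕ → ℕ} {t p : ℕ} {s s' : Memory}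
    (h : AtTerm l pos t p s) (hn : ∀ r ∈ [NReg.t, .w, .p, .pos, .pp], s'.nr r = s.nr r) :
    AtTerm l pos t p s' := by
  constructor
  · rw [hn _ (by simp), h.nr_t]
  · rw [hn _ (by simp), h.nr_w]
  · rw [hn _ (by simp), h.nr_p]
  · rw [hn _ (by simp), h.nr_pos]
  · rw [hn _ (by simp), h.nr_pp]

/-- The memory during the descent along term `t` in the tree of its `p`-th variable. -/
structure Descending (k n m : ℕ) (l : ℕ → List ℕ) (a : ℕ → ℝ) (pos : ℕ → ℕ) (B t p j cnt : ℕ)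
    (path : ℕ → List ℕ) (s : Memory) : Prop where
  building : Building k n m l a t p cnt path s
  term : AtTerm l pos t p s
  node_lt : s.nr .node < cnt
  path_node : path (s.nr .node) = (l t).take j
  root_node : s.na .root (s.nr .node) = s.nr .v
  nr_v : s.nr .v = (l t).getD p 0
  rr_a : s.rr .a = a t / 6 ^ j
  nr_j : s.nr .j = j
  nr_pj : s.nr .pj = pos t + 1 + 2 * j
  cnt_le : cnt ≤ B + j

/-- A new node has coefficient 0, so it changes none of the sums over nodes. -/
theorem Building.create {k n m t p cnt : ℕ} {l : ℕ → List ℕ} {a : ℕ → ℝ} {path : ℕ → List ℕ}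
    {s s' : Memory} {ν x : ℕ} (h : Building k n m l a t p cnt path s)
    (ht : IsTrie (4 * n) k s' (cnt + 1) (Function.update path cnt (path ν ++ [x])))
    (hc : HoldsConstants n m s') (hcnt : s'.nr .cnt = cnt + 1)
    (hacc : s'.nr .acc = (cnt + 1) * (4 * n))
    (hroot : s'.na .root = Function.update (s.na .root) cnt (s.na .root ν))
    (hra : s'.ra = Function.update s.ra .W (Function.update (s.ra .W) cnt (s.ra .W ν * 5))) :
    Building k n m l a t p (cnt + 1) (Function.update path cnt (path ν ++ [x])) s' := by
  have hS : s'.ra .S = s.ra .S := by rw [hra, Function.update_of_ne (by simp)]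
  have hQ : s'.ra .Q = s.ra .Q := by rw [hra, Function.update_of_ne (by simp)]
  have hT : s'.ra .T = s.ra .T := by rw [hra, Function.update_of_ne (by simp)]
  have hW : ∀ μ < cnt, s'.ra .W μ = s.ra .W μ := by
    intro μ hμ; rw [hra, Function.update_self, Function.update_of_ne hμ.ne]
  have hr : ∀ μ < cnt, s'.na .root μ = s.na .root μ := by
    intro μ hμ; rw [hroot, Function.update_of_ne hμ.ne]
  have h0 : s.ra .S cnt = 0 := h.trie.S_zero cnt le_rfl
  have hsum : ∀ (F F' : ℕ → ℝ) v, (∀ μ < cnt, F' μ = F μ) → F' cnt = 0 →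
      ∑ μ ∈ Finset.range (cnt + 1) with s'.na .root μ = v, F' μ =
        ∑ μ ∈ Finset.range cnt with s.na .root μ = v, F μ := by
    intro F F' v hF hF0
    rw [Finset.sum_filter, Finset.sum_range_succ, hF0, ite_self, add_zero, Finset.sum_filter]
    apply Finset.sum_congr rfl
    intro μ hμ
    rw [hr μ (Finset.mem_range.1 hμ), hF μ (Finset.mem_range.1 hμ)]
  refine ⟨ht, hc, hcnt, hacc, ?_, ?_, ?_, ?_, ?_⟩
  · intro y v
    rw [← h.poly y v, hS]
    apply hsum
    · intro μ hμ; rw [Function.update_of_ne hμ.ne]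
    · rw [h0, zero_mul]
  · rw [hQ]; exact h.sq
  · intro v
    rw [hQ, h.sq_eq v, hS]
    symm
    apply hsum
    · intro μ hμ; rfl
    · simp [h0]
  · intro v
    rw [hT, h.weighted v, hS]
    symm
    apply hsum
    · intro μ hμ; rw [hW μ hμ]
    · simp [h0]
  · intro μ hμ hSμ
    rw [hS] at hSμ
    have hμ' : μ < cnt := by
      rcases Nat.lt_succ_iff_lt_or_eq.1 hμ with h1 | rfl
      · exact h1
      · exact absurd h0 hSμ
    rw [hr μ hμ', Function.update_of_ne hμ'.ne]
    exact h.done μ hμ' hSμ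

/-- The child is found by direct indexing, hence in constant time, and at most one node is created.
The coefficient loses a factor 6 per level, so it arrives at the end of the path as `a t / 6 ^ |t|`.
-/
theorem Descending.step {inp : Input} {ω : Tape} {k n m : ℕ} {l : ℕ → List ℕ} {a : ℕ → ℝ}
    {pos : ℕ → ℕ} {B t p j cnt : ℕ} {path : ℕ → List ℕ} {s : Memory} (hn : 1 ≤ n)
    (hin : ReadsTerms k n m l a pos inp) (ht : t < m) (hj : j < (l t).length)
    (h : Descending k n m l a pos B t p j cnt path s) :
    Halts inp ω descendProgram 200
      (fun s' => ∃ cnt path, Descending k n m l a pos B t p (j + 1) cnt path s') s := by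
  set ν := s.nr .node with hνdef
  set x := (l t).getD j 0 with hxdef
  have hx : (l t)[j] = x := by simp [hxdef, hj]
  have hxM : x < 4 * n := hin.lt t ht x (by rw [← hx]; exact List.getElem_mem hj)
  have htake : (l t).take (j + 1) = (l t).take j ++ [x] := by
    rw [List.take_succ_eq_append_getElem hj, hx]
  have hc := h.building.consts
  have htr := h.building.trie
  refine (Halts.seq_of (T := 50) (T' := 150) (P := fun s1 => s1.na = s.na ∧ s1.ra = s.ra ∧
    s1.rr = s.rr ∧ (∀ r, r ∉ [NReg.tmp, .idx, .x, .ch] → s1.nr r = s.nr r) ∧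
    s1.nr .x = x ∧ s1.nr .idx = ν * (4 * n) + x ∧
    s1.nr .ch = s.na .child (ν * (4 * n) + x)) ?_ ?_).mono (by norm_num) fun _ h => h
  · apply Halts.of_block_le _ (by simp [readVar, MemOp.time])
    have hv := hin.var t ht j hj
    rw [← hxdef, ← h.nr_pj] at hv
    rw [execs_append]
    obtain ⟨e1, e2, e3, -, -, e4, e5⟩ := execs_readVar (ω := ω) (dst := .x) hc.nr_one (by simp) hv
    generalize execs inp ω (readVar .x .pj) s = s0 at *
    have hnode : s0.nr .node = ν := e5 _ (by simp) (by simp) (by simp)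
    refine ⟨?_, ?_, ?_, ?_, ?_, ?_, ?_⟩
    · simp [MemOp.exec, e1]
    · simp [MemOp.exec, e2]
    · simp [MemOp.exec, e3]
    · intro r hr
      simp at hr
      simp [MemOp.exec, hr, e5]
    all_goals simp [MemOp.exec, e1, e4, hnode, htr.row ν h.node_lt]
  rintro s1 ⟨hna, hra, hrr, hnr, hx1, hidx1, hch1⟩
  have hb1 : Building k n m l a t p cnt path s1 :=
    h.building.congr hna hra (fun r hr => hnr r (by simp at hr ⊢; grind)) (fun r _ => by rw [hrr])
  have hν1 : s1.nr .node = ν := hnr _ (by simp)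
  refine (Halts.seq_of (T := 101) (T' := 40) (P := fun s2 => ∃ cnt' path',
    Building k n m l a t p cnt' path' s2 ∧ (∀ r, r ∉ [NReg.tmp, .idx, .x, .ch, .acc, .cnt] →
      s2.nr r = s.nr r) ∧ s2.nr .ch < cnt' ∧ path' (s2.nr .ch) = (l t).take (j + 1) ∧
      s2.na .root (s2.nr .ch) = s.nr .v ∧ s2.rr .a = s.rr .a ∧ cnt' ≤ cnt + 1) ?_ ?_).mono
      (by norm_num) fun _ h => h
  · apply Halts.ite
    · intro hlt
      apply Halts.of_block_le _ (by simp)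
      rw [execs_nil]
      have hne : s.na .child (ν * (4 * n) + x) ≠ 0 := by
        rw [← hch1]
        have : s1.nr .zero < s1.nr .ch := hlt
        omega
      obtain ⟨c1, c2, c3, c4⟩ := htr.child_ne ν h.node_lt x hxM hne
      refine ⟨cnt, path, hb1, fun r hr => hnr r (by simp at hr ⊢; tauto), ?_, ?_, ?_, by rw [hrr],
        by omega⟩
      · rw [hch1]; exact c2
      · rw [hch1, htr.path_par _ c2 c1, c3, c4, h.path_node, htake]
      · rw [hna, hch1, ← htr.root_par _ c2 c1, c3, h.root_node]
    · intro hlt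
      have h0 : s1.na .child (ν * (4 * n) + x) = 0 := by
        rw [hna, ← hch1]
        have : ¬ s1.nr .zero < s1.nr .ch := hlt
        rw [hb1.consts.nr_zero] at this
        omega
      have hpx : path ν ++ [x] = (l t).take (j + 1) := by rw [h.path_node, htake]
      refine (halts_createProgram (ν := ν) (x := x) hn hb1.trie hb1.consts hb1.nr_cnt hb1.nr_acc
        hν1 hx1 hidx1 ?_ h.node_lt hxM h0 ?_ ?_).mono le_rfl ?_
      · rw [hna, h.root_node]; exact hnr _ (by simp)
      · rw [hpx]; exact (hin.sorted t ht).sublist (List.take_sublist _ _)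
      · rw [hpx, List.length_take]; exact (min_le_right _ _).trans (hin.length_le t ht)
      · rintro s2 ⟨g1, g2, g3, g4, g5, g6, g7, g8, g9⟩
        refine ⟨cnt + 1, _, hb1.create g1 g2 g3 g4 g6 g7, ?_, ?_, ?_, ?_, ?_, le_rfl⟩
        · intro r hr
          rw [g9 r (by simp at hr ⊢; tauto), hnr r (by simp at hr ⊢; tauto)]
        · rw [g5]; omega
        · rw [g5, Function.update_self, hpx]
        · rw [g5, g6, Function.update_self, hna, h.root_node]
        · rw [g8, hrr]
  · rintro s2 ⟨cnt', path', hb, hnr2, hlt, hpath, hroot, ha, hle⟩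
    have hc2 := hb.consts
    apply Halts.of_block_le _ (by simp [MemOp.time])
    refine ⟨cnt', path', ?_⟩
    have hcnt := h.cnt_le
    constructor
    · exact hb.congr (by simp [MemOp.exec]) (by simp [MemOp.exec])
        (by intro r hr; simp at hr; rcases hr with rfl | rfl | rfl | rfl | rfl | rfl | rfl | rfl <;>
              simp [MemOp.exec])
        (by intro r hr; simp at hr; rcases hr with rfl | rfl | rfl | rfl | rfl <;>
              simp [MemOp.exec])
    · apply h.term.congr
      intro r hr
      simp at hr
      rcases hr with rfl | rfl | rfl | rfl | rfl <;> simp [MemOp.exec] <;> exact hnr2 _ (by simp)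
    · simpa [MemOp.exec, hc2.nr_zero] using hlt
    · simpa [MemOp.exec, hc2.nr_zero] using hpath
    · simpa [MemOp.exec, hc2.nr_zero, hnr2 .v (by simp)] using hroot
    · simp [MemOp.exec, hnr2 .v (by simp)]; simpa using h.nr_v
    · simp [MemOp.exec, ha, h.rr_a, hc2.rr_six]; rw [div_div, ← pow_succ]
    · simp [MemOp.exec, hnr2 .j (by simp), h.nr_j, hc2.nr_one]
    · simp [MemOp.exec, hnr2 .pj (by simp), h.nr_pj, hc2.nr_two]; ring
    · omega

theorem sum_filter_of_eq_off {cnt ν v₀ v : ℕ} {root : ℕ → ℕ} {f f' : ℕ → ℝ} (hν : ν < cnt)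
    (hroot : root ν = v₀) (h : ∀ μ, μ ≠ ν → f' μ = f μ) (h0 : f ν = 0) :
    ∑ μ ∈ Finset.range cnt with root μ = v, f' μ =
      ∑ μ ∈ Finset.range cnt with root μ = v, f μ + if v₀ = v then f' ν else 0 := by
  have hf : f' = fun μ => f μ + if μ = ν then f' ν else 0 := by
    ext μ
    by_cases hμ : μ = ν
    · subst hμ; simp [h0]
    · simp [hμ, h μ hμ]
  conv_lhs => rw [hf]
  rw [Finset.sum_add_distrib, Finset.sum_ite_eq']
  simp [hν, hroot]

theorem Descending.finish {inp : Input} {ω : Tape} {k n m : ℕ} {l : ℕ → List ℕ} {a : ℕ → ℝ}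
    {pos : ℕ → ℕ} {B t p cnt : ℕ} {path : ℕ → List ℕ} {s : Memory}
    (hin : ReadsTerms k n m l a pos inp) (ht : t < m) (hp : p < (l t).length)
    (h : Descending k n m l a pos B t p (l t).length cnt path s) :
    Halts inp ω (block [.rload .b .S .node, .radd .c .b .a, .rstore .S .node .c, .rmul .b .b .b,
        .rmul .c .c .c, .rsub .c .c .b, .rload .b .Q .v, .radd .b .b .c, .rstore .Q .v .b,
        .rload .b .W .node, .rmul .c .b .c, .rload .b .T .v, .radd .b .b .c, .rstore .T .v .b,
        .add .p .p .one, .add .pp .pp .two]) 100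
      (fun s' => Building k n m l a t (p + 1) cnt path s' ∧ AtTerm l pos t (p + 1) s' ∧
        cnt ≤ B + (l t).length) s := by
  have hb := h.building
  have hc := hb.consts
  obtain ⟨ν, hνdef⟩ : ∃ ν, s.nr .node = ν := ⟨_, rfl⟩
  obtain ⟨v, hvdef⟩ : ∃ v, s.nr .v = v := ⟨_, rfl⟩
  obtain ⟨b, hbdef⟩ : ∃ b, a t / 6 ^ (l t).length = b := ⟨_, rfl⟩
  have hpath : path ν = l t := by rw [← hνdef, h.path_node, List.take_length]
  have hroot : s.na .root ν = v := by rw [← hνdef, ← hvdef, h.root_node]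
  have hν : ν < cnt := hνdef ▸ h.node_lt
  have hvp : (l t).getD p 0 = v := by rw [← hvdef, h.nr_v]
  have ha : s.rr .a = b := by rw [h.rr_a, hbdef]
  -- The target node is still empty: a nonzero coefficient would come from an earlier insertion with
  -- the same path and root, but the terms are pairwise distinct and the variables within a term are
  -- too. This is why `Q` collects exactly the squares of the single coefficients.
  have hS0 : s.ra .S ν = 0 := by
    by_contra hne
    obtain ⟨t', j, h1, h2, h3, h4, h5⟩ := hb.done ν hν hne
    rw [hpath] at h1
    have htt := hin.inj t ht t' h4 h1
    subst htt
    rcases h5 with h5 | ⟨-, h5⟩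
    · exact lt_irrefl _ h5
    · rw [hroot, ← hvp] at h3
      simp only [List.getD_eq_getElem _ _ hp, List.getD_eq_getElem _ _ h2] at h3
      have hnd : (l t).Nodup := (hin.sorted t ht).imp fun h => ne_of_lt h
      exact h5.ne ((hnd.getElem_inj_iff).1 h3).symm
  apply Halts.of_block_le _ (by simp [MemOp.time])
  -- Because the old coefficient is 0, the differences of squares added to `Q` and `T` are just `b ^
  -- 2` and its weighted version.
  have hS' : (execs inp ω [.rload .b .S .node, .radd .c .b .a, .rstore .S .node .c, .rmul .b .b .b,
        .rmul .c .c .c, .rsub .c .c .b, .rload .b .Q .v, .radd .b .b .c, .rstore .Q .v .b,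
        .rload .b .W .node, .rmul .c .b .c, .rload .b .T .v, .radd .b .b .c, .rstore .T .v .b,
        .add .p .p .one, .add .pp .pp .two] s) =
      { s with
        nr := Function.update (Function.update s.nr .p (p + 1)) .pp (pos t + 1 + 2 * (p + 1))
        rr := Function.update (Function.update s.rr .c (s.ra .W ν * b ^ 2)) .b
          (s.ra .T v + s.ra .W ν * b ^ 2)
        ra := Function.update (Function.update (Function.update s.ra
          .S (Function.update (s.ra .S) ν b)) .Q (Function.update (s.ra .Q) v (s.ra .Q v + b ^ 2)))
          .T (Function.update (s.ra .T) v (s.ra .T v + s.ra .W ν * b ^ 2)) } := by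
    simp only [execs_cons, execs_nil, MemOp.exec]
    congr 1
    · simp [h.term.nr_p, h.term.nr_pp, hc.nr_one, hc.nr_two]
      congr 1
    · funext r
      by_cases h1 : r = .b
      · subst h1; simp [hS0, ha, hνdef, hvdef]; left; ring
      · by_cases h2 : r = .c
        · subst h2; simp [hS0, ha, hνdef]; left; ring
        · simp [h1, h2]
    · simp [hS0, ha, hνdef, hvdef, sq]
  rw [hS']
  refine ⟨?_, ?_, h.cnt_le⟩
  · refine ⟨?_, ?_, ?_, ?_, ?_, ?_, ?_, ?_, ?_⟩
    · refine IsTrie.congr hb.trie ?_ ?_ ?_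
      · rfl
      · simp
      intro μ hμ
      have : μ ≠ ν := by omega
      simp [this, hb.trie.S_zero μ hμ]
    · apply hc.frame
      · intro r hr; simp at hr; rcases hr with rfl | rfl | rfl | rfl | rfl | rfl <;> simp
      · intro r hr; simp at hr; rcases hr with rfl | rfl | rfl | rfl | rfl <;> simp
    · simp [hb.nr_cnt]
    · simp [hb.nr_acc]
    · intro y v'
      rw [doneSum_succ, ← hb.poly y v', hvp]
      rw [sum_filter_of_eq_off (f := fun μ => s.ra .S μ * ((path μ).map y).prod) hν hroot]
      · simp [hpath, hbdef]
      · intro μ hμ; simp [hμ]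
      · simp [hS0]
    · intro v'
      rw [doneSum_succ, ← hb.sq v', hvp, hbdef]
      by_cases hv : v' = v
      · subst hv; simp
      · simp [hv, Ne.symm hv]
    · intro v'
      rw [sum_filter_of_eq_off (f := fun μ => s.ra .S μ ^ 2) hν hroot, ← hb.sq_eq v']
      · by_cases hv : v' = v
        · subst hv; simp
        · simp [hv, Ne.symm hv]
      · intro μ hμ; simp [hμ]
      · simp [hS0]
    · intro v'
      rw [sum_filter_of_eq_off (f := fun μ => s.ra .W μ * s.ra .S μ ^ 2) hν hroot,
        ← hb.weighted v']
      · by_cases hv : v' = v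
        · subst hv; simp
        · simp [hv, Ne.symm hv]
      · intro μ hμ; simp [hμ]
      · simp [hS0]
    · intro μ hμ hne
      by_cases hμν : μ = ν
      · subst hμν
        exact ⟨t, p, hpath, hp, hroot.trans hvp.symm, ht, Or.inr ⟨rfl, Nat.lt_succ_self p⟩⟩
      · simp [hμν] at hne
        obtain ⟨t', j, h1, h2, h3, h4, h5⟩ := hb.done μ hμ hne
        exact ⟨t', j, h1, h2, h3, h4, by omega⟩
  · constructor
    · simp [h.term.nr_t]
    · simp [h.term.nr_w]
    · simp
    · simp [h.term.nr_pos]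
    · simp

/-- The memory between two insertions. -/
def BetweenInsertions (k n m : ℕ) (l : ℕ → List ℕ) (a : ℕ → ℝ) (pos : ℕ → ℕ) (t p : ℕ)
    (s : Memory) : Prop :=
  ∃ cnt path, Building k n m l a t p cnt path s ∧ AtTerm l pos t p s ∧
    cnt ≤ 4 * n + k * k * t + k * p

/-- A term is inserted once into the tree of each of its variables: at most `k` insertions with at
most `k` new nodes each, which gives `k * k` nodes per term in `BetweenInsertions`. -/
theorem halts_insertProgram {inp : Input} {ω : Tape} {k n m : ℕ} {l : ℕ → List ℕ} {a : ℕ → ℝ}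
    {pos : ℕ → ℕ} {t p : ℕ} {s : Memory} (hn : 1 ≤ n)
    (hin : ReadsTerms k n m l a pos inp) (ht : t < m) (hp : p < (l t).length)
    (h : BetweenInsertions k n m l a pos t p s) :
    Halts inp ω insertProgram (201 * k + 200) (BetweenInsertions k n m l a pos t (p + 1)) s := by
  obtain ⟨cnt, path, hb, hat, hcnt⟩ := h
  have hc := hb.consts
  have hlen := hin.length_le t ht
  set v := (l t).getD p 0 with hvdef
  have hv : (l t)[p] = v := by simp [hvdef, hp]
  have hvM : v < 4 * n := hin.lt t ht v (by rw [← hv]; exact List.getElem_mem hp)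
  have hvc : v < cnt := hvM.trans_le hb.trie.le_cnt
  refine (Halts.seq_of (T := 50) (T' := 201 * k + 150)
    (P := Descending k n m l a pos (4 * n + k * k * t + k * p) t p 0 cnt path) ?_ ?_).mono
    (by omega) fun _ h => h
  · apply Halts.of_block_le _ (by simp [readVar, MemOp.time])
    have hr := hin.var t ht p hp
    rw [← hat.nr_pp, ← hvdef] at hr
    obtain ⟨e1, e2, e3, -, -, e4, e5⟩ := execs_readVar (ω := ω) (dst := .v) hc.nr_one (by simp) hr
    rw [execs_append]
    generalize execs inp ω (readVar .v .pp) s = s0 at *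
    have hb0 : Building k n m l a t p cnt path s0 := hb.congr e1 e2
      (by intro r hr; apply e5 <;> rintro rfl <;> simp at hr) (fun r _ => by rw [e3])
    have hc0 := hb0.consts
    have hat0 : AtTerm l pos t p s0 := hat.congr
      (by intro r hr; apply e5 <;> rintro rfl <;> simp at hr)
    constructor
    · exact hb0.congr (by simp [MemOp.exec]) (by simp [MemOp.exec])
        (by intro r hr; simp at hr; rcases hr with rfl | rfl | rfl | rfl | rfl | rfl | rfl | rfl <;>
              simp [MemOp.exec])
        (by intro r hr; simp at hr; rcases hr with rfl | rfl | rfl | rfl | rfl <;>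
              simp [MemOp.exec])
    · apply hat0.congr
      intro r hr
      simp at hr
      rcases hr with rfl | rfl | rfl | rfl | rfl <;> simp [MemOp.exec]
    · simpa [MemOp.exec, e4, hc0.nr_zero] using hvc
    · simp [MemOp.exec, e4, hc0.nr_zero, hb.trie.path_root v hvM]
    · simp [MemOp.exec, e4, hc0.nr_zero, e1, hb.trie.root_root v hvM]
    · simpa [MemOp.exec, e4] using hvdef
    · have := hin.coeff t ht
      simpa [MemOp.exec, hat0.nr_t] using this
    · simp [MemOp.exec]
    · simp [MemOp.exec, hat0.nr_pos, hc0.nr_one]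
    · omega
  · intro s1 h1
    refine (Halts.seq_of (T := 201 * k + 1) (T' := 100)
      (P := fun s => ∃ cnt path, Descending k n m l a pos (4 * n + k * k * t + k * p) t p
        (l t).length cnt path s) ?_ ?_).mono (by omega) fun _ h => h
    · refine (Halts.while (fun j s => ∃ cnt path, Descending k n m l a pos
        (4 * n + k * k * t + k * p) t p j cnt path s) (l t).length (fun _ => 200) ?_ ?_
        ⟨cnt, path, h1⟩).mono ?_ fun _ h => h
      · rintro j hj s ⟨cnt, path, hd⟩
        refine ⟨?_, hd.step hn hin ht hj⟩
        change s.nr .j < s.nr .w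
        rw [hd.nr_j, hd.term.nr_w]; exact hj
      · rintro s ⟨cnt, path, hd⟩
        change ¬ s.nr .j < s.nr .w
        rw [hd.nr_j, hd.term.nr_w]; exact lt_irrefl _
      · simp
        nlinarith
    · rintro s2 ⟨cnt, path, hd⟩
      refine (hd.finish hin ht hp).mono le_rfl ?_
      rintro s3 ⟨g1, g2, g3⟩
      exact ⟨cnt, path, g1, g2, by rw [mul_add, mul_one]; omega⟩

theorem halts_buildProgram {inp : Input} {ω : Tape} {k n m : ℕ} {l : ℕ → List ℕ} {a : ℕ → ℝ}
    {pos : ℕ → ℕ} {s : Memory} {path : ℕ → List ℕ} (hn : 1 ≤ n)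
    (hin : ReadsTerms k n m l a pos inp) (htrie : IsTrie (4 * n) k s (4 * n) path)
    (hc : HoldsConstants n m s) (hacc : s.nr .acc = 4 * n * (4 * n))
    (hS : s.ra .S = fun _ => 0) (hQ : s.ra .Q = fun _ => 0) (hT : s.ra .T = fun _ => 0) :
    Halts inp ω buildProgram (m * (k * (201 * k + 201) + 101) + 101)
      (fun s' => ∃ cnt path, Building k n m l a m 0 cnt path s' ∧
        cnt ≤ 4 * n + k * k * m) s := by
  refine (Halts.seq_of (T := 100) (T' := m * (k * (201 * k + 201) + 101) + 1)
    (P := fun s => Building k n m l a 0 0 (4 * n) path s ∧ s.nr .t = 0 ∧ s.nr .pos = 2)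
    ?_ ?_).mono (by omega) fun _ h => h
  · apply Halts.of_block_le _ (by simp [MemOp.time])
    refine ⟨⟨htrie.congr (by simp [MemOp.exec]) (by simp [MemOp.exec]) (by simp [MemOp.exec, hS]),
      ?_, ?_, ?_, ?_, ?_, ?_, ?_, ?_⟩, ?_, ?_⟩
    · apply hc.frame
      · intro r hr; simp at hr; rcases hr with rfl | rfl | rfl | rfl | rfl | rfl <;>
          simp [MemOp.exec]
      · intro r hr; simp [MemOp.exec]
    · simp [MemOp.exec, hc.nr_size, hc.nr_zero]
    · simp [MemOp.exec, hacc]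
    · intro y v; simp [MemOp.exec, hS, doneSum_zero]
    · intro v; simp [MemOp.exec, hQ, doneSum_zero]
    · intro v; simp [MemOp.exec, hS, hQ]
    · intro v; simp [MemOp.exec, hS, hT]
    · intro ν _ h; simp [MemOp.exec, hS] at h
    · simp [MemOp.exec]
    · simp [MemOp.exec]
  · rintro s1 ⟨hb1, ht1, hp1⟩
    refine (Halts.while (fun t s => ∃ cnt path, Building k n m l a t 0 cnt path s ∧
      s.nr .t = t ∧ s.nr .pos = pos t ∧ cnt ≤ 4 * n + k * k * t) m
      (fun _ => k * (201 * k + 201) + 100) ?_ ?_ ?_).mono ?_ ?_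
    · rintro t ht s ⟨cnt, path, hb, hst, hsp, hcnt⟩
      refine ⟨?_, ?_⟩
      · change s.nr .t < s.nr .m
        rw [hst, hb.consts.nr_m]; exact ht
      have hlen := hin.length_le t ht
      refine (Halts.seq_of (T := 20) (T' := k * (201 * k + 201) + 80)
        (P := BetweenInsertions k n m l a pos t 0) ?_ ?_).mono (by omega) fun _ h => h
      · apply Halts.of_block_le _ (by simp [MemOp.time])
        refine ⟨cnt, path, hb.congr (by simp [MemOp.exec]) (by simp [MemOp.exec])
          (by intro r hr; simp at hr; rcases hr with rfl | rfl | rfl | rfl | rfl | rfl | rfl | rfl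
                <;> simp [MemOp.exec])
          (by intro r hr; simp [MemOp.exec]), ?_, by omega⟩
        have := hin.weight t ht
        constructor
        · simp [MemOp.exec, hst]
        · simpa [MemOp.exec, hsp] using this
        · simp [MemOp.exec]
        · simp [MemOp.exec, hsp]
        · simp [MemOp.exec, hsp, hb.consts.nr_one]
      · intro s2 h2
        refine (Halts.seq_of (T := k * (201 * k + 201) + 1) (T' := 79)
          (P := BetweenInsertions k n m l a pos t (l t).length) ?_ ?_).mono (by omega) fun _ h => h
        · refine (Halts.while (BetweenInsertions k n m l a pos t) (l t).length
            (fun _ => 201 * k + 200) ?_ ?_ h2).mono ?_ fun _ h => h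
          · rintro p hp s h
            refine ⟨?_, halts_insertProgram hn hin ht hp h⟩
            obtain ⟨_, _, _, hat, _⟩ := h
            change s.nr .p < s.nr .w
            rw [hat.nr_p, hat.nr_w]; exact hp
          · rintro s ⟨_, _, _, hat, _⟩
            change ¬ s.nr .p < s.nr .w
            rw [hat.nr_p, hat.nr_w]; exact lt_irrefl _
          · simp only [Finset.sum_const, Finset.card_range, smul_eq_mul]
            exact Nat.add_le_add_right (Nat.mul_le_mul_right (201 * k + 201) hlen) 1
        · rintro s3 ⟨cnt', path', hb3, hat, hcnt3⟩
          apply Halts.of_block_le _ (by simp [nextTerm, MemOp.time])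
          have hb4 : Building k n m l a (t + 1) 0 cnt' path' s3 := by
            obtain ⟨g1, g2, g3, g4, g5, g6, g7, g8, g9⟩ := hb3
            refine ⟨g1, g2, g3, g4, ?_, ?_, g7, g8, ?_⟩
            · intro y v; rw [g5 y v, doneSum_length]
            · intro v; rw [g6 v, doneSum_length]
            · intro ν hν hne
              obtain ⟨t', j, h1, h2, h3, h4, h5⟩ := g9 ν hν hne
              exact ⟨t', j, h1, h2, h3, h4, by omega⟩
          refine ⟨cnt', path', hb4.congr (by simp [nextTerm, MemOp.exec])
            (by simp [nextTerm, MemOp.exec])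
            (by intro r hr; simp at hr; rcases hr with rfl | rfl | rfl | rfl | rfl | rfl | rfl | rfl
                  <;> simp [nextTerm, MemOp.exec])
            (by intro r hr; simp [nextTerm, MemOp.exec]), ?_, ?_, ?_⟩
          · simp [nextTerm, MemOp.exec, hat.nr_t, hb3.consts.nr_one]
          · simp [nextTerm, MemOp.exec, hat.nr_pos, hat.nr_w, hb3.consts.nr_one, hin.pos_succ t ht]
          · have := Nat.mul_le_mul_left k hlen
            rw [mul_add, mul_one]; omega
    · rintro s ⟨cnt, path, hb, hst, hsp, hcnt⟩
      change ¬ s.nr .t < s.nr .m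
      rw [hst, hb.consts.nr_m]; exact lt_irrefl _
    · exact ⟨4 * n, path, hb1, ht1, by rw [hp1, hin.pos_zero], by omega⟩
    · simp only [Finset.sum_const, Finset.card_range, smul_eq_mul]
      apply le_of_eq; ring
    · rintro s ⟨cnt, path, hb, -, -, hcnt⟩
      exact ⟨cnt, path, hb, hcnt⟩

/-! ### Initialization: constants and roots of the trie -/

/-- The initial memory. -/
def Memory.init : Memory := ⟨fun _ => 0, fun _ _ => 0, fun _ => 0, fun _ _ => 0, fun _ => 0, 0⟩

theorem represents_init : Represents Memory.init Config.init := by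
  constructor <;> intros <;> rfl

/-- The memory during the creation of the roots. -/
structure CreatingRoots (k n m v : ℕ) (s : Memory) : Prop where
  consts : HoldsConstants n m s
  nr_v : s.nr .v = v
  nr_acc : s.nr .acc = v * (4 * n)
  rr_lam : s.rr .lam = 1 / 5 ^ k
  weight : ∀ μ < v, s.ra .W μ = 1 / 5 ^ k
  row : ∀ μ < v, s.na .row μ = μ * (4 * n)
  root : ∀ μ < v, s.na .root μ = μ
  child : s.na .child = fun _ => 0
  head : s.na .head = fun _ => 0
  S : s.ra .S = fun _ => 0
  Q : s.ra .Q = fun _ => 0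
  T : s.ra .T = fun _ => 0

theorem CreatingRoots.isTrie {k n m : ℕ} {s : Memory} (h : CreatingRoots k n m (4 * n) s) :
    IsTrie (4 * n) k s (4 * n) fun _ => [] := by
  constructor
  · exact le_rfl
  · exact h.row
  · exact h.root
  · intro ν hν; rw [h.root ν hν]; exact hν
  · intros; rfl
  · intro ν hν; simp [h.weight ν hν]
  · intro ν h1 h2; omega
  · intro ν h1 h2; omega
  · intro ν h1 h2; omega
  · intro ν h1 h2; omega
  · intro ν h1 h2; omega
  · intro ν _ x _ h1; simp [h.child] at h1
  · intro i _; simp [h.child]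
  · simp
  · simp
  · intro x _
    have : nodesAt (4 * n) (s.na .var) (4 * n) x = [] := by
      rw [List.eq_nil_iff_forall_not_mem]
      intro ν hν
      rw [mem_nodesAt] at hν
      omega
    rw [this, h.head]
    rfl
  · intro ν _; simp [h.S]

theorem halts_setupProgram {inp : Input} {ω : Tape} {k n m : ℕ} (h0 : inp.nats.getD 0 0 = n)
    (h1 : inp.nats.getD 1 0 = m) :
    Halts inp ω (setupProgram k) 20 (CreatingRoots k n m 0) Memory.init := by
  apply Halts.of_block_le _ (by simp [MemOp.time])
  simp only [List.getD_eq_getElem?_getD] at h0 h1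
  refine ⟨?_, ?_, ?_, ?_, ?_, ?_, ?_, ?_, ?_, ?_, ?_, ?_⟩
  · constructor <;> simp [MemOp.exec, h0, h1]
    omega
  all_goals simp [MemOp.exec, Memory.init]

theorem halts_rootsProgram {inp : Input} {ω : Tape} {k n m : ℕ} {s : Memory}
    (h : CreatingRoots k n m 0 s) :
    Halts inp ω rootsProgram (200 * n + 1) (CreatingRoots k n m (4 * n)) s := by
  refine (Halts.while (CreatingRoots k n m) (4 * n) (fun _ => 49) ?_ ?_ h).mono
    (by simp; omega) fun _ h => h
  · intro v hv s h
    refine ⟨?_, ?_⟩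
    · change s.nr .v < s.nr .size
      rw [h.nr_v, h.consts.nr_size]; exact hv
    apply Halts.of_block_le _ (by simp [MemOp.time])
    refine ⟨?_, ?_, ?_, ?_, ?_, ?_, ?_, ?_, ?_, ?_, ?_, ?_⟩
    · apply h.consts.frame
      · intro r hr; simp at hr; rcases hr with rfl | rfl | rfl | rfl | rfl | rfl <;>
          simp [MemOp.exec]
      · intro r hr; simp [MemOp.exec]
    · simp [MemOp.exec, h.nr_v, h.consts.nr_one]
    · simp [MemOp.exec, h.nr_acc, h.consts.nr_size]; ring
    · simp [MemOp.exec, h.rr_lam]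
    · intro μ hμ
      rcases Nat.lt_succ_iff_lt_or_eq.1 hμ with h1 | rfl
      · simp [MemOp.exec, h.nr_v, h1.ne, h.weight μ h1]
      · simp [MemOp.exec, h.nr_v, h.rr_lam]
    · intro μ hμ
      rcases Nat.lt_succ_iff_lt_or_eq.1 hμ with h1 | rfl
      · simp [MemOp.exec, h.nr_v, h1.ne, h.row μ h1]
      · simp [MemOp.exec, h.nr_v, h.nr_acc]
    · intro μ hμ
      rcases Nat.lt_succ_iff_lt_or_eq.1 hμ with h1 | rfl
      · simp [MemOp.exec, h.nr_v, h1.ne, h.root μ h1]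
      · simp [MemOp.exec, h.nr_v]
    · simp [MemOp.exec, h.child]
    · simp [MemOp.exec, h.head]
    · simp [MemOp.exec, h.S]
    · simp [MemOp.exec, h.Q]
    · simp [MemOp.exec, h.T]
  · intro s h
    change ¬ s.nr .v < s.nr .size
    rw [h.nr_v, h.consts.nr_size]; exact lt_irrefl _

/-! ### Choosing the signs -/

/-- The nodes that are left when the nodes with a variable at least `u` have been merged into
their parents. -/
def liveNodes (M : ℕ) (var : ℕ → ℕ) (cnt u : ℕ) : Finset ℕ :=
  {ν ∈ Finset.range cnt | ν < M ∨ var ν < u}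

theorem mem_liveNodes {M cnt u ν : ℕ} {var : ℕ → ℕ} :
    ν ∈ liveNodes M var cnt u ↔ ν < cnt ∧ (ν < M ∨ var ν < u) := by
  simp [liveNodes]

theorem liveNodes_sdiff {M cnt u : ℕ} {var : ℕ → ℕ} :
    liveNodes M var cnt (u + 1) \ (nodesAt M var cnt u).toFinset = liveNodes M var cnt u := by
  ext ν
  simp only [Finset.mem_sdiff, mem_liveNodes, List.mem_toFinset, mem_nodesAt]
  omega

/-- A node is in the list of its own label only, so all loops over these lists together take time
linear in the number of nodes. -/
theorem sum_length_nodesAt_le (M : ℕ) (var : ℕ → ℕ) (cnt : ℕ) :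
    ∑ x ∈ Finset.range M, (nodesAt M var cnt x).length ≤ cnt := by
  have h : ∀ x, (nodesAt M var cnt x).length =
      ({ν ∈ {ν ∈ Finset.range cnt | M ≤ ν ∧ var ν < M} | var ν = x} : Finset ℕ).card +
      ({ν ∈ {ν ∈ Finset.range cnt | M ≤ ν ∧ ¬ var ν < M} | var ν = x} : Finset ℕ).card := by
    intro x
    rw [← List.toFinset_card_of_nodup nodup_nodesAt, ← Finset.card_union_of_disjoint]
    · congr 1
      ext ν
      simp only [List.mem_toFinset, mem_nodesAt, Finset.mem_union, Finset.mem_filter,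
        Finset.mem_range]
      tauto
    · rw [Finset.disjoint_left]
      intro ν h1 h2
      simp only [Finset.mem_filter] at h1 h2
      exact h2.1.2.2 h1.1.2.2
  have h0 : ∀ x ∈ Finset.range M,
      ({ν ∈ {ν ∈ Finset.range cnt | M ≤ ν ∧ ¬ var ν < M} | var ν = x} : Finset ℕ).card = 0 := by
    intro x hx
    rw [Finset.card_eq_zero, Finset.filter_eq_empty_iff]
    intro ν hν hνx
    simp only [Finset.mem_filter, Finset.mem_range] at hν hx
    omega
  rw [Finset.sum_congr rfl fun x hx => by rw [h x, h0 x hx, add_zero]]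
  rw [← Finset.card_eq_sum_card_fiberwise]
  · exact (Finset.card_filter_le _ _).trans (by simp)
  · intro ν hν
    simp only [Finset.coe_filter, Set.mem_ofPred_eq, Finset.mem_range] at hν
    simpa using hν.2.2

/-- Labels strictly increase along a path, so the parent of a node labelled `u` is a root or has a
smaller label. Hence it survives the merging of `u`, and nodes labelled `u` are leaves when their
turn comes. -/
theorem IsTrie.par_mem {M k cnt u ν : ℕ} {s : Memory} {path : ℕ → List ℕ}
    (h : IsTrie M k s cnt path) (hν : ν ∈ nodesAt M (s.na .var) cnt u) :
    s.na .par ν ∈ liveNodes M (s.na .var) cnt u := by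
  obtain ⟨h1, h2, h3⟩ := mem_nodesAt.1 hν
  have hp := h.par_lt ν h1 h2
  rw [mem_liveNodes]
  refine ⟨hp.trans h1, ?_⟩
  by_contra! hn
  have hs := h.sorted ν h1
  rw [h.path_par ν h1 h2, h.path_par _ (hp.trans h1) hn.1, List.pairwise_append] at hs
  have := hs.2.2 (s.na .var (s.na .par ν)) (by simp) (s.na .var ν) (by simp)
  omega

/-- A node is recovered from its parent and its label through the table of children. -/
theorem IsTrie.par_injOn {M k cnt u : ℕ} {s : Memory} {path : ℕ → List ℕ}
    (h : IsTrie M k s cnt path) :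
    Set.InjOn (s.na .par) (nodesAt M (s.na .var) cnt u).toFinset := by
  intro ν hν μ hμ hp
  simp only [List.coe_toFinset, Set.mem_ofPred_eq] at hν hμ
  obtain ⟨h1, h2, h3⟩ := mem_nodesAt.1 hν
  obtain ⟨g1, g2, g3⟩ := mem_nodesAt.1 hμ
  rw [← h.child_par ν h1 h2, ← h.child_par μ g1 g2, hp, h3, g3]

/-- The memory when the signs of the variables from `u` on have been chosen; `s₀` is the memory
after the construction of the trie. -/
structure Signing (n m cnt : ℕ) (path : ℕ → List ℕ) (s₀ : Memory) (u : ℕ) (s : Memory) : Prop where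
  consts : HoldsConstants n m s
  na : s.na = s₀.na
  W : s.ra .W = s₀.ra .W
  Q : s.ra .Q = s₀.ra .Q
  weighted : ∀ v, s.ra .T v = ∑ ν ∈ liveNodes (4 * n) (s₀.na .var) cnt u with s₀.na .root ν = v,
    s₀.ra .W ν * s.ra .S ν ^ 2
  sign : ∀ x, u ≤ x → x < 4 * n → s.ra .Y x = 1 ∨ s.ra .Y x = -1
  potential_le : ∑ v ∈ Finset.range (4 * n), Real.sqrt (s₀.ra .Q v) / 2 ≤
    ∑ v ∈ Finset.range (4 * n), potential (s₀.ra .Q v)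
      (∑ ν ∈ liveNodes (4 * n) (s₀.na .var) cnt u with s₀.na .root ν = v, s.ra .S ν ^ 2)
      (∑ ν ∈ liveNodes (4 * n) (s₀.na .var) cnt u with s₀.na .root ν = v,
        s₀.ra .W ν * s.ra .S ν ^ 2)
  poly : ∀ v (y : ℕ → ℝ), (∀ x, u ≤ x → x < 4 * n → y x = s.ra .Y x) →
    ∑ ν ∈ liveNodes (4 * n) (s₀.na .var) cnt u with s₀.na .root ν = v,
        s.ra .S ν * ((path ν).map y).prod =
      ∑ ν ∈ Finset.range cnt with s₀.na .root ν = v, s₀.ra .S ν * ((path ν).map y).prod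

/-- Before any sign is chosen all nodes are live, and each tree contributes at least `√Q / 2` to the
total potential. -/
theorem Building.signing {k n m cnt : ℕ} {l : ℕ → List ℕ} {a : ℕ → ℝ} {path : ℕ → List ℕ}
    {s : Memory} (h : Building k n m l a m 0 cnt path s) : Signing n m cnt path s (4 * n) s := by
  have hlive : liveNodes (4 * n) (s.na .var) cnt (4 * n) = Finset.range cnt := by
    ext ν
    rw [mem_liveNodes, Finset.mem_range]
    refine ⟨fun h => h.1, fun hν => ⟨hν, ?_⟩⟩
    by_cases h1 : 4 * n ≤ ν
    · exact Or.inr (h.trie.var_lt ν hν h1)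
    · exact Or.inl (by omega)
  have hQ : ∀ v, ∑ ν ∈ Finset.range cnt with s.na .root ν = v, s.ra .S ν ^ 2 = s.ra .Q v :=
    fun v => (h.sq_eq v).symm
  refine ⟨h.consts, rfl, rfl, rfl, ?_, ?_, ?_, ?_⟩
  · rw [hlive]; exact h.weighted
  · intro x h1 h2; omega
  · rw [hlive]
    apply Finset.sum_le_sum
    intro v _
    -- The normalization `1 / 5 ^ k` of the root weights serves this purpose: depths are at most
    -- `k`, so weights are at most 1 and `T ≤ Q`.
    have hW : ∀ ν ∈ Finset.range cnt, 0 ≤ s.ra .W ν ∧ s.ra .W ν ≤ 1 := by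
      intro ν hν
      rw [Finset.mem_range] at hν
      rw [h.trie.weight ν hν]
      refine ⟨by positivity, ?_⟩
      rw [one_div, inv_mul_le_iff₀ (by positivity), mul_one]
      exact pow_le_pow_right₀ (by norm_num) (h.trie.length_le ν hν)
    rw [hQ]
    apply half_sqrt_le_potential
    · apply Finset.sum_nonneg
      intro ν hν
      exact mul_nonneg (hW ν (Finset.mem_filter.1 hν).1).1 (sq_nonneg _)
    · rw [h.sq_eq v]
      apply Finset.sum_le_sum
      intro ν hν
      exact mul_le_of_le_one_left (sq_nonneg _) (hW ν (Finset.mem_filter.1 hν).1).2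
  · rw [hlive]; intros; trivial

/-- The contribution of the node `ν` to the derivative of the potential. -/
noncomputable def nodeSlope (s : Memory) (ν : ℕ) : ℝ :=
  s.ra .S (s.na .par ν) * s.ra .S ν * (1 - s.ra .W (s.na .par ν) * s.ra .T (s.na .root ν) /
    s.ra .Q (s.na .root ν)) / Real.sqrt (s.ra .Q (s.na .root ν))

/-- The change of the weighted sum of squares when the node `ν` is merged into its parent. -/
noncomputable def mergeChange (s : Memory) (y : ℝ) (ν : ℕ) : ℝ :=
  s.ra .W (s.na .par ν) * ((s.ra .S (s.na .par ν) + y * s.ra .S ν) ^ 2 -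
    s.ra .S (s.na .par ν) ^ 2 - 5 * s.ra .S ν ^ 2)

/-- The mathematical content of one round, separated from the program: the updates of `S` and `T`
are the merging of the leaves labelled `u`, and the hypothesis on the slopes is what
`sum_potential_contract` requires. -/
theorem Signing.step {k n m cnt u : ℕ} {path : ℕ → List ℕ} {s₀ s s' : Memory} {y : ℝ}
    (htr : IsTrie (4 * n) k s₀ cnt path) (hQ : ∀ v, 0 ≤ s₀.ra .Q v)
    (h : Signing n m cnt path s₀ (u + 1) s)
    (hu : u < 4 * n) (hy : y = 1 ∨ y = -1)
    (hd : 0 ≤ y * ((nodesAt (4 * n) (s₀.na .var) cnt u).map (nodeSlope s)).sum)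
    (hc : HoldsConstants n m s') (hna : s'.na = s.na) (hW : s'.ra .W = s.ra .W)
    (hQ' : s'.ra .Q = s.ra .Q) (hY : s'.ra .Y = Function.update (s.ra .Y) u y)
    (hS : ∀ μ, s'.ra .S μ = s.ra .S μ + ((nodesAt (4 * n) (s₀.na .var) cnt u).map fun ν =>
      if s₀.na .par ν = μ then y * s.ra .S ν else 0).sum)
    (hT : ∀ v, s'.ra .T v = s.ra .T v + ((nodesAt (4 * n) (s₀.na .var) cnt u).map fun ν =>
      if s₀.na .root ν = v then mergeChange s y ν else 0).sum) :
    Signing n m cnt path s₀ u s' := by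
  have hy2 : y ^ 2 = 1 := by rcases hy with rfl | rfl <;> norm_num
  set L := (nodesAt (4 * n) (s₀.na .var) cnt u).toFinset with hLdef
  set A := liveNodes (4 * n) (s₀.na .var) cnt (u + 1) with hAdef
  have hAL : A \ L = liveNodes (4 * n) (s₀.na .var) cnt u := liveNodes_sdiff
  have hmemL : ∀ ν, ν ∈ L ↔ ν < cnt ∧ 4 * n ≤ ν ∧ s₀.na .var ν = u := by
    intro ν; rw [hLdef, List.mem_toFinset, mem_nodesAt]
  have hLsub : L ⊆ A := by
    intro ν hν
    rw [hmemL] at hν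
    rw [hAdef, mem_liveNodes]; omega
  have hpar : ∀ ν ∈ L, s₀.na .par ν ∈ A \ L := by
    intro ν hν
    rw [hAL]
    exact htr.par_mem (List.mem_toFinset.1 hν)
  have hinj : Set.InjOn (s₀.na .par) L := htr.par_injOn
  have hroot : ∀ ν ∈ L, s₀.na .root (s₀.na .par ν) = s₀.na .root ν := by
    intro ν hν
    rw [hmemL] at hν
    exact htr.root_par ν hν.1 hν.2.1
  have hpath : ∀ ν ∈ L, path ν = path (s₀.na .par ν) ++ [u] := by
    intro ν hν
    rw [hmemL] at hν
    rw [htr.path_par ν hν.1 hν.2.1, hν.2.2]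
  have hWp : ∀ ν ∈ L, s₀.ra .W ν = 5 * s₀.ra .W (s₀.na .par ν) := by
    intro ν hν
    have h1 := (hmemL ν).1 hν
    rw [htr.weight ν h1.1, htr.weight _ ((htr.par_lt ν h1.1 h1.2.1).trans h1.1), hpath ν hν,
      List.length_append, List.length_singleton, pow_succ]
    ring
  have hsum : ∀ f : ℕ → ℝ, ((nodesAt (4 * n) (s₀.na .var) cnt u).map f).sum = ∑ ν ∈ L, f ν :=
    fun f => (List.sum_toFinset f nodup_nodesAt).symm
  have hS1 : ∀ ν ∈ L, s'.ra .S (s₀.na .par ν) = s.ra .S (s₀.na .par ν) + y * s.ra .S ν := by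
    intro ν hν
    rw [hS, hsum, Finset.sum_eq_single ν]
    · simp
    · intro μ hμ hne
      rw [if_neg fun h => hne (hinj hμ hν h)]
    · exact fun h => absurd hν h
  have hS2 : ∀ μ, (∀ ν ∈ L, s₀.na .par ν ≠ μ) → s'.ra .S μ = s.ra .S μ := by
    intro μ hμ
    rw [hS, hsum, Finset.sum_eq_zero, add_zero]
    intro ν hν
    rw [if_neg (hμ ν hν)]
  have hT' : ∀ v, s'.ra .T v = ∑ ν ∈ A \ L with s₀.na .root ν = v,
      s₀.ra .W ν * s'.ra .S ν ^ 2 := by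
    intro v
    rw [hT, hsum, h.weighted v, Finset.sum_filter, Finset.sum_filter]
    rw [sum_sdiff_contract hLsub hpar hinj
      (F := fun ν => if s₀.na .root ν = v then s₀.ra .W ν * s.ra .S ν ^ 2 else 0)
      (F' := fun ν => if s₀.na .root ν = v then s₀.ra .W ν * s'.ra .S ν ^ 2 else 0)]
    · congr 1
      apply Finset.sum_congr rfl
      intro ν hν
      simp only [hroot ν hν]
      split_ifs
      · rw [hS1 ν hν, hWp ν hν, mergeChange, h.W, h.na]; ring
      · simp
    · intro μ _ hμ
      simp only [hS2 μ hμ]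
  refine ⟨hc, hna.trans h.na, hW.trans h.W, hQ'.trans h.Q, ?_, ?_, ?_, ?_⟩
  · rw [← hAL]; exact hT'
  · intro x hx hxn
    rw [hY]
    by_cases hxu : x = u
    · subst hxu; simpa using hy
    · simp only [Function.update_of_ne hxu]
      exact h.sign x (by omega) hxn
  · refine h.potential_le.trans ?_
    rw [← hAL]
    apply sum_potential_contract hLsub hpar hinj hroot hWp ?_ hS1 hS2 ?_ hQ hy2 ?_
    · intro ν hν
      rw [htr.weight ν (mem_liveNodes.1 hν).1]; positivity
    · intro ν hν
      exact Finset.mem_range.2 (htr.root_lt ν ((hmemL ν).1 hν).1)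
    · rw [hsum] at hd
      refine hd.trans_eq ?_
      congr 1
      apply Finset.sum_congr rfl
      intro ν hν
      rw [nodeSlope, h.W, h.na, h.Q, h.weighted]
  · intro v z hz
    rw [← hAL, ← h.poly v z, Finset.sum_filter, Finset.sum_filter]
    · rw [sum_sdiff_contract hLsub hpar hinj
        (F := fun ν => if s₀.na .root ν = v then s.ra .S ν * ((path ν).map z).prod else 0)
        (F' := fun ν => if s₀.na .root ν = v then s'.ra .S ν * ((path ν).map z).prod else 0)]
      · refine add_eq_left.2 (Finset.sum_eq_zero fun ν hν => ?_)
        -- The monomial of a merged node is that of its parent times `z u = y`, so the coefficient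
        -- gained by the parent compensates for the node removed.
        have hzu : z u = y := by rw [hz u le_rfl hu, hY, Function.update_self]
        simp only [hroot ν hν]
        split_ifs
        · rw [hS1 ν hν, hpath ν hν]
          simp [hzu]; ring
        · simp
      · intro μ _ hμ
        simp only [hS2 μ hμ]
    · intro x hx hxn
      rw [hz x (by omega) hxn, hY, Function.update_of_ne (by omega)]

/-- Each tree has shrunk to its root, whose coefficient is the value of the polynomial at the chosen
signs and whose potential is bounded by `potential_le_abs`. -/
theorem Signing.finish {k n m cnt : ℕ} {l : ℕ → List ℕ} {a : ℕ → ℝ} {path : ℕ → List ℕ}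
    {s₀ s : Memory} (hb : Building k n m l a m 0 cnt path s₀) (h : Signing n m cnt path s₀ 0 s) :
    (∀ v < 4 * n, s.ra .S v =
      doneSum l (fun t => a t / 6 ^ (l t).length * ((l t).map (s.ra .Y)).prod) v m 0) ∧
    1 / 5 ^ k / 2 * ∑ v ∈ Finset.range (4 * n),
        Real.sqrt (doneSum l (fun t => (a t / 6 ^ (l t).length) ^ 2) v m 0) ≤
      ∑ v ∈ Finset.range (4 * n), |s.ra .S v| := by
  have htr := hb.trie
  have hlive : ∀ v < 4 * n,
      {ν ∈ liveNodes (4 * n) (s₀.na .var) cnt 0 | s₀.na .root ν = v} = {v} := by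
    intro v hv
    ext ν
    simp only [Finset.mem_filter, mem_liveNodes, Finset.mem_singleton]
    constructor
    · rintro ⟨⟨h1, h2 | h2⟩, h3⟩
      · rw [htr.root_root ν h2] at h3; exact h3
      · omega
    · rintro rfl
      exact ⟨⟨hv.trans_le htr.le_cnt, Or.inl hv⟩, htr.root_root _ hv⟩
  refine ⟨?_, ?_⟩
  · intro v hv
    have := h.poly v (s.ra .Y) fun _ _ _ => rfl
    rw [hlive v hv, Finset.sum_singleton, htr.path_root v hv, hb.poly] at this
    simpa using this
  · have h1 := h.potential_le
    rw [mul_comm, Finset.sum_mul]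
    have h5 : (0 : ℝ) < 1 / 5 ^ k := by positivity
    calc _ = (1 / 5 ^ k) * ∑ v ∈ Finset.range (4 * n), Real.sqrt (s₀.ra .Q v) / 2 := by
          rw [Finset.mul_sum]
          apply Finset.sum_congr rfl
          intro v _
          rw [hb.sq v]; ring
      _ ≤ _ := mul_le_mul_of_nonneg_left h1 h5.le
      _ ≤ _ := by
          rw [Finset.mul_sum]
          apply Finset.sum_le_sum
          intro v hv
          have hv' := Finset.mem_range.1 hv
          rw [hlive v hv', Finset.sum_singleton, Finset.sum_singleton,
            htr.weight v (hv'.trans_le htr.le_cnt), htr.path_root v hv']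
          simp only [List.length_nil, pow_zero, mul_one]
          apply potential_le_abs _ h5
          rw [hb.sq_eq v]
          exact Finset.sum_nonneg fun _ _ => sq_nonneg _

/-- A loop along a linked list. -/
theorem Halts.walk {inp : Input} {ω : Tape} {p : Program} {next : ℕ → ℕ} {L : List ℕ} {c : ℕ}
    {s : Memory} (I : ℕ → Memory → Prop) (hchain : IsChain next (s.nr .node) L)
    (h : ∀ (j : ℕ) (hj : j < L.length) (s : Memory), I j s → s.nr .zero = 0 → s.nr .node = L[j] →
      Halts inp ω p c
        (fun s' => I (j + 1) s' ∧ s'.nr .zero = 0 ∧ s'.nr .node = next L[j]) s)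
    (h0 : I 0 s) (hz : s.nr .zero = 0) :
    Halts inp ω (.whileDo (RegTest.lt .zero .node).test p) (L.length * (c + 1) + 1)
      (I L.length) s := by
  refine (Halts.while
    (fun j s => I j s ∧ s.nr .zero = 0 ∧ IsChain next (s.nr .node) (L.drop j)) L.length
    (fun _ => c) ?_ ?_ ⟨h0, hz, by simpa using hchain⟩).mono (by simp) fun _ h => h.1
  · rintro j hj s ⟨h1, h2, h3⟩
    rw [List.drop_eq_getElem_cons hj] at h3
    obtain ⟨e1, e2, e3⟩ := h3
    refine ⟨?_, (h j hj s h1 h2 e1).mono le_rfl ?_⟩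
    · change s.nr .zero < s.nr .node
      omega
    · rintro s' ⟨g1, g2, g3⟩
      exact ⟨g1, g2, by rw [g3]; exact e3⟩
  · rintro s ⟨-, h2, h3⟩
    change ¬ s.nr .zero < s.nr .node
    rw [List.drop_length] at h3
    have h3 : s.nr .node = 0 := h3
    omega

/-- The registers that stay fixed while the nodes of one variable are handled. -/
structure SameAs (s₁ s : Memory) : Prop where
  nr : ∀ r ∉ [NReg.ch, .v, .node], s.nr r = s₁.nr r
  na : s.na = s₁.na
  rr : ∀ r ∉ [RReg.a, .b, .c, .d], s.rr r = s₁.rr r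
  W : s.ra .W = s₁.ra .W
  Q : s.ra .Q = s₁.ra .Q
  Y : s.ra .Y = s₁.ra .Y

theorem halts_slopeLoop {inp : Input} {ω : Tape} {L : List ℕ} {s : Memory}
    (hchain : IsChain (s.na .next) (s.nr .node) L) (hz : s.nr .zero = 0) (h1 : s.rr .one = 1)
    (hd : s.rr .d = 0) :
    Halts inp ω (.whileDo (RegTest.lt .zero .node).test slopeProgram) (L.length * 101 + 1)
      (fun s' => SameAs s s' ∧ s'.ra = s.ra ∧ s'.rr .d = (L.map (nodeSlope s)).sum) s := by
  refine (Halts.walk (c := 100) (fun j s' => SameAs s s' ∧ s'.ra = s.ra ∧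
    s'.rr .d = ((L.take j).map (nodeSlope s)).sum) hchain ?_ ⟨?_, rfl, by simpa using hd⟩
    hz).mono le_rfl (by simp)
  · rintro j hj s' ⟨hs, hra, hd'⟩ hz' hnode
    apply Halts.of_block_le _ (by simp [MemOp.time])
    refine ⟨⟨⟨?_, ?_, ?_, ?_, ?_, ?_⟩, ?_, ?_⟩, ?_, ?_⟩
    · intro r hr
      simp at hr
      simp [MemOp.exec, hr, hs.nr]
    · simp [MemOp.exec, hs.na]
    · intro r hr
      simp at hr
      simp [MemOp.exec, hr, hs.rr]
    · simp [MemOp.exec, hra]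
    · simp [MemOp.exec, hra]
    · simp [MemOp.exec, hra]
    · simp [MemOp.exec, hra]
    · have h1' : s'.rr .one = 1 := by rw [hs.rr _ (by simp), h1]
      rw [List.take_succ_eq_append_getElem hj]
      simp only [List.map_append, List.sum_append, ← hd', List.map_cons, List.map_nil,
        List.sum_cons, List.sum_nil, add_zero, nodeSlope]
      simp [MemOp.exec, hnode, h1', hra, hs.na]
      ring
    · simp [MemOp.exec, hz']
    · simp [MemOp.exec, hnode, hs.na]
  · constructor <;> intros <;> rfl

/-- Merging in place, one node after the other, agrees with the simultaneous merge: no listed node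
is a parent of a listed one, and the parents are distinct, so each iteration reads coefficients not
yet modified. Only `T` accumulates. -/
theorem halts_mergeLoop {inp : Input} {ω : Tape} {L : List ℕ} {s : Memory} {y : ℝ}
    (hchain : IsChain (s.na .next) (s.nr .node) L) (hz : s.nr .zero = 0) (h5 : s.rr .five = 5)
    (hy : s.rr .y = y) (hinj : (L.map (s.na .par)).Nodup)
    (hpar : ∀ ν ∈ L, ∀ μ ∈ L, s.na .par ν ≠ μ) :
    Halts inp ω (.whileDo (RegTest.lt .zero .node).test mergeProgram) (L.length * 101 + 1)
      (fun s' => SameAs s s' ∧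
        (∀ μ, s'.ra .S μ = s.ra .S μ +
          (L.map fun ν => if s.na .par ν = μ then y * s.ra .S ν else 0).sum) ∧
        (∀ v, s'.ra .T v = s.ra .T v +
          (L.map fun ν => if s.na .root ν = v then mergeChange s y ν else 0).sum)) s := by
  refine (Halts.walk (c := 100) (fun j s' => SameAs s s' ∧
    (∀ μ, s'.ra .S μ = s.ra .S μ +
      ((L.take j).map fun ν => if s.na .par ν = μ then y * s.ra .S ν else 0).sum) ∧
    (∀ v, s'.ra .T v = s.ra .T v +
      ((L.take j).map fun ν => if s.na .root ν = v then mergeChange s y ν else 0).sum))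
    hchain ?_ ⟨?_, by simp, by simp⟩ hz).mono le_rfl (by simp)
  · rintro j hj s' ⟨hs, hS, hT⟩ hz' hnode
    obtain ⟨ν, hν⟩ : ∃ ν, L[j] = ν := ⟨_, rfl⟩
    have hνL : ν ∈ L := hν ▸ List.getElem_mem hj
    rw [hν] at hnode ⊢
    have hSν : s'.ra .S ν = s.ra .S ν := by
      rw [hS, List.sum_eq_zero, add_zero]
      intro x hx
      obtain ⟨μ, hμ, rfl⟩ := List.mem_map.1 hx
      rw [if_neg (hpar μ (List.mem_of_mem_take hμ) ν hνL)]
    have hSp : s'.ra .S (s.na .par ν) = s.ra .S (s.na .par ν) := by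
      rw [hS, List.sum_eq_zero, add_zero]
      intro x hx
      obtain ⟨μ, hμ, rfl⟩ := List.mem_map.1 hx
      rw [if_neg]
      intro hp
      obtain ⟨i, hi, hμi⟩ := List.mem_take_iff_getElem.1 hμ
      have : i = j := by
        have := (hinj.getElem_inj_iff (hi := by simp; omega) (hj := by simpa using hj)).1
          (show (L.map (s.na .par))[i]'(by simp; omega) = (L.map (s.na .par))[j]'(by simpa using hj)
            by simp [hμi, hν, hp])
        exact this
      omega
    have hy' : s'.rr .y = y := by rw [hs.rr _ (by simp), hy]
    have h5' : s'.rr .five = 5 := by rw [hs.rr _ (by simp), h5]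
    apply Halts.of_block_le _ (by simp [MemOp.time])
    refine ⟨⟨⟨?_, ?_, ?_, ?_, ?_, ?_⟩, ?_, ?_⟩, ?_, ?_⟩
    · intro r hr
      simp at hr
      simp [MemOp.exec, hr, hs.nr]
    · simp [MemOp.exec, hs.na]
    · intro r hr
      simp at hr
      simp [MemOp.exec, hr, hs.rr]
    · simp [MemOp.exec, hs.W]
    · simp [MemOp.exec, hs.Q]
    · simp [MemOp.exec, hs.Y]
    · intro μ
      rw [List.take_succ_eq_append_getElem hj, hν]
      simp only [List.map_append, List.sum_append, List.map_cons, List.map_nil,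
        List.sum_cons, List.sum_nil, add_zero, ← add_assoc, ← hS μ]
      by_cases hμ : s.na .par ν = μ
      · subst hμ
        simp [MemOp.exec, hnode, hs.na, hSν, hy']
      · simp [MemOp.exec, hnode, hs.na, hμ, Ne.symm hμ]
    · intro v
      rw [List.take_succ_eq_append_getElem hj, hν]
      simp only [List.map_append, List.sum_append, List.map_cons, List.map_nil,
        List.sum_cons, List.sum_nil, add_zero, ← add_assoc, ← hT v]
      by_cases hv : s.na .root ν = v
      · subst hv
        simp [MemOp.exec, hnode, hs.na, hs.W, hSν, hSp, hy', h5', mergeChange]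
        left; ring
      · simp [MemOp.exec, hnode, hs.na, hv, Ne.symm hv]
    · simp [MemOp.exec, hz']
    · simp [MemOp.exec, hnode, hs.na]
  · constructor <;> intros <;> rfl

theorem SameAs.holdsConstants {n m : ℕ} {s s' : Memory} (h : SameAs s s')
    (hc : HoldsConstants n m s) : HoldsConstants n m s' :=
  hc.frame (fun r hr => h.nr r (by simp at hr ⊢; grind)) fun r hr => h.rr r (by simp at hr ⊢; grind)

theorem Signing.halts_step {inp : Input} {ω : Tape} {k n m cnt u : ℕ} {path : ℕ → List ℕ}
    {s₀ s : Memory} (htr : IsTrie (4 * n) k s₀ cnt path) (hQ : ∀ v, 0 ≤ s₀.ra .Q v)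
    (h : Signing n m cnt path s₀ (u + 1) s) (hnu : s.nr .u = u + 1) (hu : u < 4 * n) :
    Halts inp ω (.seq (block [.sub .u .u .one, .rconst .d 0, .load .node .head .u])
        (.seq (.whileDo (RegTest.lt .zero .node).test slopeProgram)
          (.seq (.ifThenElse (RegTest.rlt .d .zero).test (block [.rconst .y (-1)])
              (block [.rconst .y 1]))
            (.seq (block [.rstore .Y .u .y, .load .node .head .u])
              (.whileDo (RegTest.lt .zero .node).test mergeProgram)))))
      (202 * (nodesAt (4 * n) (s₀.na .var) cnt u).length + 100)
      (fun s' => Signing n m cnt path s₀ u s' ∧ s'.nr .u = u) s := by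
  set L := nodesAt (4 * n) (s₀.na .var) cnt u with hL
  have hc := h.consts
  refine (Halts.seq_of (T := 20) (T' := 202 * L.length + 80) (P := fun s1 =>
    Signing n m cnt path s₀ (u + 1) s1 ∧ s1.nr .u = u ∧ s1.rr .d = 0 ∧
      s1.nr .node = s₀.na .head u) ?_ ?_).mono (by omega) fun _ h => h
  · apply Halts.of_block_le _ (by simp [MemOp.time])
    refine ⟨⟨?_, ?_, ?_, ?_, ?_, ?_, ?_, ?_⟩, ?_, ?_, ?_⟩
    · apply hc.frame
      · intro r hr; simp at hr; rcases hr with rfl | rfl | rfl | rfl | rfl | rfl <;>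
          simp [MemOp.exec]
      · intro r hr; simp at hr; rcases hr with rfl | rfl | rfl | rfl | rfl <;>
          simp [MemOp.exec]
    · simp [MemOp.exec, h.na]
    · simp [MemOp.exec, h.W]
    · simp [MemOp.exec, h.Q]
    · exact h.weighted
    · exact h.sign
    · exact h.potential_le
    · exact h.poly
    · simp [MemOp.exec, hnu, hc.nr_one]
    · simp [MemOp.exec]
    · simp [MemOp.exec, hnu, hc.nr_one, h.na]
  rintro s1 ⟨h1, hu1, hd1, hn1⟩
  have hc1 := h1.consts
  have hch := htr.chain u hu
  refine (Halts.seq_of (T := 101 * L.length + 1) (T' := 101 * L.length + 79) (halts_slopeLoop (L := L)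
    (by rw [h1.na, hn1]; exact hch) hc1.nr_zero hc1.rr_one hd1 |>.mono (by omega) fun _ h => h)
    ?_).mono (by omega) fun _ h => h
  rintro s2 ⟨hs2, hra2, hd2⟩
  have hc2 := hs2.holdsConstants hc1
  -- `SameAs` also fixes the register `y`, so it is reset before the comparison; it alone may have
  -- changed here.
  refine (Halts.seq_of (T := 11) (T' := 101 * L.length + 68) (P := fun s3 => SameAs s1 { s3 with
      rr := Function.update s3.rr .y (s1.rr .y) } ∧ s3.ra = s1.ra ∧
      (s3.rr .y = 1 ∨ s3.rr .y = -1) ∧ 0 ≤ s3.rr .y * (L.map (nodeSlope s1)).sum)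
    ?_ ?_).mono (by omega) fun _ h => h
  · have key : ∀ z : ℤ, SameAs s1 { s2 with
        rr := Function.update (Function.update s2.rr .y (z : ℝ)) .y (s1.rr .y) } := by
      intro z
      refine ⟨hs2.nr, hs2.na, ?_, hs2.W, hs2.Q, hs2.Y⟩
      intro r hr
      by_cases hry : r = .y
      · subst hry; simp
      · simp only [Function.update_of_ne hry]; exact hs2.rr r hr
    apply Halts.ite
    · intro hlt
      have hlt : s2.rr .d < s2.rr .zero := hlt
      rw [hc2.rr_zero, hd2] at hlt
      apply Halts.of_block_le _ (by simp [MemOp.time])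
      refine ⟨key (-1), hra2, ?_, ?_⟩
      · simp [MemOp.exec]
      · simp [MemOp.exec, hlt.le]
    · intro hlt
      have hlt : ¬ s2.rr .d < s2.rr .zero := hlt
      rw [hc2.rr_zero, hd2, not_lt] at hlt
      apply Halts.of_block_le _ (by simp [MemOp.time])
      refine ⟨key 1, hra2, ?_, ?_⟩
      · simp [MemOp.exec]
      · simp [MemOp.exec, hlt]
  rintro s3 ⟨hs3, hra3, hy3, hd3⟩
  have hu3 : s3.nr .u = u := (hs3.nr .u (by simp)).trans hu1
  have hna3 : s3.na = s₀.na := hs3.na.trans h1.na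
  have hc3 : HoldsConstants n m s3 := by
    apply hc1.frame
    · intro r hr; exact hs3.nr r (by simp at hr ⊢; grind)
    · intro r hr
      have hry : r ≠ .y := by rintro rfl; simp at hr
      have := hs3.rr r (by simp at hr ⊢; grind)
      simpa only [Function.update_of_ne hry] using this
  obtain ⟨y, hy⟩ : ∃ y, s3.rr .y = y := ⟨_, rfl⟩
  rw [hy] at hy3 hd3
  refine (Halts.seq_of (T := 20) (T' := 101 * L.length + 48) (P := fun s4 => s4.na = s₀.na ∧
    HoldsConstants n m s4 ∧ s4.ra = Function.update s1.ra .Y (Function.update (s1.ra .Y) u y) ∧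
    s4.nr .u = u ∧ s4.nr .node = s₀.na .head u ∧ s4.rr .y = y) ?_ ?_).mono
    (by omega) fun _ h => h
  · apply Halts.of_block_le _ (by simp [MemOp.time])
    refine ⟨?_, ?_, ?_, ?_, ?_, ?_⟩
    · simp [MemOp.exec, hna3]
    · apply hc3.frame
      · intro r hr; simp at hr; rcases hr with rfl | rfl | rfl | rfl | rfl | rfl <;>
          simp [MemOp.exec]
      · intro r hr; simp [MemOp.exec]
    · simp [MemOp.exec, hra3, hu3, hy]
    · simp [MemOp.exec, hu3]
    · simp [MemOp.exec, hu3, hna3]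
    · simp [MemOp.exec, hy]
  rintro s4 ⟨hna4, hc4, hra4, hu4, hnode4, hy4⟩
  refine (halts_mergeLoop (L := L) (y := y) (by rw [hna4, hnode4]; exact hch) hc4.nr_zero hc4.rr_five
    hy4 ?_ ?_).mono (by omega) ?_
  · rw [List.nodup_map_iff_inj_on nodup_nodesAt, hna4]
    intro x hx z hz
    exact htr.par_injOn (u := u) (by simpa using hx) (by simpa using hz)
  · intro ν hν μ hμ hp
    rw [hna4] at hp
    have h2 := htr.par_mem hν
    rw [hp, mem_liveNodes] at h2
    rw [hL, mem_nodesAt] at hμ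
    omega
  · rintro s5 ⟨hs5, hS5, hT5⟩
    have hcoef : ∀ A, A ≠ RArr.Y → s4.ra A = s1.ra A := by
      intro A hA; rw [hra4, Function.update_of_ne hA]
    refine ⟨h1.step htr hQ hu hy3 hd3 (hs5.holdsConstants hc4) ?_ ?_ ?_ ?_ ?_ ?_, ?_⟩
    · rw [hs5.na, hna4, h1.na]
    · rw [hs5.W, hcoef _ (by simp)]
    · rw [hs5.Q, hcoef _ (by simp)]
    · rw [hs5.Y, hra4, Function.update_self]
    · intro μ
      rw [hS5, hna4, hcoef .S (by simp)]
    · intro v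
      have : mergeChange s4 y = mergeChange s1 y := by
        funext ν
        simp only [mergeChange, hcoef .S (by simp), hcoef .W (by simp), hna4, h1.na]
      rw [hT5, hna4, hcoef .T (by simp), this]
    · rw [hs5.nr _ (by simp), hu4]

/-- The identity code also has its variables `4 i`. No term contains them, so their signs are
irrelevant, and treating them uniformly costs only `O(n)` steps. -/
theorem halts_signProgram {inp : Input} {ω : Tape} {k n m cnt : ℕ} {l : ℕ → List ℕ} {a : ℕ → ℝ}
    {path : ℕ → List ℕ} {s : Memory} (hb : Building k n m l a m 0 cnt path s) :
    Halts inp ω signProgram (404 * n + 202 * cnt + 100)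
      (fun s' => HoldsConstants n m s' ∧
        (∀ x < 4 * n, s'.ra .Y x = 1 ∨ s'.ra .Y x = -1) ∧
        (∀ v < 4 * n, s'.ra .S v =
          doneSum l (fun t => a t / 6 ^ (l t).length * ((l t).map (s'.ra .Y)).prod) v m 0) ∧
        1 / 5 ^ k / 2 * ∑ v ∈ Finset.range (4 * n),
            Real.sqrt (doneSum l (fun t => (a t / 6 ^ (l t).length) ^ 2) v m 0) ≤
          ∑ v ∈ Finset.range (4 * n), |s'.ra .S v|) s := by
  have hQ : ∀ v, 0 ≤ s.ra .Q v := fun v => by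
    rw [hb.sq_eq v]; exact Finset.sum_nonneg fun _ _ => sq_nonneg _
  refine (Halts.seq_of (T := 50) (T' := 404 * n + 202 * cnt + 1)
    (P := fun s1 => Signing n m cnt path s (4 * n) s1 ∧ s1.nr .u = 4 * n) ?_ ?_).mono
    (by omega) fun _ h => h
  · apply Halts.of_block_le _ (by simp [MemOp.time])
    obtain ⟨h1, h2, h3, h4, h5, h6, h7, h8⟩ := hb.signing
    refine ⟨⟨?_, h2, h3, h4, h5, h6, h7, h8⟩, ?_⟩
    · apply h1.frame
      · intro r hr; simp at hr; rcases hr with rfl | rfl | rfl | rfl | rfl | rfl <;>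
          simp [MemOp.exec]
      · intro r hr; simp [MemOp.exec]
    · simp [MemOp.exec, h1.nr_size, h1.nr_zero]
  · rintro s1 ⟨h1, hu1⟩
    -- Iteration `i` treats the variable `4 n - 1 - i`; its cost is proportional to the length of
    -- the list of that variable.
    refine (Halts.while (fun i s' => Signing n m cnt path s (4 * n - i) s' ∧ s'.nr .u = 4 * n - i)
      (4 * n) (fun i => 202 * (nodesAt (4 * n) (s.na .var) cnt (4 * n - 1 - i)).length + 100)
      ?_ ?_ ⟨h1, hu1⟩).mono ?_ ?_
    · rintro i hi s' ⟨hs, hu⟩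
      have e : 4 * n - i = 4 * n - 1 - i + 1 := by omega
      rw [e] at hs hu
      refine ⟨?_, ?_⟩
      · change s'.nr .zero < s'.nr .u
        rw [hs.consts.nr_zero, hu]; omega
      have e' : 4 * n - (i + 1) = 4 * n - 1 - i := by omega
      rw [e']
      exact hs.halts_step hb.trie hQ hu (by omega)
    · rintro s' ⟨hs, hu⟩
      change ¬ s'.nr .zero < s'.nr .u
      rw [hs.consts.nr_zero, hu]; omega
    · have h2 := sum_length_nodesAt_le (4 * n) (s.na .var) cnt
      rw [Finset.sum_range_reflect
        (fun x => 202 * (nodesAt (4 * n) (s.na .var) cnt x).length + 100 + 1)]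
      rw [Finset.sum_add_distrib, Finset.sum_add_distrib, ← Finset.mul_sum]
      simp only [Finset.sum_const, Finset.card_range, smul_eq_mul]
      omega
    · rintro s' ⟨hs, -⟩
      rw [Nat.sub_self] at hs
      obtain ⟨g1, g2⟩ := hs.finish hb
      exact ⟨hs.consts, fun x hx => hs.sign x (Nat.zero_le _) hx, g1, g2⟩

/-! ### Choosing the best candidate -/

/-- The value of the variable `x` in the candidate with parameter `t`, given the signs `Y` and the
derivatives `S`. -/
noncomputable def candidate (Y S : ℕ → ℝ) (t : ℝ) (x : ℕ) : ℝ :=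
  Y x * (if S x < 0 then 1 - t else 1 + t) / 6

/-- The value of the non-constant part of the Hamiltonian at a candidate. -/
noncomputable def candidateValue (m : ℕ) (l : ℕ → List ℕ) (a : ℕ → ℝ) (Y S : ℕ → ℝ) (t : ℝ) : ℝ :=
  ∑ i ∈ Finset.range m,
    if 0 < (l i).length then a i * ((l i).map (candidate Y S t)).prod else 0

/-- The memory after the signs have been chosen. -/
structure Signed (n m : ℕ) (Y S : ℕ → ℝ) (s : Memory) : Prop where
  consts : HoldsConstants n m s
  Y : s.ra .Y = Y
  S : s.ra .S = S

theorem Signed.frame {n m : ℕ} {Y S : ℕ → ℝ} {s s' : Memory} (h : Signed n m Y S s)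
    (hn : ∀ r ∈ [NReg.zero, .one, .two, .n, .m, .size], s'.nr r = s.nr r)
    (hr : ∀ r ∈ [RReg.zero, .one, .two, .five, .six], s'.rr r = s.rr r) (ha : s'.ra = s.ra) :
    Signed n m Y S s' :=
  ⟨h.consts.frame hn hr, by rw [ha, h.Y], by rw [ha, h.S]⟩

theorem halts_valueProgram {inp : Input} {ω : Tape} {n m : ℕ} {Y S : ℕ → ℝ} {s : Memory}
    {tt : RReg} (h : Signed n m Y S s) (hb : tt ≠ .b) (hc : tt ≠ .c) :
    Halts inp ω (valueProgram tt) 20 (fun s' => Signed n m Y S s' ∧ s'.ra = s.ra ∧ s'.nr = s.nr ∧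
      (∀ r, r ≠ .b → r ≠ .c → s'.rr r = s.rr r) ∧ s'.out = s.out ∧ s'.drawn = s.drawn ∧
      s'.rr .b = candidate Y S (s.rr tt) (s.nr .x)) s := by
  refine (Halts.seq_of (T := 13) (T' := 7) (P := fun s1 => s1.nr = s.nr ∧ s1.ra = s.ra ∧
    s1.out = s.out ∧ s1.drawn = s.drawn ∧ (∀ r, r ≠ .b → r ≠ .c → s1.rr r = s.rr r) ∧
    s1.rr .b = Y (s.nr .x) ∧ s1.rr .c = S (s.nr .x)) ?_ ?_).mono (by omega) fun _ h => h
  · apply Halts.of_block_le _ (by simp [MemOp.time])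
    refine ⟨?_, ?_, ?_, ?_, ?_, ?_, ?_⟩
    all_goals simp [MemOp.exec, h.Y, h.S]
    intro r h1 h2
    simp [h1, h2]
  rintro s1 ⟨e1, e2, e3, e4, e5, e6, e7⟩
  have h1 : Signed n m Y S s1 := h.frame (fun r _ => by rw [e1])
    (by intro r hr; simp at hr; rcases hr with rfl | rfl | rfl | rfl | rfl <;> apply e5 <;> simp) e2
  refine (Halts.seq_of (T := 3) (T' := 4) (P := fun s2 => s2.nr = s.nr ∧ s2.ra = s.ra ∧
    s2.out = s.out ∧ s2.drawn = s.drawn ∧ (∀ r, r ≠ .b → r ≠ .c → s2.rr r = s.rr r) ∧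
    s2.rr .b = Y (s.nr .x) ∧
    s2.rr .c = if S (s.nr .x) < 0 then 1 - s.rr tt else 1 + s.rr tt) ?_ ?_).mono
    (by omega) fun _ h => h
  · have hz := h1.consts.rr_zero
    have ho := h1.consts.rr_one
    apply Halts.ite
    · intro hlt
      have hlt : s1.rr .c < s1.rr .zero := hlt
      rw [e7, hz] at hlt
      apply Halts.of_block_le _ (by simp [MemOp.time])
      refine ⟨e1, e2, e3, e4, ?_, ?_, ?_⟩
      · intro r h1 h2; simp [MemOp.exec, h2, e5 r h1 h2]
      · simp [MemOp.exec, e6]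
      · simp [MemOp.exec, hlt, ho, e5 tt hb hc]
    · intro hlt
      have hlt : ¬ s1.rr .c < s1.rr .zero := hlt
      rw [e7, hz] at hlt
      apply Halts.of_block_le _ (by simp [MemOp.time])
      refine ⟨e1, e2, e3, e4, ?_, ?_, ?_⟩
      · intro r h1 h2; simp [MemOp.exec, h2, e5 r h1 h2]
      · simp [MemOp.exec, e6]
      · simp [MemOp.exec, hlt, ho, e5 tt hb hc]
  rintro s2 ⟨g1, g2, g3, g4, g5, g6, g7⟩
  have h2 : Signed n m Y S s2 := h.frame (fun r _ => by rw [g1])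
    (by intro r hr; simp at hr; rcases hr with rfl | rfl | rfl | rfl | rfl <;> apply g5 <;> simp) g2
  apply Halts.of_block_le _ (by simp [MemOp.time])
  refine ⟨h2.frame (by intro r _; simp [MemOp.exec]) ?_ (by simp [MemOp.exec]),
    g2, g1, ?_, g3, g4, ?_⟩
  · intro r hr; simp at hr; rcases hr with rfl | rfl | rfl | rfl | rfl <;> simp [MemOp.exec]
  · intro r h1 h2; simp [MemOp.exec, h1, g5 r h1 h2]
  · simp [MemOp.exec, g6, g7, h2.consts.rr_six, candidate]

/-- The memory during the evaluation of a candidate. -/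
structure Evaluating (n m : ℕ) (l : ℕ → List ℕ) (pos : ℕ → ℕ) (Y S : ℕ → ℝ) (z b bt d : ℝ) (t : ℕ)
    (s : Memory) : Prop where
  signed : Signed n m Y S s
  nr_t : s.nr .t = t
  nr_pos : s.nr .pos = pos t
  rr_tt : s.rr .tt = z
  rr_best : s.rr .best = b
  rr_bt : s.rr .bt = bt
  rr_d : s.rr .d = d

theorem Evaluating.congr {n m : ℕ} {l : ℕ → List ℕ} {pos : ℕ → ℕ} {Y S : ℕ → ℝ} {z b bt d : ℝ}
    {t : ℕ} {s s' : Memory} (h : Evaluating n m l pos Y S z b bt d t s)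
    (hn : ∀ r ∈ [NReg.zero, .one, .two, .n, .m, .size, .t, .pos], s'.nr r = s.nr r)
    (hr : ∀ r ∈ [RReg.zero, .one, .two, .five, .six, .tt, .best, .bt, .d], s'.rr r = s.rr r)
    (ha : s'.ra = s.ra) : Evaluating n m l pos Y S z b bt d t s' := by
  refine ⟨h.signed.frame (fun r hr' => hn r ?_) (fun r hr' => hr r ?_) ha, ?_, ?_, ?_, ?_, ?_, ?_⟩
  · simp at hr' ⊢; tauto
  · simp at hr' ⊢; tauto
  · rw [hn _ (by simp), h.nr_t]
  · rw [hn _ (by simp), h.nr_pos]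
  · rw [hr _ (by simp), h.rr_tt]
  · rw [hr _ (by simp), h.rr_best]
  · rw [hr _ (by simp), h.rr_bt]
  · rw [hr _ (by simp), h.rr_d]

theorem halts_evalTermProgram {inp : Input} {ω : Tape} {k n m : ℕ} {l : ℕ → List ℕ} {a : ℕ → ℝ}
    {pos : ℕ → ℕ} {Y S : ℕ → ℝ} {z b bt d : ℝ} {t : ℕ} {s : Memory}
    (hin : ReadsTerms k n m l a pos inp) (ht : t < m)
    (h : Evaluating n m l pos Y S z b bt d t s) (hw : s.nr .w = (l t).length) :
    Halts inp ω evalTermProgram (k * 51 + 30) (fun s' =>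
      Evaluating n m l pos Y S z b bt (d + a t * ((l t).map (candidate Y S z)).prod) t s' ∧
        s'.nr .w = (l t).length) s := by
  have hlen := hin.length_le t ht
  refine (Halts.seq_of (T := 10) (T' := k * 51 + 20) (P := fun s1 =>
    Evaluating n m l pos Y S z b bt d t s1 ∧ s1.nr .w = (l t).length ∧ s1.nr .j = 0 ∧
    s1.nr .pj = pos t + 1 ∧ s1.rr .a = a t) ?_ ?_).mono (by omega) fun _ h => h
  · have hc := h.signed.consts
    have ha := hin.coeff t ht
    simp only [List.getD_eq_getElem?_getD] at ha
    apply Halts.of_block_le _ (by simp [MemOp.time])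
    refine ⟨h.congr ?_ ?_ ?_, ?_, ?_, ?_, ?_⟩
    · intro r hr; simp at hr
      rcases hr with rfl | rfl | rfl | rfl | rfl | rfl | rfl | rfl <;> simp [MemOp.exec]
    · intro r hr; simp at hr
      rcases hr with rfl | rfl | rfl | rfl | rfl | rfl | rfl | rfl | rfl <;> simp [MemOp.exec]
    · simp [MemOp.exec]
    · simp [MemOp.exec, hw]
    · simp [MemOp.exec]
    · simp [MemOp.exec, h.nr_pos, hc.nr_one]
    · simp [MemOp.exec, h.nr_t, ha]
  rintro s1 ⟨h1, hw1, hj1, hpj1, ha1⟩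
  refine (Halts.seq_of (T := k * 51 + 1) (T' := 19) (P := fun s2 =>
    Evaluating n m l pos Y S z b bt d t s2 ∧ s2.nr .w = (l t).length ∧
    s2.rr .a = a t * ((l t).map (candidate Y S z)).prod) ?_ ?_).mono (by omega) fun _ h => h
  · refine (Halts.while (fun j s => Evaluating n m l pos Y S z b bt d t s ∧
      s.nr .w = (l t).length ∧ s.nr .j = j ∧ s.nr .pj = pos t + 1 + 2 * j ∧
      s.rr .a = a t * (((l t).take j).map (candidate Y S z)).prod) (l t).length (fun _ => 50) ?_ ?_
      ⟨h1, hw1, hj1, by simpa using hpj1, by simpa using ha1⟩).mono ?_ ?_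
    · rintro j hj s ⟨hs, hw, hsj, hpj, ha⟩
      refine ⟨?_, ?_⟩
      · change s.nr .j < s.nr .w
        rw [hsj, hw]; exact hj
      have hv := hin.var t ht j hj
      rw [← hpj] at hv
      obtain ⟨e1, e2, e3, -, -, e4, e5⟩ := execs_readVar (ω := ω) (dst := .x)
        hs.signed.consts.nr_one (by simp) hv
      refine (Halts.seq_of (T := 20) (T' := 30) (P := fun s2 =>
        Evaluating n m l pos Y S z b bt d t s2 ∧ s2.nr .w = (l t).length ∧ s2.nr .j = j ∧
        s2.nr .pj = pos t + 1 + 2 * j ∧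
        s2.rr .a = a t * (((l t).take j).map (candidate Y S z)).prod ∧
        s2.nr .x = (l t).getD j 0) ?_ ?_).mono (by omega) fun _ h => h
      · apply Halts.of_block_le _ (by simp [readVar, MemOp.time])
        refine ⟨hs.congr ?_ (fun r _ => by rw [e3]) e2, ?_, ?_, ?_, ?_, ?_⟩
        · intro r hr; apply e5 <;> rintro rfl <;> simp at hr
        · rw [e5 _ (by simp) (by simp) (by simp), hw]
        · rw [e5 _ (by simp) (by simp) (by simp), hsj]
        · rw [e5 _ (by simp) (by simp) (by simp), hpj]
        · rw [e3, ha]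
        · rw [e4]
      rintro s2 ⟨hs2, hw2, hj2, hpj2, ha2, hx2⟩
      refine (Halts.seq_of (T := 20) (T' := 10) (halts_valueProgram hs2.signed
        (tt := .tt) (by simp) (by simp)) ?_).mono (by omega) fun _ h => h
      rintro s3 ⟨hsg, g0, g1, g2, -, -, g3⟩
      rw [hs2.rr_tt, hx2] at g3
      have hc3 := hsg.consts
      apply Halts.of_block_le _ (by simp [MemOp.time])
      refine ⟨hs2.congr ?_ ?_ ?_, ?_, ?_, ?_, ?_⟩
      · intro r hr; simp at hr
        rcases hr with rfl | rfl | rfl | rfl | rfl | rfl | rfl | rfl <;> simp [MemOp.exec, g1]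
      · intro r hr; simp at hr
        rcases hr with rfl | rfl | rfl | rfl | rfl | rfl | rfl | rfl | rfl <;>
          simp [MemOp.exec] <;> apply g2 <;> simp
      · have : s3.ra = s2.ra := g0
        simp [MemOp.exec, this]
      · simp [MemOp.exec, g1, hw2]
      · simp [MemOp.exec, hc3.nr_one]
        rw [g1, hj2]
      · simp [MemOp.exec, hc3.nr_two]
        rw [g1, hpj2]; ring
      · rw [List.take_succ_eq_append_getElem hj, List.map_append, List.prod_append, ← mul_assoc,
          ← ha2]
        have := g2 .a (by simp) (by simp)
        rw [List.getD_eq_getElem _ _ hj] at g3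
        simp [MemOp.exec, this, g3]
    · rintro s ⟨hs, hw, hsj, -⟩
      change ¬ s.nr .j < s.nr .w
      rw [hsj, hw]; exact lt_irrefl _
    · simp; omega
    · rintro s ⟨hs, hw, -, -, ha⟩
      exact ⟨hs, hw, by rw [ha, List.take_length]⟩
  rintro s2 ⟨h2, hw2, ha2⟩
  obtain ⟨q1, q2, q3, q4, q5, q6, q7⟩ := h2
  apply Halts.of_block_le _ (by simp [MemOp.time])
  refine ⟨⟨q1.frame ?_ ?_ ?_, ?_, ?_, ?_, ?_, ?_, ?_⟩, hw2⟩
  · intro r hr; simp [MemOp.exec]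
  · intro r hr; simp at hr; rcases hr with rfl | rfl | rfl | rfl | rfl <;> simp [MemOp.exec]
  · simp [MemOp.exec]
  all_goals simp [MemOp.exec, *]

/-- The memory after some candidates have been evaluated. -/
structure Selected (n m : ℕ) (l : ℕ → List ℕ) (a : ℕ → ℝ) (Y S : ℕ → ℝ) (j : ℕ) (s : Memory) :
    Prop where
  signed : Signed n m Y S s
  nonneg : 0 ≤ s.rr .bt
  le_one : s.rr .bt ≤ 1
  best_le : s.rr .best ≤ |candidateValue m l a Y S (s.rr .bt)|
  le_best : ∀ i < j, |candidateValue m l a Y S (1 / ((i : ℝ) + 1))| ≤ s.rr .best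

/-- A running maximum of absolute values: a very negative value is as good as a very positive one,
as it solves the minimization problem. -/
theorem halts_candidateProgram {inp : Input} {ω : Tape} {k n m : ℕ} {l : ℕ → List ℕ} {a : ℕ → ℝ}
    {pos : ℕ → ℕ} {Y S : ℕ → ℝ} {j : ℕ} {s : Memory}
    (hin : ReadsTerms k n m l a pos inp) (h : Selected n m l a Y S j s) :
    Halts inp ω (candidateProgram j) (m * (k * 51 + 61) + 40) (Selected n m l a Y S (j + 1)) s := by
  obtain ⟨b, hb⟩ : ∃ b, s.rr .best = b := ⟨_, rfl⟩
  obtain ⟨bt, hbt⟩ : ∃ bt, s.rr .bt = bt := ⟨_, rfl⟩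
  obtain ⟨h1, h2, h3, h4, h5⟩ := h
  rw [hbt] at h2 h3 h4
  rw [hb] at h4 h5
  set z : ℝ := 1 / ((j : ℝ) + 1) with hz
  have hc := h1.consts
  have hz0 : 0 ≤ z := by positivity
  have hz1 : z ≤ 1 := by
    rw [hz, div_le_one (by positivity)]; linarith [(Nat.cast_nonneg j : (0 : ℝ) ≤ j)]
  set F : ℕ → ℝ := fun i =>
    if 0 < (l i).length then a i * ((l i).map (candidate Y S z)).prod else 0 with hF
  refine (Halts.seq_of (T := 10) (T' := m * (k * 51 + 61) + 30)
    (P := Evaluating n m l pos Y S z b bt 0 0) ?_ ?_).mono (by omega) fun _ h => h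
  · apply Halts.of_block_le _ (by simp [MemOp.time])
    refine ⟨h1.frame ?_ ?_ ?_, ?_, ?_, ?_, ?_, ?_, ?_⟩
    · intro r hr; simp at hr; rcases hr with rfl | rfl | rfl | rfl | rfl | rfl <;>
        simp [MemOp.exec]
    · intro r hr; simp at hr; rcases hr with rfl | rfl | rfl | rfl | rfl <;> simp [MemOp.exec]
    · simp [MemOp.exec]
    · simp [MemOp.exec]
    · simp [MemOp.exec, hin.pos_zero]
    · simp [MemOp.exec, hc.rr_one, hz]
    · simp [MemOp.exec, hb]
    · simp [MemOp.exec, hbt]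
    · simp [MemOp.exec]
  intro s1 hs1
  refine (Halts.seq_of (T := m * (k * 51 + 61) + 1) (T' := 29)
    (P := Evaluating n m l pos Y S z b bt (candidateValue m l a Y S z) m) ?_ ?_).mono
    (by omega) fun _ h => h
  · refine (Halts.while (fun t => Evaluating n m l pos Y S z b bt (∑ i ∈ Finset.range t, F i) t)
      m (fun _ => k * 51 + 60) ?_ ?_ (by simpa using hs1)).mono (by simp) fun _ h => h
    · intro t ht s2 hs2
      refine ⟨?_, ?_⟩
      · change s2.nr .t < s2.nr .m
        rw [hs2.nr_t, hs2.signed.consts.nr_m]; exact ht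
      rw [Finset.sum_range_succ]
      refine (Halts.seq_of (T := 5) (T' := k * 51 + 55) (P := fun s3 =>
        Evaluating n m l pos Y S z b bt (∑ i ∈ Finset.range t, F i) t s3 ∧
        s3.nr .w = (l t).length) ?_ ?_).mono (by omega) fun _ h => h
      · apply Halts.of_block_le _ (by simp [MemOp.time])
        have hw := hin.weight t ht
        simp only [List.getD_eq_getElem?_getD] at hw
        refine ⟨hs2.congr ?_ ?_ ?_, ?_⟩
        · intro r hr; simp at hr
          rcases hr with rfl | rfl | rfl | rfl | rfl | rfl | rfl | rfl <;> simp [MemOp.exec]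
        · intro r hr; simp [MemOp.exec]
        · simp [MemOp.exec]
        · simp [MemOp.exec, hs2.nr_pos, hw]
      rintro s3 ⟨hs3, hw3⟩
      refine (Halts.seq_of (T := k * 51 + 31) (T' := 24) (P := fun s4 =>
        Evaluating n m l pos Y S z b bt (∑ i ∈ Finset.range t, F i + F t) t s4 ∧
        s4.nr .w = (l t).length) ?_ ?_).mono (by omega) fun _ h => h
      · have hc3 := hs3.signed.consts
        apply Halts.ite
        · intro hlt
          have hlt : s3.nr .zero < s3.nr .w := hlt
          rw [hc3.nr_zero, hw3] at hlt
          simp only [hF, if_pos hlt]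
          exact halts_evalTermProgram hin ht hs3 hw3
        · intro hlt
          have hlt : ¬ s3.nr .zero < s3.nr .w := hlt
          rw [hc3.nr_zero, hw3] at hlt
          apply Halts.of_block_le _ (by simp)
          simp only [hF, if_neg hlt, add_zero, execs_nil]
          exact ⟨hs3, hw3⟩
      rintro s4 ⟨⟨q1, q2, q3, q4, q5, q6, q7⟩, hw4⟩
      have hc4 := q1.consts
      apply Halts.of_block_le _ (by simp [nextTerm, MemOp.time])
      refine ⟨q1.frame ?_ ?_ ?_, ?_, ?_, ?_, ?_, ?_, ?_⟩
      · intro r hr; simp at hr; rcases hr with rfl | rfl | rfl | rfl | rfl | rfl <;>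
          simp [nextTerm, MemOp.exec]
      · intro r hr; simp [nextTerm, MemOp.exec]
      · simp [nextTerm, MemOp.exec]
      · simp [nextTerm, MemOp.exec, q2, hc4.nr_one]
      · simp [nextTerm, MemOp.exec, q3, hw4, hc4.nr_one, hin.pos_succ t ht]
      all_goals simp [nextTerm, MemOp.exec, q4, q5, q6, q7]
    · intro s hs
      change ¬ s.nr .t < s.nr .m
      rw [hs.nr_t, hs.signed.consts.nr_m]; exact lt_irrefl _
  intro s2 hs2
  refine (Halts.seq_of (T := 10) (T' := 19)
    (P := Evaluating n m l pos Y S z b bt |candidateValue m l a Y S z| m) ?_ ?_).mono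
    (by omega) fun _ h => h
  · have hz2 := hs2.signed.consts.rr_zero
    apply (Halts.ite (T := 9) ?_ ?_)
    · intro hlt
      have hlt : s2.rr .d < s2.rr .zero := hlt
      rw [hs2.rr_d, hz2] at hlt
      obtain ⟨q1, q2, q3, q4, q5, q6, q7⟩ := hs2
      apply Halts.of_block_le _ (by simp [MemOp.time])
      refine ⟨q1.frame ?_ ?_ ?_, ?_, ?_, ?_, ?_, ?_, ?_⟩
      · intro r hr; simp [MemOp.exec]
      · intro r hr; simp at hr; rcases hr with rfl | rfl | rfl | rfl | rfl <;> simp [MemOp.exec]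
      · simp [MemOp.exec]
      all_goals simp [MemOp.exec, q2, q3, q4, q5, q6, q7, hz2, abs_of_neg hlt]
    · intro hlt
      have hlt : ¬ s2.rr .d < s2.rr .zero := hlt
      rw [hs2.rr_d, hz2, not_lt] at hlt
      apply Halts.of_block_le _ (by simp)
      rw [abs_of_nonneg hlt]
      exact hs2
  rintro s3 ⟨q1, q2, q3, q4, q5, q6, q7⟩
  have hz3 := q1.consts.rr_zero
  apply (Halts.ite (T := 18) ?_ ?_)
  · intro hlt
    have hlt : s3.rr .best < s3.rr .d := hlt
    rw [q5, q7] at hlt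
    apply Halts.of_block_le _ (by simp [MemOp.time])
    have e1 : (execs inp ω [.radd .best .d .zero, .radd .bt .tt .zero] s3).rr .best =
        |candidateValue m l a Y S z| := by simp [MemOp.exec, hz3, q7]
    have e2 : (execs inp ω [.radd .best .d .zero, .radd .bt .tt .zero] s3).rr .bt = z := by
      simp [MemOp.exec, hz3, q4]
    refine ⟨q1.frame ?_ ?_ ?_, ?_, ?_, ?_, ?_⟩
    · intro r hr; simp [MemOp.exec]
    · intro r hr; simp at hr; rcases hr with rfl | rfl | rfl | rfl | rfl <;> simp [MemOp.exec]
    · simp [MemOp.exec]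
    · rw [e2]; exact hz0
    · rw [e2]; exact hz1
    · rw [e1, e2]
    · intro i hi
      rw [e1]
      rcases Nat.lt_succ_iff_lt_or_eq.1 hi with hi | rfl
      · exact (h5 i hi).trans hlt.le
      · exact le_rfl
  · intro hlt
    have hlt : ¬ s3.rr .best < s3.rr .d := hlt
    rw [q5, q7, not_lt] at hlt
    apply Halts.of_block_le _ (by simp)
    rw [execs_nil]
    refine ⟨q1, by rwa [q6], by rwa [q6], by rwa [q5, q6], ?_⟩
    intro i hi
    rw [q5]
    rcases Nat.lt_succ_iff_lt_or_eq.1 hi with hi | rfl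
    · exact h5 i hi
    · exact hlt

theorem halts_candidatesProgram {inp : Input} {ω : Tape} {k n m : ℕ} {l : ℕ → List ℕ} {a : ℕ → ℝ}
    {pos : ℕ → ℕ} {Y S : ℕ → ℝ} {s : Memory} (hin : ReadsTerms k n m l a pos inp)
    (h : Signed n m Y S s) (j : ℕ) :
    Halts inp ω (candidatesProgram j) (j * (m * (k * 51 + 61) + 40) + 10)
      (Selected n m l a Y S j) s := by
  induction j with
  | zero =>
    apply Halts.of_block_le _ (by simp [MemOp.time])
    -- The search starts with the value 0 and the parameter 0, where the true value may differ from
    -- 0; hence `best_le` is only an inequality.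
    refine ⟨h.frame ?_ ?_ ?_, ?_, ?_, ?_, ?_⟩
    · intro r hr; simp [MemOp.exec]
    · intro r hr; simp at hr; rcases hr with rfl | rfl | rfl | rfl | rfl <;> simp [MemOp.exec]
    · simp [MemOp.exec]
    · simp [MemOp.exec]
    · simp [MemOp.exec]
    · simp [MemOp.exec]
    · intro i hi; omega
  | succ j ih =>
    exact (Halts.seq_of ih fun s hs => halts_candidateProgram hin hs).mono
      (by rw [add_mul, one_mul]; omega) fun _ h => h

/-! ### Rounding -/

/-- The Bloch vector of qubit `i` in the candidate with parameter `t`. -/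
noncomputable def candidateBloch (Y S : ℕ → ℝ) (t : ℝ) (i : ℕ) (p : Pauli) : ℝ :=
  candidate Y S t (4 * i + p.code)

/-- The constants used during the rounding. -/
structure RoundingConstants (n m : ℕ) (Y S : ℕ → ℝ) (t : ℝ) (s : Memory) : Prop where
  signed : Signed n m Y S s
  rr_bt : s.rr .bt = t
  rr_h : s.rr .h = 1 / Real.sqrt 2
  rr_third : s.rr .third = 1 / 3
  rr_twoThirds : s.rr .twoThirds = 2 / 3
  rr_cX : s.rr .cX = 1 / 6
  rr_cY : s.rr .cY = 1 / 2
  rr_cZ : s.rr .cZ = 5 / 6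

theorem RoundingConstants.frame {n m : ℕ} {Y S : ℕ → ℝ} {t : ℝ} {s s' : Memory}
    (h : RoundingConstants n m Y S t s)
    (hn : ∀ r ∈ [NReg.zero, .one, .two, .n, .m, .size], s'.nr r = s.nr r)
    (hr : ∀ r ∉ [RReg.a, .b, .c, .mX, .mY, .mZ, .r], s'.rr r = s.rr r) (ha : s'.ra = s.ra) :
    RoundingConstants n m Y S t s' := by
  refine ⟨h.signed.frame hn (fun r hr' => hr r (by simp at hr' ⊢; grind)) ha,
    ?_, ?_, ?_, ?_, ?_, ?_, ?_⟩
  · rw [hr _ (by simp), h.rr_bt]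
  · rw [hr _ (by simp), h.rr_h]
  · rw [hr _ (by simp), h.rr_third]
  · rw [hr _ (by simp), h.rr_twoThirds]
  · rw [hr _ (by simp), h.rr_cX]
  · rw [hr _ (by simp), h.rr_cY]
  · rw [hr _ (by simp), h.rr_cZ]

theorem halts_thresholdProgram {inp : Input} {ω : Tape} {n m : ℕ} {Y S : ℕ → ℝ} {t : ℝ}
    {s : Memory} {q c : RReg} (h : RoundingConstants n m Y S t s) (hq : q ∈ [RReg.mX, .mY, .mZ])
    (hc : c ≠ .b ∧ c ≠ .c) :
    Halts inp ω (thresholdProgram q c) 40 (fun s' => RoundingConstants n m Y S t s' ∧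
      s'.nr .o = s.nr .o + 1 ∧ s'.nr .i = s.nr .i ∧ s'.out = s.out ∧ s'.drawn = s.drawn ∧
      (∀ r, r ≠ .b → r ≠ .c → r ≠ q → s'.rr r = s.rr r) ∧
      s'.rr q = s.rr c + candidate Y S t (s.nr .o + 1) / 2) s := by
  have hc0 := h.signed.consts
  refine (Halts.seq_of (T := 10) (T' := 30) (P := fun s1 => RoundingConstants n m Y S t s1 ∧
    s1.nr .o = s.nr .o + 1 ∧ s1.nr .x = s.nr .o + 1 ∧ s1.nr .i = s.nr .i ∧ s1.out = s.out ∧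
    s1.drawn = s.drawn ∧ s1.rr = s.rr) ?_ ?_).mono (by omega) fun _ h => h
  · apply Halts.of_block_le _ (by simp [MemOp.time])
    refine ⟨h.frame ?_ ?_ ?_, ?_, ?_, ?_, ?_, ?_, ?_⟩
    · intro r hr; simp at hr; rcases hr with rfl | rfl | rfl | rfl | rfl | rfl <;>
        simp [MemOp.exec]
    all_goals simp [MemOp.exec, hc0.nr_one, hc0.nr_zero]
  rintro s1 ⟨h1, ho, hx, hi, hout, hdr, hrr⟩
  refine (Halts.seq_of (T := 20) (T' := 10) (P := fun s2 => RoundingConstants n m Y S t s2 ∧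
    s2.nr .o = s.nr .o + 1 ∧ s2.nr .i = s.nr .i ∧ s2.out = s.out ∧ s2.drawn = s.drawn ∧
    (∀ r, r ≠ .b → r ≠ .c → s2.rr r = s.rr r) ∧
    s2.rr .b = candidate Y S t (s.nr .o + 1)) ?_ ?_).mono (by omega) fun _ h => h
  · refine (halts_valueProgram h1.signed (tt := .bt) (by simp) (by simp)).mono le_rfl ?_
    rintro s2 ⟨-, g0, g1, g2, g3, g4, g5⟩
    refine ⟨h1.frame (fun r _ => by rw [g1]) ?_ g0, by rw [g1, ho], by rw [g1, hi],
      by rw [g3, hout], by rw [g4, hdr], ?_, ?_⟩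
    · intro r hr; simp at hr; exact g2 r hr.2.1 hr.2.2.1
    · intro r h1 h2; rw [g2 r h1 h2, hrr]
    · rw [g5, h1.rr_bt, hx]
  rintro s2 ⟨h2, ho2, hi2, hout2, hdr2, hrr2, hb2⟩
  have hqb : q ≠ .b ∧ q ≠ .a ∧ q ≠ .c ∧ q ≠ .two := by
    simp at hq; rcases hq with rfl | rfl | rfl <;> simp
  apply Halts.of_block_le _ (by simp [MemOp.time])
  refine ⟨h2.frame ?_ ?_ ?_, ?_, ?_, ?_, ?_, ?_, ?_⟩
  · intro r hr; simp [MemOp.exec]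
  · intro r hr
    simp at hr hq
    have : r ≠ q := by rintro rfl; tauto
    simp [MemOp.exec, this, hr]
  · simp [MemOp.exec]
  · simp [MemOp.exec, ho2]
  · simp [MemOp.exec, hi2]
  · simp [MemOp.exec, hout2]
  · simp [MemOp.exec, hdr2]
  · intro r h1 h3 h4; simp [MemOp.exec, h1, h4, hrr2 r h1 h3]
  · simp [MemOp.exec, hc, hb2, hrr2 c hc.1 hc.2, h2.signed.consts.rr_two]

theorem halts_chooseProgram {inp : Input} {ω : Tape} {n m : ℕ} {Y S : ℕ → ℝ} {t : ℝ}
    {s : Memory} {q : Pauli → ℝ} {x : ℝ} (h : RoundingConstants n m Y S t s)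
    (hX : s.rr .mX = 1 / 6 + q .X / 2) (hY : s.rr .mY = 1 / 2 + q .Y / 2)
    (hZ : s.rr .mZ = 5 / 6 + q .Z / 2) (hr : s.rr .r = x) :
    Halts inp ω chooseProgram 20 (fun s' => RoundingConstants n m Y S t s' ∧
      s'.nr = s.nr ∧ s'.out = s.out ∧ s'.drawn = s.drawn ∧
      s'.rr .a = (roundedAmplitudes q x).1 ∧ s'.rr .b = (roundedAmplitudes q x).2.1 ∧
      s'.rr .c = (roundedAmplitudes q x).2.2) s := by
  have h0 := h.signed.consts.rr_zero
  have hh := h.rr_h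
  have ht : ∀ a b, (RegTest.rlt a b).holds s ↔ s.rr a < s.rr b := fun a b => Iff.rfl
  -- All six branches only set the three amplitude registers, so one argument serves every leaf of
  -- the decision tree.
  have leaf : ∀ (ops : List MemOp) (T : ℕ) (u v w : ℝ), (ops.map MemOp.time).sum + 1 ≤ T →
      execs inp ω ops s = { s with
        rr := Function.update (Function.update (Function.update s.rr .a u) .b v) .c w } →
      roundedAmplitudes q x = (u, v, w) →
      Halts inp ω (block ops) T (fun s' => RoundingConstants n m Y S t s' ∧
        s'.nr = s.nr ∧ s'.out = s.out ∧ s'.drawn = s.drawn ∧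
        s'.rr .a = (roundedAmplitudes q x).1 ∧ s'.rr .b = (roundedAmplitudes q x).2.1 ∧
        s'.rr .c = (roundedAmplitudes q x).2.2) s := by
    intro ops T u v w hT he hq
    apply Halts.of_block_le _ hT
    rw [he, hq]
    refine ⟨h.frame (fun _ _ => rfl) (fun r hr => ?_) rfl, rfl, rfl, rfl, ?_, ?_, ?_⟩
    · simp at hr
      simp [hr]
    all_goals simp
  unfold chooseProgram
  refine (Halts.ite (T := 19) (fun c1 => ?_) fun c1 => ?_) <;> rw [ht, hr, hX] at c1
  · exact leaf _ _ (1 / Real.sqrt 2) (1 / Real.sqrt 2) 0 (by simp [MemOp.time])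
      (by simp [MemOp.exec, h0, hh]) (by rw [roundedAmplitudes, if_pos c1])
  refine (Halts.ite (T := 18) (fun c2 => ?_) fun c2 => ?_) <;> rw [ht, hr, h.rr_third] at c2
  · exact leaf _ _ (1 / Real.sqrt 2) (-(1 / Real.sqrt 2)) 0 (by simp [MemOp.time])
      (by simp [MemOp.exec, h0, hh]) (by rw [roundedAmplitudes, if_neg c1, if_pos c2])
  refine (Halts.ite (T := 17) (fun c3 => ?_) fun c3 => ?_) <;> rw [ht, hr, hY] at c3
  · exact leaf _ _ (1 / Real.sqrt 2) 0 (1 / Real.sqrt 2) (by simp [MemOp.time])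
      (by simp [MemOp.exec, h0, hh]) (by rw [roundedAmplitudes, if_neg c1, if_neg c2, if_pos c3])
  refine (Halts.ite (T := 16) (fun c4 => ?_) fun c4 => ?_) <;> rw [ht, hr, h.rr_twoThirds] at c4
  · exact leaf _ _ (1 / Real.sqrt 2) 0 (-(1 / Real.sqrt 2)) (by simp [MemOp.time])
      (by simp [MemOp.exec, h0, hh])
      (by rw [roundedAmplitudes, if_neg c1, if_neg c2, if_neg c3, if_pos c4])
  refine (Halts.ite (T := 15) (fun c5 => ?_) fun c5 => ?_) <;> rw [ht, hr, hZ] at c5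
  · exact leaf _ _ 1 0 0 (by simp [MemOp.time]) (by simp [MemOp.exec])
      (by rw [roundedAmplitudes, if_neg c1, if_neg c2, if_neg c3, if_neg c4, if_pos c5])
  · exact leaf _ _ 0 1 0 (by simp [MemOp.time]) (by simp [MemOp.exec])
      (by rw [roundedAmplitudes, if_neg c1, if_neg c2, if_neg c3, if_neg c4, if_neg c5])

/-- The memory when the first `i` qubits have been rounded. -/
structure Rounding (n m : ℕ) (Y S : ℕ → ℝ) (t : ℝ) (ω : Tape) (i : ℕ) (s : Memory) : Prop where
  consts : RoundingConstants n m Y S t s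
  nr_i : s.nr .i = i
  nr_o : s.nr .o = 4 * i
  drawn : s.drawn = i
  out : ∀ j < i, s.out (4 * j) = (roundedAmplitudes (candidateBloch Y S t j) (ω j)).1 ∧
    s.out (4 * j + 1) = 0 ∧
    s.out (4 * j + 2) = (roundedAmplitudes (candidateBloch Y S t j) (ω j)).2.1 ∧
    s.out (4 * j + 3) = (roundedAmplitudes (candidateBloch Y S t j) (ω j)).2.2

theorem Rounding.halts_step {inp : Input} {ω : Tape} {n m : ℕ} {Y S : ℕ → ℝ} {t : ℝ} {i : ℕ}
    {s : Memory} (h : Rounding n m Y S t ω i s) :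
    Halts inp ω (.seq (thresholdProgram .mX .cX) <| .seq (thresholdProgram .mY .cY) <|
    .seq (thresholdProgram .mZ .cZ) <| .seq (block [.rrandom .r]) <| .seq chooseProgram <|
    block [.sub .o .o .two, .sub .o .o .one, .rwrite .o .a, .add .o .o .one, .rwrite .o .zero,
      .add .o .o .one, .rwrite .o .b, .add .o .o .one, .rwrite .o .c, .add .o .o .one,
      .add .i .i .one]) 200 (Rounding n m Y S t ω (i + 1)) s := by
  refine (Halts.seq_of (T := 40) (T' := 160) (halts_thresholdProgram h.consts (by simp)
    (by simp)) ?_).mono (by omega) fun _ h => h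
  rintro s1 ⟨h1, ho1, hi1, hout1, hdr1, hrr1, hX1⟩
  refine (Halts.seq_of (T := 40) (T' := 120) (halts_thresholdProgram h1 (by simp)
    (by simp)) ?_).mono (by omega) fun _ h => h
  rintro s2 ⟨h2, ho2, hi2, hout2, hdr2, hrr2, hY2⟩
  refine (Halts.seq_of (T := 40) (T' := 80) (halts_thresholdProgram h2 (by simp)
    (by simp)) ?_).mono (by omega) fun _ h => h
  rintro s3 ⟨h3, ho3, hi3, hout3, hdr3, hrr3, hZ3⟩
  have hX3 : s3.rr .mX = 1 / 6 + candidateBloch Y S t i .X / 2 := by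
    rw [hrr3 _ (by simp) (by simp) (by simp), hrr2 _ (by simp) (by simp) (by simp), hX1,
      h.nr_o, h.consts.rr_cX]
    rfl
  have hY3 : s3.rr .mY = 1 / 2 + candidateBloch Y S t i .Y / 2 := by
    rw [hrr3 _ (by simp) (by simp) (by simp), hY2, ho1, h.nr_o, h1.rr_cY]
    rfl
  have hZ3 : s3.rr .mZ = 5 / 6 + candidateBloch Y S t i .Z / 2 := by
    rw [hZ3, ho2, ho1, h.nr_o, h2.rr_cZ]
    rfl
  have hd3 : s3.drawn = i := by rw [hdr3, hdr2, hdr1, h.drawn]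
  refine (Halts.seq_of (T := 10) (T' := 70) (P := fun s4 => RoundingConstants n m Y S t s4 ∧
    s4.nr = s3.nr ∧ s4.out = s3.out ∧ s4.drawn = i + 1 ∧ s4.rr .r = (ω i : ℝ) ∧
    s4.rr .mX = s3.rr .mX ∧ s4.rr .mY = s3.rr .mY ∧ s4.rr .mZ = s3.rr .mZ) ?_ ?_).mono
    (by omega) fun _ h => h
  · apply Halts.of_block_le _ (by simp [MemOp.time])
    refine ⟨h3.frame ?_ ?_ ?_, ?_, ?_, ?_, ?_, ?_, ?_, ?_⟩
    · intro r hr; simp [MemOp.exec]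
    · intro r hr; simp at hr; simp [MemOp.exec, hr]
    all_goals simp [MemOp.exec, hd3]
  rintro s4 ⟨h4, hnr4, hout4, hdr4, hr4, hX4, hY4, hZ4⟩
  refine (Halts.seq_of (T := 20) (T' := 50) (halts_chooseProgram h4 (hX4.trans hX3)
    (hY4.trans hY3) (hZ4.trans hZ3) hr4) ?_).mono (by omega) fun _ h => h
  rintro s5 ⟨h5, hnr5, hout5, hdr5, ha, hb, hc⟩
  have hc5 := h5.signed.consts
  -- The counter `o` passed through the codes 1, 2, 3 of `X`, `Y`, `Z`. The final block moves it
  -- back to `4 i`, writes four cells and leaves it at `4 (i + 1)`.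
  have ho5 : s5.nr .o = 4 * i + 3 := by rw [hnr5, hnr4, ho3, ho2, ho1, h.nr_o]
  have hi5 : s5.nr .i = i := by rw [hnr5, hnr4, hi3, hi2, hi1, h.nr_i]
  have hout : s5.out = s.out := by rw [hout5, hout4, hout3, hout2, hout1]
  apply Halts.of_block_le _ (by simp [MemOp.time])
  refine ⟨h5.frame ?_ ?_ ?_, ?_, ?_, ?_, ?_⟩
  · intro r hr; simp at hr; rcases hr with rfl | rfl | rfl | rfl | rfl | rfl <;>
      simp [MemOp.exec]
  · intro r hr; simp [MemOp.exec]
  · simp [MemOp.exec]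
  · simp [MemOp.exec, hi5, hc5.nr_one]
  · simp [MemOp.exec, ho5, hc5.nr_one, hc5.nr_two]; omega
  · simp [MemOp.exec, hdr5, hdr4]
  · intro j hj
    have e0 : (execs inp ω [.sub .o .o .two, .sub .o .o .one, .rwrite .o .a, .add .o .o .one,
        .rwrite .o .zero, .add .o .o .one, .rwrite .o .b, .add .o .o .one, .rwrite .o .c,
        .add .o .o .one, .add .i .i .one] s5).out = Function.update (Function.update
        (Function.update (Function.update s.out (4 * i) (s5.rr .a)) (4 * i + 1) (s5.rr .zero))
        (4 * i + 2) (s5.rr .b)) (4 * i + 3) (s5.rr .c) := by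
      simp [MemOp.exec, ho5, hc5.nr_one, hc5.nr_two, hout]
    rw [e0]
    rcases Nat.lt_succ_iff_lt_or_eq.1 hj with hj | rfl
    · obtain ⟨g1, g2, g3, g4⟩ := h.out j hj
      rw [← g1, ← g3, ← g4, ← g2]
      refine ⟨?_, ?_, ?_, ?_⟩ <;> repeat rw [Function.update_of_ne (by omega)]
    · simp [hc5.rr_zero, ha, hb, hc]

theorem halts_roundingProgram {inp : Input} {ω : Tape} {n m : ℕ} {Y S : ℕ → ℝ} {t : ℝ}
    {s : Memory} (h : Signed n m Y S s) (ht : s.rr .bt = t) (hd : s.drawn = 0) :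
    Halts inp ω roundingProgram (n * 201 + 21) (Rounding n m Y S t ω n) s := by
  have hc := h.consts
  refine (Halts.seq_of (T := 20) (T' := n * 201 + 1) (P := Rounding n m Y S t ω 0) ?_ ?_).mono
    (by omega) fun _ h => h
  · apply Halts.of_block_le _ (by simp [MemOp.time])
    refine ⟨⟨h.frame ?_ ?_ ?_, ?_, ?_, ?_, ?_, ?_, ?_, ?_⟩, ?_, ?_, ?_, ?_⟩
    · intro r hr; simp at hr; rcases hr with rfl | rfl | rfl | rfl | rfl | rfl <;>
        simp [MemOp.exec]
    · intro r hr; simp at hr; rcases hr with rfl | rfl | rfl | rfl | rfl <;> simp [MemOp.exec]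
    all_goals first
      | (intro j hj; omega)
      | simp [MemOp.exec, hc.rr_one, hc.rr_two, hc.rr_five, hc.rr_six, ht, hd] <;> norm_num
  · intro s1 h1
    refine (Halts.while (Rounding n m Y S t ω) n (fun _ => 200) ?_ ?_ h1).mono (by simp)
      fun _ h => h
    · intro i hi s hs
      refine ⟨?_, hs.halts_step⟩
      change s.nr .i < s.nr .n
      rw [hs.nr_i, hs.consts.signed.consts.nr_n]; exact hi
    · intro s hs
      change ¬ s.nr .i < s.nr .n
      rw [hs.nr_i, hs.consts.signed.consts.nr_n]; exact lt_irrefl _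

/-! ### The input describing a Hamiltonian -/

/-- The list of the variables of a Pauli string; the variable `4 i + c` is the Pauli matrix with
code `c` on qubit `i`. -/
def variableList {n : ℕ} (P : PauliString n) : List ℕ :=
  ((List.finRange n).filter fun i => P i ≠ Pauli.I).map fun i : Fin n => 4 * i.val + (P i).code

theorem Pauli.code_lt (p : Pauli) : p.code < 4 := by cases p <;> simp [Pauli.code]

theorem Pauli.code_injective : Function.Injective Pauli.code := by
  intro p q; cases p <;> cases q <;> simp [Pauli.code]

theorem mem_variableList {n : ℕ} {P : PauliString n} {x : ℕ} :
    x ∈ variableList P ↔ ∃ i : Fin n, P i ≠ .I ∧ 4 * i.val + (P i).code = x := by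
  simp [variableList]

/-- Codes are smaller than 4, so a variable determines its qubit and its Pauli matrix; this makes
the encoding of strings injective. -/
theorem mem_variableList_code {n : ℕ} {P : PauliString n} {i : Fin n} {p : Pauli} :
    4 * i.val + p.code ∈ variableList P ↔ P i = p ∧ p ≠ .I := by
  rw [mem_variableList]
  constructor
  · rintro ⟨j, hj, h⟩
    have h1 := p.code_lt
    have h2 := (P j).code_lt
    have hij : j = i := Fin.ext (by omega)
    subst hij
    have : P j = p := Pauli.code_injective (by omega)
    exact ⟨this, this ▸ hj⟩
  · rintro ⟨rfl, h⟩
    exact ⟨i, h, rfl⟩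

theorem variableList_injective {n : ℕ} : Function.Injective (variableList (n := n)) := by
  have key : ∀ P Q : PauliString n, variableList P = variableList Q → ∀ i, P i ≠ .I → Q i = P i := by
    intro P Q h i hi
    have : 4 * i.val + (P i).code ∈ variableList P := mem_variableList_code.2 ⟨rfl, hi⟩
    rw [h, mem_variableList_code] at this
    exact this.1
  intro P Q h
  funext i
  by_cases hP : P i = .I
  · by_cases hQ : Q i = .I
    · rw [hP, hQ]
    · exact key Q P h.symm i hQ
  · exact (key P Q h i hP).symm

theorem length_variableList {n : ℕ} (P : PauliString n) : (variableList P).length = weight P := by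
  rw [variableList, List.length_map, weight, ← List.toFinset_card_of_nodup]
  · congr 1
    ext i
    simp
  · exact (List.nodup_finRange n).filter _

theorem sorted_variableList {n : ℕ} (P : PauliString n) : (variableList P).Pairwise (· < ·) := by
  rw [variableList, List.pairwise_map]
  refine ((List.pairwise_lt_finRange n).filter _).imp ?_
  intro i j hij
  have h1 := (P i).code_lt
  have h2 : i.val < j.val := hij
  omega

theorem lt_of_mem_variableList {n : ℕ} {P : PauliString n} {x : ℕ} (h : x ∈ variableList P) :
    x < 4 * n := by
  obtain ⟨i, -, rfl⟩ := mem_variableList.1 h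
  have := (P i).code_lt
  have := i.isLt
  omega

theorem prod_variableList {n : ℕ} (P : PauliString n) (f : ℕ → ℝ) :
    ((variableList P).map f).prod = ∏ i, if P i = .I then 1 else f (4 * i.val + (P i).code) := by
  rw [variableList, List.map_map, ← List.prod_toFinset _ ((List.nodup_finRange n).filter _)]
  rw [Finset.prod_congr (s₂ := Finset.univ.filter fun i => ¬ P i = .I) (by ext i; simp)
    fun _ _ => rfl, Finset.prod_filter]
  apply Finset.prod_congr rfl
  intro i _
  by_cases h : P i = .I <;> simp [h]

theorem getD_flatMap_pair {β : Type*} (f g : β → ℕ) (l : List β) (j : ℕ) (hj : j < l.length) :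
    (l.flatMap fun i => [f i, g i]).getD (2 * j) 0 = f l[j] ∧
      (l.flatMap fun i => [f i, g i]).getD (2 * j + 1) 0 = g l[j] := by
  induction l generalizing j with
  | nil => simp at hj
  | cons b l ih =>
    cases j with
    | zero => simp
    | succ j =>
      have := ih j (by simpa using hj)
      simpa [mul_add] using this

theorem length_flatMap_pair {β : Type*} (f g : β → ℕ) (l : List β) :
    (l.flatMap fun i => [f i, g i]).length = 2 * l.length := by
  induction l with
  | nil => rfl
  | cons b l ih => simp [ih]; ring

theorem length_encodePauli {n : ℕ} (P : PauliString n) :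
    (encodePauli P).length = (variableList P).length + (variableList P).length + 1 := by
  rw [encodePauli, List.length_cons, length_flatMap_pair, variableList, List.length_map]; ring

theorem getD_encodePauli_zero {n : ℕ} (P : PauliString n) :
    (encodePauli P).getD 0 0 = (variableList P).length := by
  rw [length_variableList]; simp [encodePauli]

theorem getD_encodePauli {n : ℕ} (P : PauliString n) {j : ℕ} (hj : j < (variableList P).length) :
    4 * (encodePauli P).getD (1 + 2 * j) 0 + (encodePauli P).getD (1 + 2 * j + 1) 0 =
      (variableList P).getD j 0 := by
  have hj' : j < ((List.finRange n).filter fun i => P i ≠ Pauli.I).length := by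
    simpa [variableList] using hj
  obtain ⟨h1, h2⟩ := getD_flatMap_pair (fun i : Fin n => i.val) (fun i => (P i).code) _ j hj'
  rw [encodePauli, add_comm 1, List.getD_cons_succ, List.getD_cons_succ, h1, h2,
    List.getD_eq_getElem _ _ hj]
  simp [variableList]

theorem getD_flatMap_encodePauli {n : ℕ} (L : List (PauliString n)) {t j : ℕ} (ht : t < L.length)
    (hj : j < (encodePauli L[t]).length) :
    (L.flatMap encodePauli).getD (((L.take t).flatMap encodePauli).length + j) 0 =
      (encodePauli L[t]).getD j 0 := by
  have h : L.flatMap encodePauli =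
      (L.take t).flatMap encodePauli ++ (L.drop t).flatMap encodePauli := by
    rw [← List.flatMap_append, List.take_append_drop]
  rw [h, List.getD_append_right _ _ _ _ (by omega), Nat.add_sub_cancel_left,
    List.drop_eq_getElem_cons ht, List.flatMap_cons, List.getD_append _ _ _ _ hj]

/-- Term `t` of a list of Pauli strings. -/
def term {n : ℕ} (L : List (PauliString n)) (t : ℕ) : PauliString n :=
  L.getD t (identityString n)

theorem term_eq {n : ℕ} {L : List (PauliString n)} {t : ℕ} (ht : t < L.length) :
    term L t = L[t] := by
  rw [term, List.getD_eq_getElem _ _ ht]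

/-- The bridge from Pauli strings to lists of numbers, which are all that the analysis of the
program uses. The offset 2 skips the header consisting of the numbers of qubits and of terms. -/
theorem readsTerms_encodeHamiltonian {n k : ℕ} {α : PauliString n → ℝ} (hα : IsLocal k α)
    {L : List (PauliString n)} (hL : ListsTerms α L) :
    ReadsTerms k n L.length (fun t => variableList (term L t)) (fun t => α (term L t))
      (fun t => 2 + ((L.take t).flatMap encodePauli).length) (encodeHamiltonian α L) := by
  have hget : ∀ (t : ℕ) (ht : t < L.length) (j : ℕ), j < (encodePauli (term L t)).length →
      (encodeHamiltonian α L).nats.getD (2 + ((L.take t).flatMap encodePauli).length + j) 0 =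
        (encodePauli (term L t)).getD j 0 := by
    intro t ht j hj
    rw [term_eq ht] at hj ⊢
    rw [← getD_flatMap_encodePauli L ht hj, encodeHamiltonian]
    have : 2 + ((L.take t).flatMap encodePauli).length + j =
        ((L.take t).flatMap encodePauli).length + j + 1 + 1 := by ring
    rw [this, List.getD_cons_succ, List.getD_cons_succ]
  constructor
  · simp [encodeHamiltonian]
  · simp [encodeHamiltonian]
  · simp
  · intro t ht
    rw [List.take_succ_eq_append_getElem ht, List.flatMap_append, List.length_append, term_eq ht]
    simp [length_encodePauli]
    ring
  · intro t ht
    rw [← getD_encodePauli_zero]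
    exact hget t ht 0 (by rw [length_encodePauli]; omega)
  · intro t ht j hj
    rw [← getD_encodePauli _ hj]
    have hl := length_encodePauli (term L t)
    rw [← hget t ht _ (by omega), ← hget t ht _ (by omega)]
    simp only [add_assoc]
  · intro t ht
    simp [encodeHamiltonian, term, ht]
  · intro t _ x hx
    exact lt_of_mem_variableList hx
  · intro t _
    exact sorted_variableList _
  · intro t ht
    rw [length_variableList]
    apply hα
    rw [term_eq ht]
    exact (hL.2 _).1 (List.getElem_mem ht)
  · intro t ht t' ht' h
    have := variableList_injective h
    rw [term_eq ht, term_eq ht'] at this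
    exact hL.1.getElem_inj_iff.1 this

theorem sum_terms {n : ℕ} {α : PauliString n → ℝ} {L : List (PauliString n)} (hL : ListsTerms α L)
    {f : PauliString n → ℝ} (hf : ∀ P, α P = 0 → f P = 0) :
    ∑ t ∈ Finset.range L.length, f (term L t) = ∑ P, f P := by
  have h1 : ∑ P ∈ L.toFinset, f P = ∑ P, f P := by
    apply Finset.sum_subset (Finset.subset_univ _)
    intro P _ hP
    apply hf
    by_contra h
    exact hP (List.mem_toFinset.2 ((hL.2 P).2 h))
  rw [← h1, List.sum_toFinset _ hL.1, Finset.sum_range, ← Fin.sum_univ_fun_getElem]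
  apply Finset.sum_congr rfl
  intro t _
  rw [term_eq t.2]

theorem card_terms_with_variable_le {n k d : ℕ} {α : PauliString n → ℝ}
    (h : HasDegreeAtMost k d (hamiltonian α)) {L : List (PauliString n)} (hL : ListsTerms α L)
    (v : ℕ) : ({t ∈ Finset.range L.length | v ∈ variableList (term L t)} : Finset ℕ).card ≤
      d * 4 ^ k := by
  -- The variable `v` belongs to the qubit `v / 4`; beyond the last qubit there are no terms to
  -- count.
  by_cases hv : v / 4 < n
  · refine le_trans ?_ (card_terms_at_le h ⟨v / 4, hv⟩)
    apply Finset.card_le_card_of_injOn (term L)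
    · intro t ht
      simp only [Finset.coe_filter, Finset.mem_range, Set.mem_ofPred_eq, Finset.mem_univ,
        true_and] at ht ⊢
      refine ⟨(hL.2 _).1 (by rw [term_eq ht.1]; exact List.getElem_mem _), ?_⟩
      obtain ⟨i, hi, hiv⟩ := mem_variableList.1 ht.2
      have := (term L t i).code_lt
      have e : i = ⟨v / 4, hv⟩ := Fin.ext (by simp only; omega)
      rw [← e]; exact hi
    · intro t ht t' ht' e
      simp only [Finset.coe_filter, Finset.mem_range, Set.mem_ofPred_eq] at ht ht'
      rw [term_eq ht.1, term_eq ht'.1] at e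
      exact hL.1.getElem_inj_iff.1 e
  · rw [Finset.card_eq_zero.2]
    · exact Nat.zero_le _
    · rw [Finset.filter_eq_empty_iff]
      intro t _ hvt
      have := lt_of_mem_variableList hvt
      omega

theorem length_le_of_listsTerms {n k d : ℕ} {α : PauliString n → ℝ}
    (h : HasDegreeAtMost k d (hamiltonian α)) {L : List (PauliString n)} (hL : ListsTerms α L) :
    L.length ≤ n * (d * 4 ^ k) + 1 := by
  refine le_trans (le_of_eq ?_) (card_terms_le h)
  rw [← List.toFinset_card_of_nodup hL.1]
  congr 1
  ext P
  simp [hL.2]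

/-! ### The quality of the best candidate -/

/-- `doneSum` counts positions rather than terms; without repetitions a term has at most one
position holding `v`. -/
theorem doneSum_zero_right (l : ℕ → List ℕ) (F : ℕ → ℝ) (v m : ℕ) (hl : ∀ t < m, (l t).Nodup) :
    doneSum l F v m 0 = ∑ t ∈ Finset.range m with v ∈ l t, F t := by
  rw [doneSum, Finset.sum_range_zero, add_zero, Finset.sum_filter]
  apply Finset.sum_congr rfl
  intro t ht
  have hnd := hl t (Finset.mem_range.1 ht)
  by_cases hv : v ∈ l t
  · obtain ⟨i, hi, rfl⟩ := List.getElem_of_mem hv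
    rw [if_pos hv, Finset.sum_eq_single i]
    · simp [hi]
    · intro j hj hji
      rw [Finset.mem_range] at hj
      rw [List.getD_eq_getElem _ _ hj, if_neg fun h => hji (hnd.getElem_inj_iff.1 h)]
    · intro h; exact absurd (Finset.mem_range.2 hi) h
  · rw [if_neg hv]
    apply Finset.sum_eq_zero
    intro j hj
    rw [Finset.mem_range] at hj
    rw [List.getD_eq_getElem _ _ hj, if_neg]
    rintro rfl
    exact hv (List.getElem_mem hj)

theorem sum_mul_doneSum {l : ℕ → List ℕ} {m M : ℕ} (hl : ∀ t < m, (l t).Nodup)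
    (hM : ∀ t < m, ∀ x ∈ l t, x < M) (F g : ℕ → ℝ) :
    ∑ v ∈ Finset.range M, g v * doneSum l F v m 0 =
      ∑ t ∈ Finset.range m, F t * ((l t).map g).sum := by
  simp only [doneSum_zero_right l F _ m hl, Finset.sum_filter, Finset.mul_sum]
  rw [Finset.sum_comm]
  apply Finset.sum_congr rfl
  intro t ht
  rw [Finset.mem_range] at ht
  rw [← List.sum_toFinset _ (hl t ht), Finset.mul_sum]
  rw [← Finset.sum_subset (s₁ := (l t).toFinset) (s₂ := Finset.range M)]
  · apply Finset.sum_congr rfl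
    intro v hv
    rw [if_pos (List.mem_toFinset.1 hv), mul_comm]
  · intro v hv
    exact Finset.mem_range.2 (hM t ht v (List.mem_toFinset.1 hv))
  · intro v _ hv
    rw [if_neg fun h => hv (List.mem_toFinset.2 h), mul_zero]

/-- Each nonconstant term is counted by at least one of its variables. For a fixed variable,
Cauchy-Schwarz over its at most `D` terms turns the sum of absolute values into `√D` times the root
of the sum of squares. The factor `6 ^ k` undoes the scaling of the coefficients. -/
theorem sum_abs_le_sum_sqrt {l : ℕ → List ℕ} {m M D k : ℕ} (hl : ∀ t < m, (l t).Nodup)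
    (hM : ∀ t < m, ∀ x ∈ l t, x < M) (hk : ∀ t < m, (l t).length ≤ k)
    (hD : ∀ v, ({t ∈ Finset.range m | v ∈ l t} : Finset ℕ).card ≤ D) (a : ℕ → ℝ) :
    ∑ t ∈ Finset.range m, (if 0 < (l t).length then |a t| else 0) ≤
      6 ^ k * Real.sqrt D * ∑ v ∈ Finset.range M,
        Real.sqrt (doneSum l (fun t => (a t / 6 ^ (l t).length) ^ 2) v m 0) := by
  have h1 : ∀ v, doneSum l (fun t => |a t / 6 ^ (l t).length|) v m 0 ≤
      Real.sqrt D * Real.sqrt (doneSum l (fun t => (a t / 6 ^ (l t).length) ^ 2) v m 0) := by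
    intro v
    rw [doneSum_zero_right _ _ _ _ hl, doneSum_zero_right _ _ _ _ hl,
      ← Real.sqrt_mul (Nat.cast_nonneg _)]
    apply Real.le_sqrt_of_sq_le
    refine sq_sum_le_card_mul_sum_sq.trans ?_
    simp only [sq_abs]
    exact mul_le_mul_of_nonneg_right (Nat.cast_le.2 (hD v))
      (Finset.sum_nonneg fun _ _ => sq_nonneg _)
  have h2 := sum_mul_doneSum hl hM (fun t => |a t / 6 ^ (l t).length|) fun _ => 1
  simp only [one_mul] at h2
  calc _ ≤ 6 ^ k * ∑ t ∈ Finset.range m,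
        |a t / 6 ^ (l t).length| * ((l t).map fun _ => (1 : ℝ)).sum := by
        rw [Finset.mul_sum]
        apply Finset.sum_le_sum
        intro t ht
        have hkt := hk t (Finset.mem_range.1 ht)
        have h6 : (6 : ℝ) ^ (l t).length ≤ 6 ^ k := pow_le_pow_right₀ (by norm_num) hkt
        have hs : ((l t).map fun _ => (1 : ℝ)).sum = (l t).length := by simp
        rw [hs]
        split_ifs with hpos
        · have h3 : (1 : ℝ) ≤ (l t).length := by exact_mod_cast hpos
          have hp : (0 : ℝ) < 6 ^ (l t).length := by positivity
          rw [abs_div, abs_of_pos hp]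
          calc |a t| = 6 ^ (l t).length * (|a t| / 6 ^ (l t).length * 1) := by field_simp
            _ ≤ 6 ^ k * (|a t| / 6 ^ (l t).length * (l t).length) := by gcongr
        · positivity
    _ = 6 ^ k * ∑ v ∈ Finset.range M, doneSum l (fun t => |a t / 6 ^ (l t).length|) v m 0 := by
        rw [h2]
    _ ≤ 6 ^ k * ∑ v ∈ Finset.range M, Real.sqrt D *
        Real.sqrt (doneSum l (fun t => (a t / 6 ^ (l t).length) ^ 2) v m 0) := by
        gcongr with v _
        exact h1 v
    _ = _ := by rw [← Finset.mul_sum, mul_assoc]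

open Polynomial in
theorem list_prod_polynomial (c s : ℕ → ℝ) (l : List ℕ) :
    ((l.map fun x => C (c x) * (1 + C (s x) * X)).prod).natDegree ≤ l.length ∧
    ((l.map fun x => C (c x) * (1 + C (s x) * X)).prod).eval 0 = (l.map c).prod ∧
    ((l.map fun x => C (c x) * (1 + C (s x) * X)).prod).derivative.eval 0 =
      (l.map c).prod * (l.map s).sum := by
  induction l with
  | nil => simp
  | cons x l ih =>
    obtain ⟨h1, h2, h3⟩ := ih
    simp only [List.map_cons, List.prod_cons, List.length_cons, List.sum_cons]
    refine ⟨?_, ?_, ?_⟩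
    · refine natDegree_mul_le.trans ?_
      have : (C (c x) * (1 + C (s x) * X)).natDegree ≤ 1 := by compute_degree
      omega
    · rw [eval_mul, h2]; simp
    · rw [derivative_mul, eval_add, eval_mul, eval_mul, h2, h3]; simp; ring

-- Along `Y x (1 + g x z) / 6` the derivative of a monomial at `z = 0` is its value there times the
-- sum of the `g x` over its variables. Exchanging the sums gives `∑ g v * S v`, which is `∑ |S v|`
-- by the choice of `g`.
open Polynomial in
theorem exists_candidate_bound {k : ℕ} {c : ℝ}
    (hc : ∀ p : ℝ[X], p.natDegree ≤ k →
      ∃ j ≤ k, c * |p.derivative.eval 0| ≤ |p.eval (1 / ((j : ℝ) + 1))|)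
    {m M : ℕ} {l : ℕ → List ℕ} (hl : ∀ t < m, (l t).Nodup)
    (hM : ∀ t < m, ∀ x ∈ l t, x < M) (hk : ∀ t < m, (l t).length ≤ k) {a Y S : ℕ → ℝ}
    (hS : ∀ v < M, S v = doneSum l (fun t => a t / 6 ^ (l t).length * ((l t).map Y).prod) v m 0) :
    ∃ j ≤ k, c * ∑ v ∈ Finset.range M, |S v| ≤
      |candidateValue m l a Y S (1 / ((j : ℝ) + 1))| := by
  let g : ℕ → ℝ := fun x => if S x < 0 then -1 else 1
  let p : ℝ[X] := ∑ t ∈ Finset.range m, if 0 < (l t).length then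
    C (a t) * ((l t).map fun x => C (Y x / 6) * (1 + C (g x) * X)).prod else 0
  have hdeg : p.natDegree ≤ k := by
    apply natDegree_sum_le_of_forall_le
    intro t ht
    split_ifs
    · exact (natDegree_C_mul_le _ _).trans
        ((list_prod_polynomial _ g _).1.trans (hk t (Finset.mem_range.1 ht)))
    · simp
  have heval : ∀ z, p.eval z = candidateValue m l a Y S z := by
    intro z
    simp only [p, eval_finsetSum, candidateValue]
    apply Finset.sum_congr rfl
    intro t _
    split_ifs
    · rw [eval_mul, eval_C, eval_list_prod, List.map_map]
      congr 2
      apply List.map_congr_left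
      intro x _
      simp only [Function.comp_apply, eval_mul, eval_add, eval_C, eval_X, eval_one, candidate, g]
      split_ifs <;> ring
    · simp
  have hder : p.derivative.eval 0 = ∑ v ∈ Finset.range M, |S v| := by
    have h1 : ∀ v ∈ Finset.range M, |S v| = g v *
        doneSum l (fun t => a t / 6 ^ (l t).length * ((l t).map Y).prod) v m 0 := by
      intro v hv
      rw [← hS v (Finset.mem_range.1 hv)]
      simp only [g]
      split_ifs with h
      · rw [abs_of_neg h]; ring
      · rw [abs_of_nonneg (not_lt.1 h)]; ring
    rw [Finset.sum_congr rfl h1, sum_mul_doneSum hl hM]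
    simp only [p, derivative_sum, eval_finsetSum]
    apply Finset.sum_congr rfl
    intro t _
    have hprod : ((l t).map fun x => Y x / 6).prod = ((l t).map Y).prod / 6 ^ (l t).length := by
      generalize l t = L
      induction L with
      | nil => simp
      | cons x L ih => simp only [List.map_cons, List.prod_cons, ih, List.length_cons, pow_succ]; ring
    split_ifs with h
    · rw [derivative_C_mul, eval_mul, eval_C, (list_prod_polynomial _ g _).2.2, hprod]; ring
    -- The constant term is excluded from the candidate value, and it has no variable to contribute
    -- to the derivative.
    · have : l t = [] := List.length_eq_zero_iff.1 (by omega)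
      simp [this]
  obtain ⟨j, hj, h⟩ := hc p hdeg
  refine ⟨j, hj, ?_⟩
  rw [heval, hder] at h
  rwa [abs_of_nonneg (Finset.sum_nonneg fun _ _ => abs_nonneg _)] at h

/-! ### Running the whole program -/

/-- The program draws no random numbers. -/
def Program.drawFree : Program → Bool
  | .instr (.realRandom _) => false
  | .instr _ => true
  | .seq p q => p.drawFree && q.drawFree
  | .ifThenElse _ p q => p.drawFree && q.drawFree
  | .whileDo _ p => p.drawFree

/-- Only the drawing instruction looks at the tape. Therefore the selected Bloch vectors do not
depend on the tape, and all draws are left for the independent rounding. -/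
theorem Runs.of_drawFree {inp : Input} {ω ω' : Tape} {p : Program} {c c' : Config} {t : ℕ}
    (hp : p.drawFree = true) (h : Runs inp ω p c c' t) :
    Runs inp ω' p c c' t ∧ c'.drawn = c.drawn := by
  induction h with
  | instr i s =>
    cases i with
    | realRandom a => simp [Program.drawFree] at hp
    | _ => exact ⟨Runs.instr _ _, rfl⟩
  | seq _ _ ih ih' =>
    simp only [Program.drawFree, Bool.and_eq_true] at hp
    exact ⟨.seq (ih hp.1).1 (ih' hp.2).1, (ih' hp.2).2.trans (ih hp.1).2⟩
  | ifTrue hb _ ih =>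
    simp only [Program.drawFree, Bool.and_eq_true] at hp
    exact ⟨.ifTrue hb (ih hp.1).1, (ih hp.1).2⟩
  | ifFalse hb _ ih =>
    simp only [Program.drawFree, Bool.and_eq_true] at hp
    exact ⟨.ifFalse hb (ih hp.2).1, (ih hp.2).2⟩
  | whileTrue hb _ _ ih ih' =>
    have hp' := hp
    simp only [Program.drawFree] at hp'
    exact ⟨.whileTrue hb (ih hp').1 (ih' hp).1, (ih' hp).2.trans (ih hp').2⟩
  | whileFalse hb => exact ⟨.whileFalse hb, rfl⟩

theorem drawFree_candidatesProgram (j : ℕ) : (candidatesProgram j).drawFree = true := by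
  induction j with
  | zero => rfl
  | succ j ih =>
    have : (candidateProgram j).drawFree = true := rfl
    rw [candidatesProgram, Program.drawFree, ih, this]
    rfl

theorem drawFree_selectProgram (k : ℕ) : (selectProgram k).drawFree = true := by
  have h : ∀ p q : Program, p.drawFree = true → q.drawFree = true →
      (Program.seq p q).drawFree = true := by
    intro p q hp hq; rw [Program.drawFree, hp, hq]; rfl
  exact h _ _ rfl (h _ _ rfl (h _ _ rfl (h _ _ rfl (drawFree_candidatesProgram _))))

theorem halts_selectProgram {inp : Input} {ω : Tape} {k n m : ℕ} {l : ℕ → List ℕ} {a : ℕ → ℝ}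
    {pos : ℕ → ℕ} (hn : 1 ≤ n) (hin : ReadsTerms k n m l a pos inp) :
    Halts inp ω (selectProgram k)
      (20 + ((200 * n + 1) + ((m * (k * (201 * k + 201) + 101) + 101) +
        ((404 * n + 202 * (4 * n + k * k * m) + 100) +
          ((k + 1) * (m * (k * 51 + 61) + 40) + 10)))))
      (fun s => ∃ Y S : ℕ → ℝ, Selected n m l a Y S (k + 1) s ∧
        (∀ x < 4 * n, Y x = 1 ∨ Y x = -1) ∧
        (∀ v < 4 * n, S v =
          doneSum l (fun t => a t / 6 ^ (l t).length * ((l t).map Y).prod) v m 0) ∧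
        1 / 5 ^ k / 2 * ∑ v ∈ Finset.range (4 * n),
            Real.sqrt (doneSum l (fun t => (a t / 6 ^ (l t).length) ^ 2) v m 0) ≤
          ∑ v ∈ Finset.range (4 * n), |S v|) Memory.init := by
  refine Halts.seq_of (halts_setupProgram hin.nats_zero hin.nats_one) fun s1 h1 => ?_
  refine Halts.seq_of (halts_rootsProgram h1) fun s2 h2 => ?_
  refine Halts.seq_of (halts_buildProgram hn hin h2.isTrie h2.consts h2.nr_acc h2.S h2.Q h2.T) ?_
  rintro s3 ⟨cnt, path, hb, hcnt⟩
  refine Halts.seq_of ((halts_signProgram hb).mono (by omega) fun _ h => h) ?_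
  rintro s4 ⟨g1, g2, g3, g4⟩
  refine (halts_candidatesProgram hin ⟨g1, rfl, rfl⟩ (k + 1)).mono le_rfl fun s5 h5 => ?_
  exact ⟨_, _, h5, g2, g3, g4⟩

theorem abs_candidate_le {Y S : ℕ → ℝ} {t : ℝ} {x : ℕ} (h0 : 0 ≤ t) (h1 : t ≤ 1)
    (hY : Y x = 1 ∨ Y x = -1) : |candidate Y S t x| ≤ 1 / 3 := by
  have hy : |Y x| = 1 := by rcases hY with h | h <;> simp [h]
  rw [candidate, abs_div, abs_mul, hy, one_mul, abs_of_pos (by norm_num : (0 : ℝ) < 6)]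
  have : |if S x < 0 then 1 - t else 1 + t| ≤ 2 := by
    rw [abs_le]
    split_ifs <;> constructor <;> linarith
  linarith

theorem sum_terms_erase {n : ℕ} {α : PauliString n → ℝ} {L : List (PauliString n)}
    (hL : ListsTerms α L) {f : PauliString n → ℝ} (hf : ∀ P, α P = 0 → f P = 0) :
    ∑ t ∈ Finset.range L.length,
        (if 0 < (variableList (term L t)).length then f (term L t) else 0) =
      ∑ P ∈ Finset.univ.erase (identityString n), f P := by
  rw [sum_terms hL (f := fun P => if 0 < (variableList P).length then f P else 0)
    (by intro P hP; simp [hf P hP]), ← Finset.add_sum_erase _ _ (Finset.mem_univ (identityString n))]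
  have h0 : variableList (identityString n) = [] := by
    rw [List.eq_nil_iff_forall_not_mem]
    intro x hx
    obtain ⟨i, hi, -⟩ := mem_variableList.1 hx
    exact hi rfl
  rw [h0]
  simp only [List.length_nil, lt_irrefl, if_false, zero_add]
  apply Finset.sum_congr rfl
  intro P hP
  rw [if_pos]
  rw [List.length_pos_iff]
  intro h
  exact Finset.ne_of_mem_erase hP (variableList_injective (h.trans h0.symm))

/-- The program's evaluation, term by term over the input list, is the average energy of the rounded
state minus the Haar average. -/
theorem sum_energy_eq {n : ℕ} {α : PauliString n → ℝ} {L : List (PauliString n)}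
    (hL : ListsTerms α L) (Y S : ℕ → ℝ) (t : ℝ) :
    ∑ P, α P * ∏ i, (if P i = .I then 1 else candidateBloch Y S t i (P i)) =
      α (identityString n) + candidateValue L.length (fun i => variableList (term L i))
        (fun i => α (term L i)) Y S t := by
  rw [candidateValue, sum_terms_erase hL
    (f := fun P => α P * ((variableList P).map (candidate Y S t)).prod) (by intro P hP; simp [hP]),
    ← Finset.add_sum_erase _ _ (Finset.mem_univ (identityString n))]
  congr 1
  · simp [identityString]
  · apply Finset.sum_congr rfl
    intro P _
    rw [prod_variableList]
    rfl

theorem outputQubits_eq {n m : ℕ} {Y S : ℕ → ℝ} {t : ℝ} {ω : Tape} {s : Memory} {c : Config}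
    (h : Rounding n m Y S t ω n s) (hc : Represents s c) :
    outputQubits n c = fun i : Fin n => roundedQubit (candidateBloch Y S t i) (ω i) := by
  funext i b
  obtain ⟨h1, h2, h3, h4⟩ := h.out i i.isLt
  rw [outputQubits, hc.out]
  fin_cases b
  · simpa [roundedQubit, h1] using h2
  · simp [roundedQubit, h3, h4]

/-- The number of steps of the program, divided by `n d`. -/
def stepBound (k : ℕ) : ℕ :=
  20 + (201 + (((4 ^ k + 1) * (k * (201 * k + 201) + 101) + 101) +
    ((404 + 202 * (4 + k * k * (4 ^ k + 1)) + 100) +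
      ((k + 1) * ((4 ^ k + 1) * (k * 51 + 61) + 40) + 10)))) + 222

/-- The time is affine in `n` and `m` for fixed `k`, so every summand is at most a multiple of `N`,
to be taken as `n d`. -/
theorem steps_le {k n m N : ℕ} (hn : n ≤ N) (hN : 1 ≤ N) (hm : m ≤ (4 ^ k + 1) * N) :
    20 + ((200 * n + 1) + ((m * (k * (201 * k + 201) + 101) + 101) +
        ((404 * n + 202 * (4 * n + k * k * m) + 100) +
          ((k + 1) * (m * (k * 51 + 61) + 40) + 10)))) + (n * 201 + 21) ≤ stepBound k * N := by
  calc _ ≤ 20 * N + ((200 * N + 1 * N) + (((4 ^ k + 1) * N * (k * (201 * k + 201) + 101) +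
          101 * N) + ((404 * N + 202 * (4 * N + k * k * ((4 ^ k + 1) * N)) + 100 * N) +
          ((k + 1) * ((4 ^ k + 1) * N * (k * 51 + 61) + 40 * N) + 10 * N)))) +
          (N * 201 + 21 * N) := by
        gcongr <;> omega
    _ = _ := by rw [stepBound]; ring

/-- Three separate losses: `S₂ / N ≤ 1`, `S₂ ≤ S₁` and `√D ≤ D`. The case `N = 0` is covered because
division by 0 gives 0. -/
theorem margin_le {S₁ S₂ C D : ℝ} {N : ℕ} (hC : 0 ≤ C) (hD : 1 ≤ D) (h1 : S₂ ≤ S₁) (h0 : 0 ≤ S₂)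
    (hN : S₂ ≤ N) : C / D * S₂ * (S₂ / N) ≤ C / Real.sqrt D * S₁ := by
  have hs : 1 ≤ Real.sqrt D := Real.one_le_sqrt.2 hD
  have hsD : Real.sqrt D ≤ D := by
    rw [Real.sqrt_le_left (by linarith)]; nlinarith
  have h2 : S₂ / N ≤ 1 := div_le_one_of_le₀ hN (Nat.cast_nonneg _)
  calc C / D * S₂ * (S₂ / N) ≤ C / D * S₂ * 1 := by gcongr
    _ = C / D * S₂ := mul_one _
    _ ≤ C / Real.sqrt D * S₁ := by gcongr

/-- The input is processed in time, and the state is good for one of the two optimization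
problems. -/
theorem exists_final {k n d : ℕ} {c : ℝ} (hc0 : 0 < c)
    (hc : ∀ p : Polynomial ℝ, p.natDegree ≤ k →
      ∃ j ≤ k, c * |p.derivative.eval 0| ≤ |p.eval (1 / ((j : ℝ) + 1))|)
    (hn : 1 ≤ n) (hd : 1 ≤ d) {α : PauliString n → ℝ} (hα : IsLocal k α)
    (hdeg : HasDegreeAtMost k d (hamiltonian α)) {L : List (PauliString n)}
    (hL : ListsTerms α L) :
    ∃ (final : Tape → Config) (m : Fin n → Pauli → ℝ) (g : ℝ),
      (∀ ω, ∃ t, t ≤ stepBound k * (n * d) ∧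
        Runs (encodeHamiltonian α L) ω (optimizeProgram k) Config.init (final ω) t) ∧
      (∀ ω, outputQubits n (final ω) = fun i => roundedQubit (m i) (ω i)) ∧
      (∀ i p, p ≠ .I → |m i p| ≤ 1 / 3) ∧
      ∑ P, α P * ∏ i, (if P i = .I then 1 else m i (P i)) = α (identityString n) + g ∧
      c / (2 * 5 ^ k * 6 ^ k * Real.sqrt (4 ^ k)) / Real.sqrt d *
        ∑ P ∈ Finset.univ.erase (identityString n), |α P| ≤ |g| := by
  have hin := readsTerms_encodeHamiltonian hα hL
  have hnd : ∀ t < L.length, (variableList (term L t)).Nodup :=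
    fun t ht => (hin.sorted t ht).imp fun h => ne_of_lt h
  -- The selection is run once, on the zero tape; being free of draws, the same run is valid for
  -- every tape.
  obtain ⟨s, t, ht, ⟨Y, S, hsel, hY, hS, hbound⟩, hr⟩ :=
    halts_selectProgram (ω := fun _ => 0) hn hin
  obtain ⟨c', hc', hruns⟩ := hr _ represents_init
  have hfree := drawFree_selectProgram k
  have hdrawn : s.drawn = 0 := by
    rw [← hc'.drawn, (hruns.of_drawFree (ω' := fun _ => 0) hfree).2]; rfl
  have hround : ∀ ω : Tape, ∃ (e : Config) (t' : ℕ), t' ≤ n * 201 + 21 ∧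
      Runs (encodeHamiltonian α L) ω roundingProgram c' e t' ∧
      outputQubits n e = fun i : Fin n => roundedQubit (candidateBloch Y S (s.rr .bt) i) (ω i) := by
    intro ω
    obtain ⟨s', t', ht', hs', hr'⟩ := halts_roundingProgram (inp := encodeHamiltonian α L) (ω := ω)
      hsel.signed rfl hdrawn
    obtain ⟨e, he, hrun⟩ := hr' _ hc'
    exact ⟨e, t', ht', hrun, outputQubits_eq hs' he⟩
  choose final t' ht' hrun hout using hround
  refine ⟨final, fun i => candidateBloch Y S (s.rr .bt) i, _, ?_, hout, ?_,
    sum_energy_eq hL Y S _, ?_⟩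
  · intro ω
    refine ⟨t + t' ω, ?_, .seq (hruns.of_drawFree hfree).1 (hrun ω)⟩
    refine (Nat.add_le_add ht (ht' ω)).trans (steps_le ?_ ?_ ?_)
    · exact Nat.le_mul_of_pos_right n hd
    · exact Nat.mul_pos hn hd
    · refine (length_le_of_listsTerms hdeg hL).trans ?_
      have := Nat.mul_pos hn hd
      -- The identity term is absorbed using `1 ≤ n d`, whence the factor `4 ^ k + 1` in
      -- `stepBound`.
      calc n * (d * 4 ^ k) + 1 ≤ n * (d * 4 ^ k) + n * d := by omega
        _ = _ := by ring
  · intro i p _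
    apply abs_candidate_le hsel.nonneg hsel.le_one
    apply hY
    have := p.code_lt
    have := i.isLt
    omega
  · obtain ⟨j, hj, hcand⟩ := exists_candidate_bound hc hnd hin.lt hin.length_le hS
    -- The interpolation bound holds for some `j ≤ k`, and all `k + 1` parameters were tried, so the
    -- retained candidate is at least as good.
    have h1 := (hcand.trans (hsel.le_best j (by omega))).trans hsel.best_le
    refine le_trans ?_ h1
    have h2 := sum_abs_le_sum_sqrt hnd hin.lt hin.length_le
      (card_terms_with_variable_le hdeg hL) fun t => α (term L t)
    rw [sum_terms_erase hL (f := fun P => |α P|) (by intro P hP; simp [hP])] at h2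
    refine le_trans ?_ (mul_le_mul_of_nonneg_left hbound hc0.le)
    push_cast at h2
    rw [Real.sqrt_mul (Nat.cast_nonneg _)] at h2
    have hd0 : 0 < Real.sqrt d := Real.sqrt_pos.2 (by exact_mod_cast hd)
    have h4 : 0 < Real.sqrt (4 ^ k) := Real.sqrt_pos.2 (by positivity)
    calc _ ≤ c / (2 * 5 ^ k * 6 ^ k * Real.sqrt (4 ^ k)) / Real.sqrt d * _ :=
          mul_le_mul_of_nonneg_left h2 (by positivity)
      _ = _ := by field_simp

end LocalHam

/-! ### The corollary -/

theorem mainTheorem10 (k : ℕ) :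
    ∃ (prog : Program) (C : ℝ) (K : ℕ), 0 < C ∧
      ∀ (n d : ℕ), 1 ≤ n → 1 ≤ d →
      ∀ α : PauliString n → ℝ, IsLocal k α → HasDegreeAtMost k d (hamiltonian α) →
        (∀ P, |α P| ≤ 1) →
        (∀ L : List (PauliString n), ListsTerms α L →
          ∃ final : Tape → Config,
            (∀ ω, ∃ t, t ≤ K * (n * d) ∧
              Runs (encodeHamiltonian α L) ω prog Config.init (final ω) t) ∧
            (∀ ω i, ∑ b, ‖outputQubits n (final ω) i b‖ ^ 2 = 1) ∧
            MeasureTheory.Integrable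
              (fun ω => energy (hamiltonian α) (productState (outputQubits n (final ω)))) tapeLaw ∧
            ((∫ ω, energy (hamiltonian α) (productState (outputQubits n (final ω))) ∂tapeLaw) ≥
                haarEnergy (hamiltonian α) +
                  C / Real.sqrt d * ∑ P ∈ Finset.univ.erase (identityString n), |α P| ∨
              (∫ ω, energy (hamiltonian α) (productState (outputQubits n (final ω))) ∂tapeLaw) ≤
                haarEnergy (hamiltonian α) -
                  C / Real.sqrt d * ∑ P ∈ Finset.univ.erase (identityString n), |α P|)) ∧
        C / Real.sqrt d * ∑ P ∈ Finset.univ.erase (identityString n), |α P| ≥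
          C / d * (∑ P ∈ Finset.univ.erase (identityString n), α P ^ 2) *
            ((∑ P ∈ Finset.univ.erase (identityString n), α P ^ 2) /
              ((Finset.univ.erase (identityString n)).filter fun P => α P ≠ 0).card) := by
  obtain ⟨c, hc0, hc⟩ := exists_abs_derivative_le k
  -- In the constant, `c` comes from interpolation, `2 * 5 ^ k` from the potential, `6 ^ k` from the
  -- scaling of the variables and `√(4 ^ k)` from the number of terms per variable.
  refine ⟨optimizeProgram k, c / (2 * 5 ^ k * 6 ^ k * Real.sqrt (4 ^ k)), stepBound k, ?_, ?_⟩
  · have : 0 < Real.sqrt (4 ^ k) := Real.sqrt_pos.2 (by positivity)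
    positivity
  intro n d hn hd α hα hdeg h1
  refine ⟨?_, ?_⟩
  · intro L hL
    obtain ⟨final, m, g, hrun, hout, hm, hsum, hg⟩ := exists_final hc0 hc hn hd hα hdeg hL
    obtain ⟨hint, hval⟩ := integral_energy_rounded hm α
    refine ⟨final, hrun, ?_, ?_, ?_⟩
    · intro ω i
      rw [hout]
      exact sum_norm_sq_roundedQubit _ _
    · simpa only [hout] using hint
    · simp only [hout]
      rw [hval, hsum, haarEnergy_hamiltonian]
      -- The sign of the deviation `g` from the Haar average decides which alternative holds.
      rcases le_abs.1 hg with h | h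
      · left; linarith
      · right; linarith
  · have hsq : ∀ P, α P ^ 2 ≤ |α P| := by
      intro P
      rw [← sq_abs]
      nlinarith [abs_nonneg (α P), h1 P]
    apply margin_le
    · positivity
    · exact_mod_cast hd
    · exact Finset.sum_le_sum fun P _ => hsq P
    · exact Finset.sum_nonneg fun P _ => sq_nonneg _
    -- Only nonzero coefficients contribute, each at most 1 because `|α P| ≤ 1`.
    · rw [← Finset.sum_filter_of_ne (p := fun P => α P ≠ 0)
        (fun P _ h => by simpa using h), ← nsmul_one, ← Finset.sum_const]
      exact Finset.sum_le_sum fun P _ => (hsq P).trans (h1 P)
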